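/- **Setting.** Let $d\ge1$, $\mathfrak s\in[1,\infty)^d$, $\ell>0$, $|\mathfrak s|=\sum_i\mathfrak s_i$, $\|x\|_{\mathfrak s}=\sum_i|x_i|^{1/\mathfrak s_i}$, $t^{\pm\mathfrak s/\ell}x=(t^{\pm\mathfrak s_i/\ell}x_i)_i$, let $G:\mathbb R^d\to[0,\infty)$ be measurable and $G_t(x)=t^{-|\mathfrak s|/\ell}G(t^{-\mathfrak s/\ell}x)$. A continuous $w:\mathbb R^d\to(0,1]$ is a *$G$-controlled weight* with associated continuous function $w^*:\mathbb R^d\to[1,\infty)$ if $w(x+y)\le w^*(x)w(y)$ for all $x,y$ and $\sup_{0<t\le T}\sup_x\|x\|_{\mathfrak s}^n\,w^*(t^{\mathfrak s/\ell}x)G(x)<\infty$ for all $n\in\mathbb N$, $T>0$. Let $\{Q_t\}_{t>0}$ be a *$G$-type semigroup*: continuous kernels on $\mathbb R^d\times\mathbb R^d$ with $\int Q_{t-s}(x,z)Q_s(z,y)\,dz=Q_t(x,y)$ for $0<s<t$, $\lim_{t\downarrow0}\int Q_t(x,y)\,dy=1$, $|Q_t(x,y)|\le C_1G_t(x-y)$,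 differentiable in $t$ with $|\partial_tQ_t(x,y)|\le C_2t^{-1}G_t(x-y)$. Write $Q_tf(x)=Q_t(x,f)=\int Q_t(x,y)f(y)\,dy$. Let $\varphi(x)=|x_1|^{1/\mathfrak s_1}\wedge1$, $\varphi(x,y)=\varphi(x)\wedge\varphi(y)$, $D=(\mathbb R\setminus\{0\})\times\mathbb R^{d-1}$. **Besov spaces.** For a $G$-controlled weight $w$ let $C(w)$ be the space of continuous $f$ with $fw$ bounded. For $\alpha\le0$ let $\|f\|_{C^{\alpha,Q}(w)}=\sup_{0<t\le1}t^{-\alpha/\ell}\|wQ_tf\|_{L^\infty}$, and let $\overline{C}^{\alpha,Q}(w)$ be the completion of $C(w)$ under this norm, to which $Q_t$, $0<t\le 1$, extends continuously; these spaces increase as $\alpha$ decreases, an element $\Lambda$ being determined by the family $(Q_t\Lambda)_{0<t\le1}$. Let $C^{\alpha,Q}(w)$ be the space of all $\Lambda\in\bigcap_{\alpha'<\alpha}\overline{C}^{\alpha',Q}(w)$ with $\|\Lambda\|_{C^{\alpha,Q}(w)}<\infty$; it contains $\overline C^{\alpha,Q}(w)$. **Models.** Let $\mathscr T=(\mathbf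 A,\mathbf T,\mathbf G)$ be a regularity structure: $\mathbf A\subset\mathbb R$ is nonempty, locally finite and bounded below, $\alpha_0=\min\mathbf A$, $\mathbf T=\bigoplus_{\alpha\in\mathbf A}\mathbf T_\alpha$ is an algebraic sum of Banach spaces, and $\mathbf G$ is a group of continuous linear operators on $\mathbf T$ with $(\Gamma-\mathrm{id})\mathbf T_\alpha\subset\mathbf T_{<\alpha}$. Write $\|\tau\|_\alpha$ for the norm of the $\mathbf T_\alpha$-component of $\tau$. Let $w,v$ be $G$-controlled weights such that $wv$ is $G$-controlled with $(wv)^*=w^*v^*$. Assume that there are $G$-controlled weights $w_1,w_2$ with $ww_1,ww_2$ $G$-controlled and $\sup_x\|x\|_{\mathfrak s}^nw^*(x)w_1(x)+\sup_x\|x\|_{\mathfrak s}^nw_1^*(x)w_2(x)<\infty$ for all $n\in\mathbb N$; fix them. A *smooth model* is a pair of families of continuous linear operators $\Pi_x:\mathbf T\to C(w)$ and $\Gamma_{xy}\in\mathbf G$ with $\Pi_x\Gamma_{xy}=\Pi_y$, $\Gamma_{xx}=\mathrm{id}$, $\Gamma_{xy}\Gamma_{yz}=\Gamma_{xz}$ such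 that for all $\gamma\in\mathbb R$ the quantities $$\|\Pi\|_{\gamma,w}=\max_{\alpha<\gamma}\sup_{0<t\le1,\,x,\,\tau\in\mathbf T_\alpha\setminus\{0\}}t^{-\alpha/\ell}w(x)\frac{|Q_t(x,\Pi_x\tau)|}{\|\tau\|_\alpha},\qquad \|\Gamma\|_{\gamma,w}=\max_{\beta<\alpha<\gamma}\sup_{x\ne y,\,\tau\in\mathbf T_\alpha\setminus\{0\}}\frac{w(x)\|\Gamma_{yx}\tau\|_\beta}{w^*(y-x)\|y-x\|_{\mathfrak s}^{\alpha-\beta}\|\tau\|_\alpha}$$ are finite. $\mathscr M_w(\mathscr T)$ is the completion of the set of smooth models under the pseudo-metrics $\|\Pi-\Pi'\|_{\gamma,w}+\|\Gamma-\Gamma'\|_{\gamma,w}$, $\gamma\in\mathbb R$; for a model $M=(\Pi,\Gamma)$ in it, $\Pi_x\tau\in\overline C^{\alpha_0\wedge0,Q}(ww_1)$. Write $|||M|||_{\gamma,w}=\|\Pi\|_{\gamma,w}+\|\Gamma\|_{\gamma,w}$. **Singular modelled distributions.** For $f:D\to\mathbf T_{<\gamma}$ let $\Delta^\Gamma_{yx}f=f(y)-\Gamma_{yx}f(x)$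 and $$(\!|f|\!)_{\gamma,\eta,v}=\max_{\alpha<\gamma}\sup_{x\in D}\frac{v(x)\|f(x)\|_\alpha}{\varphi(x)^{(\eta-\alpha)\wedge0}},\qquad \|f\|^\#_{\gamma,\eta,v}=\max_{\alpha<\gamma}\sup_{x\ne y\in D}\frac{v(x)\|\Delta^\Gamma_{yx}f\|_\alpha}{\varphi(x,y)^{\eta-\gamma}v^*(x-y)\|y-x\|_{\mathfrak s}^{\gamma-\alpha}},$$ $|||f|||^\#=(\!|f|\!)+\|f\|^\#$, and let $\mathcal D^{\gamma,\eta}_v(\Gamma)^\#$ be the set of $f$ with $|||f|||^\#_{\gamma,\eta,v}<\infty$. For $f^{(i)}\in\mathcal D_v^{\gamma,\eta}(\Gamma^{(i)})^\#$, $i=1,2$, let $\|f^{(1)};f^{(2)}\|^\#$ be defined like $\|f\|^\#$ with $\Delta^{\Gamma^{(1)}}_{yx}f^{(1)}-\Delta^{\Gamma^{(2)}}_{yx}f^{(2)}$ in place of $\Delta^\Gamma_{yx}f$, and $|||f^{(1)};f^{(2)}|||^\#=(\!|f^{(1)}-f^{(2)}|\!)+\|f^{(1)};f^{(2)}\|^\#$.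 For $\zeta\le0$, $\Lambda\in C^{\zeta,Q}(wv)$ is a *reconstruction* of $f$ for $M$ if $$[\![\Lambda]\!]_{\gamma,\eta,wv}=\sup_{0<t\le1}\sup_{x\in D}t^{-\gamma/\ell}\varphi(x)^{\gamma-\eta}(wv)(x)|Q_t(x,\Lambda_x)|<\infty,\qquad\Lambda_x=\Lambda-\Pi_xf(x),$$ and $[\![\Lambda^{(1)};\Lambda^{(2)}]\!]$ is defined in the same way with $\Lambda^{(1)}_x-\Lambda^{(2)}_x$ in place of $\Lambda_x$. **Theorem.** Let $\gamma>0$, $\eta\in(\gamma-\mathfrak s_1,\gamma]$ and $\zeta=\eta\wedge\alpha_0\wedge0$. For every $M=(\Pi,\Gamma)\in\mathscr M_w(\mathscr T)$ and $f\in\mathcal D^{\gamma,\eta}_v(\Gamma)^\#$ there is a unique reconstruction $\mathcal Rf\in C^{\zeta,Q}(wv)$ of $f$ for $M$. There is a constant $C$, independent of $M$ and $f$, such that $$\|\mathcal Rf\|_{C^{\zeta,Q}(wv)}\le C\|\Pi\|_{\gamma,w}|||f|||^\#_{\gamma,\eta,v},\qquad[\![\mathcal Rf]\!]_{\gamma,\eta,wv}\le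 C\|\Pi\|_{\gamma,w}\|f\|^\#_{\gamma,\eta,v}.$$ Moreover, there is an affine function $R\mapsto C_R$, positive for $R>0$, such that for all $R>0$, all $M^{(i)}=(\Pi^{(i)},\Gamma^{(i)})\in\mathscr M_w(\mathscr T)$ and $f^{(i)}\in\mathcal D_v^{\gamma,\eta}(\Gamma^{(i)})^\#$, $i=1,2$, with $|||M^{(i)}|||_{\gamma,w}\le R$ and $|||f^{(i)}|||^\#_{\gamma,\eta,v}\le R$, $$\|\mathcal Rf^{(1)}-\mathcal Rf^{(2)}\|_{C^{\zeta,Q}(wv)}\le C_R\big(\|\Pi^{(1)}-\Pi^{(2)}\|_{\gamma,w}+|||f^{(1)};f^{(2)}|||^\#_{\gamma,\eta,v}\big),$$ $$[\![\mathcal Rf^{(1)};\mathcal Rf^{(2)}]\!]_{\gamma,\eta,wv}\le C_R\big(\|\Pi^{(1)}-\Pi^{(2)}\|_{\gamma,w}+\|f^{(1)};f^{(2)}\|^\#_{\gamma,\eta,v}\big).$$ -/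

import Mathlib

open Set Filter Topology MeasureTheory
open scoped NNReal ENNReal DirectSum

universe u

noncomputable section

/-! ### Anisotropic scaling -/

/-- The scaled size `‖x‖_𝔰 = ∑ᵢ |xᵢ|^{1/𝔰ᵢ}`. -/
def scaledNorm {d : ℕ} (s : Fin d → ℝ) (x : Fin d → ℝ) : ℝ :=
  ∑ i, |x i| ^ (1 / s i)

/-- The dilation `t^{𝔰/ℓ} x = (t^{𝔰ᵢ/ℓ} xᵢ)ᵢ`. -/
def scaledDil {d : ℕ} (s : Fin d → ℝ) (ℓ t : ℝ) (x : Fin d → ℝ) : Fin d → ℝ :=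
  fun i => t ^ (s i / ℓ) * x i

/-- `G_t(x) = t^{-|𝔰|/ℓ} G(t^{-𝔰/ℓ} x)`. -/
def scaledKernel {d : ℕ} (s : Fin d → ℝ) (ℓ : ℝ) (G : (Fin d → ℝ) → ℝ) (t : ℝ)
    (x : Fin d → ℝ) : ℝ :=
  t ^ (-(∑ i, s i) / ℓ) * G (fun i => t ^ (-(s i) / ℓ) * x i)

/-- `φ(x) = |x₁|^{1/𝔰₁} ∧ 1`, the first coordinate being the temporal one. -/
def temporalWeight {d : ℕ} [NeZero d] (s : Fin d → ℝ) (x : Fin d → ℝ) : ℝ :=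
  min (|x 0| ^ (1 / s 0)) 1

/-- The domain `(ℝ ∖ {0}) × ℝ^{d-1}`. -/
abbrev OffPlane (d : ℕ) [NeZero d] : Type := {x : Fin d → ℝ // x 0 ≠ 0}

/-! ### Weights and semigroups -/

/-- `w` is a `G`-controlled weight, `ws` being its associated function `w^*`. -/
structure GControlled {d : ℕ} (s : Fin d → ℝ) (ℓ : ℝ) (G w ws : (Fin d → ℝ) → ℝ) : Prop where
  continuous_weight : Continuous w
  pos : ∀ x, 0 < w x
  le_one : ∀ x, w x ≤ 1
  continuous_star : Continuous ws
  one_le_star : ∀ x, 1 ≤ ws x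
  moderate : ∀ x y, w (x + y) ≤ ws x * w y
  controlled : ∀ (n : ℕ) (T : ℝ), 0 < T → ∃ B : ℝ, ∀ t ∈ Ioc (0 : ℝ) T, ∀ x,
    scaledNorm s x ^ n * ws (scaledDil s ℓ t x) * G x ≤ B

/-- `{Q_t}_{t>0}` is a `G`-type semigroup (only positive times matter). -/
structure IsGTypeSemigroup {d : ℕ} (s : Fin d → ℝ) (ℓ : ℝ) (G : (Fin d → ℝ) → ℝ)
    (Q : ℝ → (Fin d → ℝ) → (Fin d → ℝ) → ℝ) : Prop where
  continuous_kernel : ∀ t, 0 < t → Continuous (Function.uncurry (Q t))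
  semigroup : ∀ r t, 0 < r → r < t → ∀ x y, ∫ z, Q (t - r) x z * Q r z y = Q t x y
  conservative : ∀ x, Tendsto (fun t => ∫ y, Q t x y) (𝓝[>] 0) (𝓝 1)
  upper_bound : ∃ C : ℝ, 0 < C ∧ ∀ t, 0 < t → ∀ x y,
    |Q t x y| ≤ C * scaledKernel s ℓ G t (x - y)
  differentiable : ∀ t, 0 < t → ∀ x y, DifferentiableAt ℝ (fun r => Q r x y) t
  deriv_bound : ∃ C : ℝ, 0 < C ∧ ∀ t, 0 < t → ∀ x y,
    |deriv (fun r => Q r x y) t| ≤ C * t⁻¹ * scaledKernel s ℓ G t (x - y)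

/-! ### Besov spaces associated with the semigroup -/

/-- `f ∈ C(w)`: `f` is continuous and `f w` is bounded. -/
def MemCw {d : ℕ} (w f : (Fin d → ℝ) → ℝ) : Prop :=
  Continuous f ∧ ∃ B : ℝ, ∀ x, |f x| * w x ≤ B

/-- Families `(t, x) ↦ (Q_t Λ)(x)` indexed by `t ∈ (0,1]`. -/
abbrev QFamily (d : ℕ) : Type := Ioc (0 : ℝ) 1 → (Fin d → ℝ) → ℝ

/-- The family `(t, x) ↦ (Q_t f)(x) = ∫ Q_t(x,y) f(y) dy` of a function `f`. -/
def toQFamily {d : ℕ} (Q : ℝ → (Fin d → ℝ) → (Fin d → ℝ) → ℝ) (f : (Fin d → ℝ) → ℝ) :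
    QFamily d :=
  fun t x => ∫ y, Q t x y * f y

/-- The Besov norm `sup_{0<t≤1} t^{-α/ℓ} ‖Q_t Λ‖_{L^∞(w)}` of the family `Λ_t = Q_t Λ`
(the functions `Q_t Λ` being continuous, the essential supremum is a supremum). -/
def besovNorm {d : ℕ} (ℓ α : ℝ) (w : (Fin d → ℝ) → ℝ) (Λ : QFamily d) : ℝ≥0∞ :=
  ⨆ t : Ioc (0 : ℝ) 1, ⨆ x, ENNReal.ofReal ((t : ℝ) ^ (-α / ℓ) * (|Λ t x| * w x))

/-- The completion of `C(w)` under the Besov norm of order `α`. By the definition of that norm,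
`f ↦ (Q_t f)_{0<t≤1}` is an isometry of `C(w)` into the Banach space of all families of finite
norm, so the completion is the closure of the image; its element `Λ` is written as the
family `(Q_t Λ)_{0<t≤1}`, `Q_t` being extended by continuity. -/
def BesovCompletion {d : ℕ} (ℓ : ℝ) (Q : ℝ → (Fin d → ℝ) → (Fin d → ℝ) → ℝ) (α : ℝ)
    (w : (Fin d → ℝ) → ℝ) : Set (QFamily d) :=
  {Λ | ∃ f : ℕ → (Fin d → ℝ) → ℝ, (∀ n, MemCw w (f n)) ∧
    Tendsto (fun n => besovNorm ℓ α w (toQFamily Q (f n) - Λ)) atTop (𝓝 0)}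

/-- The Besov space of order `α`: all distributions, that is elements of the completions of
lower orders, whose Besov norm of order `α` is finite. It contains the completion of order `α`;
an element need not be approximable by `C(w)` in the norm of order `α` itself. -/
def BesovSpace {d : ℕ} (ℓ : ℝ) (Q : ℝ → (Fin d → ℝ) → (Fin d → ℝ) → ℝ) (α : ℝ)
    (w : (Fin d → ℝ) → ℝ) : Set (QFamily d) :=
  {Λ | (∀ α' < α, Λ ∈ BesovCompletion ℓ Q α' w) ∧ besovNorm ℓ α w Λ < ⊤}

/-! ### Regularity structures and models -/

/-- A regularity structure `(A, T, G)`. The operators of the structure group act on the algebraic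
direct sum of the Banach spaces `T_α`; being triangular, such an operator is continuous
exactly when its components `T_α → T_β` are. -/
structure RegularityStructure where
  A : Set ℝ
  nonempty_A : A.Nonempty
  bddBelow_A : BddBelow A
  locallyFinite_A : ∀ a b : ℝ, (A ∩ Icc a b).Finite
  T : A → Type u
  [normedT : ∀ α, NormedAddCommGroup (T α)]
  [spaceT : ∀ α, NormedSpace ℝ (T α)]
  [completeT : ∀ α, CompleteSpace (T α)]
  G : Subgroup ((⨁ α, T α) ≃ₗ[ℝ] (⨁ α, T α))
  continuous_G : ∀ g ∈ G, ∀ α β : A,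
    Continuous fun τ : T α => (g (DirectSum.lof ℝ A T α τ)) β
  triangular_G : ∀ g ∈ G, ∀ (α : A) (τ : T α) (β : A), α ≤ β →
    (g (DirectSum.lof ℝ A T α τ) - DirectSum.lof ℝ A T α τ) β = 0

namespace RegularityStructure

attribute [instance] normedT spaceT completeT

/-- The model space `T = ⨁ T_α`. -/
abbrev Space (S : RegularityStructure.{u}) : Type u := ⨁ α, S.T α

/-- The inclusion `T_α → T`. -/
abbrev incl (S : RegularityStructure.{u}) (α : S.A) : S.T α →ₗ[ℝ] S.Space :=
  DirectSum.lof ℝ S.A S.T α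

/-- The regularity `α₀`, the smallest element of `A`. -/
def regularity (S : RegularityStructure.{u}) : ℝ := sInf S.A

end RegularityStructure

/-- `‖Π‖_{γ,w} = max_{α<γ} sup_{t,x,τ} t^{-α/ℓ} w(x) |Q_t(x, Π_x τ)| / ‖τ‖_α`, where `P x τ` is
the family of `Π_x τ`, so that `P x τ t x = Q_t(x, Π_x τ)`. -/
def piNorm {d : ℕ} (S : RegularityStructure.{u}) (ℓ : ℝ) (w : (Fin d → ℝ) → ℝ) (γ : ℝ)
    (P : (Fin d → ℝ) → S.Space → QFamily d) : ℝ≥0∞ :=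
  ⨆ (α : S.A) (_ : (α : ℝ) < γ) (t : Ioc (0 : ℝ) 1) (x : Fin d → ℝ) (τ : S.T α) (_ : τ ≠ 0),
    ENNReal.ofReal ((t : ℝ) ^ (-(α : ℝ) / ℓ) * w x * (|P x (S.incl α τ) t x| / ‖τ‖))

/-- `‖Γ‖_{γ,w}`, the largest of the suprema over `β < α < γ` of
`w(x) ‖Γ_{yx} τ‖_β / (w^*(y-x) ‖y-x‖_𝔰^{α-β} ‖τ‖_α)`. -/
def gammaNorm {d : ℕ} (S : RegularityStructure.{u}) (s : Fin d → ℝ)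
    (w ws : (Fin d → ℝ) → ℝ) (γ : ℝ)
    (Γ : (Fin d → ℝ) → (Fin d → ℝ) → S.Space →ₗ[ℝ] S.Space) : ℝ≥0∞ :=
  ⨆ (α : S.A) (β : S.A) (_ : β < α) (_ : (α : ℝ) < γ) (x : Fin d → ℝ) (y : Fin d → ℝ)
    (_ : x ≠ y) (τ : S.T α) (_ : τ ≠ 0),
    ENNReal.ofReal (w x * ‖(Γ y x (S.incl α τ)) β‖ /
      (ws (y - x) * scaledNorm s (y - x) ^ ((α : ℝ) - β) * ‖τ‖))

/-- A smooth model: `Π_x : T → C(w)` continuous (on each `T_α`) and `Γ_{xy} ∈ G`, with the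
algebraic and the analytic conditions. -/
structure SmoothModel {d : ℕ} (S : RegularityStructure.{u}) (s : Fin d → ℝ) (ℓ : ℝ)
    (Q : ℝ → (Fin d → ℝ) → (Fin d → ℝ) → ℝ) (w ws : (Fin d → ℝ) → ℝ) where
  Pi : (Fin d → ℝ) → S.Space →ₗ[ℝ] ((Fin d → ℝ) → ℝ)
  memCw : ∀ x τ, MemCw w (Pi x τ)
  continuous_Pi : ∀ x (α : S.A), ∃ B : ℝ, ∀ (τ : S.T α) y, |Pi x (S.incl α τ) y| * w y ≤ B * ‖τ‖
  Gam : (Fin d → ℝ) → (Fin d → ℝ) → S.Space ≃ₗ[ℝ] S.Space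
  gam_mem : ∀ x y, Gam x y ∈ S.G
  pi_gam : ∀ x y τ, Pi x (Gam x y τ) = Pi y τ
  gam_self : ∀ x τ, Gam x x τ = τ
  gam_gam : ∀ x y z τ, Gam x y (Gam y z τ) = Gam x z τ
  piNorm_lt_top : ∀ γ : ℝ, piNorm S ℓ w γ (fun x τ => toQFamily Q (Pi x τ)) < ⊤
  gammaNorm_lt_top : ∀ γ : ℝ,
    gammaNorm S s w ws γ (fun x y => (Gam x y : S.Space →ₗ[ℝ] S.Space)) < ⊤

/-- A model `(Π, Γ)`: an element of the completion of the smooth models under the pseudo-metrics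
`‖Π - Π'‖_{γ,w} + ‖Γ - Γ'‖_{γ,w}`, all `γ`. It is written as the pair of the limits of the
operators of an approximating sequence: the limits `Γ_{xy}`, and the limits `Π_x τ` in the
completion of `C(w w₁)` under the Besov norm of order `α₀ ∧ 0`, which are given by
their families `(Q_t Π_x τ)_{0<t≤1}`. -/
structure Model {d : ℕ} (S : RegularityStructure.{u}) (s : Fin d → ℝ) (ℓ : ℝ)
    (Q : ℝ → (Fin d → ℝ) → (Fin d → ℝ) → ℝ) (w ws w₁ : (Fin d → ℝ) → ℝ) where
  Pi : (Fin d → ℝ) → S.Space →ₗ[ℝ] QFamily d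
  Gam : (Fin d → ℝ) → (Fin d → ℝ) → S.Space →ₗ[ℝ] S.Space
  isLimit : ∃ M : ℕ → SmoothModel S s ℓ Q w ws,
    (∀ γ : ℝ, Tendsto (fun n =>
        piNorm S ℓ w γ (fun x τ => toQFamily Q ((M n).Pi x τ) - Pi x τ)
          + gammaNorm S s w ws γ
            (fun x y => ((M n).Gam x y : S.Space →ₗ[ℝ] S.Space) - Gam x y))
        atTop (𝓝 0)) ∧
    (∀ x τ, Tendsto (fun n => besovNorm ℓ (min S.regularity 0) (w * w₁)
        (toQFamily Q ((M n).Pi x τ) - Pi x τ)) atTop (𝓝 0)) ∧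
    (∀ x y τ β, Tendsto (fun n => ((M n).Gam x y τ) β) atTop (𝓝 ((Gam x y τ) β)))

namespace Model

variable {d : ℕ} {S : RegularityStructure.{u}} {s : Fin d → ℝ} {ℓ : ℝ}
  {Q : ℝ → (Fin d → ℝ) → (Fin d → ℝ) → ℝ} {w ws w₁ : (Fin d → ℝ) → ℝ}

/-- `‖Π‖_{γ,w}`. -/
def normPi (M : Model S s ℓ Q w ws w₁) (γ : ℝ) : ℝ≥0∞ :=
  piNorm S ℓ w γ (fun x τ => M.Pi x τ)

/-- `‖Π - Π'‖_{γ,w}`. -/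
def distPi (M M' : Model S s ℓ Q w ws w₁) (γ : ℝ) : ℝ≥0∞ :=
  piNorm S ℓ w γ (fun x τ => M.Pi x τ - M'.Pi x τ)

/-- `|||M|||_{γ,w} = ‖Π‖_{γ,w} + ‖Γ‖_{γ,w}`. -/
def tripleNorm (M : Model S s ℓ Q w ws w₁) (γ : ℝ) : ℝ≥0∞ :=
  M.normPi γ + gammaNorm S s w ws γ M.Gam

end Model

/-! ### Singular modelled distributions with global bounds -/

section ModelledDistributions

variable {d : ℕ} [NeZero d] (S : RegularityStructure.{u}) (s : Fin d → ℝ)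

/-- The weighted size norm of `f : (ℝ ∖ {0}) × ℝ^{d-1} → T`: the largest over `α < γ` of
`sup_x v(x) ‖f(x)‖_α / φ(x)^{(η-α) ∧ 0}`. -/
def sizeNorm (v : (Fin d → ℝ) → ℝ) (γ η : ℝ) (f : OffPlane d → S.Space) : ℝ≥0∞ :=
  ⨆ (α : S.A) (_ : (α : ℝ) < γ) (x : OffPlane d),
    ENNReal.ofReal (v x * ‖(f x) α‖ / temporalWeight s x ^ (min (η - α) 0))

/-- The increments `(x, y) ↦ Δ^Γ_{yx} f = f(y) - Γ_{yx} f(x)`. -/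
def increment {S : RegularityStructure.{u}}
    (Γ : (Fin d → ℝ) → (Fin d → ℝ) → S.Space →ₗ[ℝ] S.Space)
    (f : OffPlane d → S.Space) (x y : OffPlane d) : S.Space :=
  f y - Γ y x (f x)

/-- The global increment norm: the largest over `α < γ` of the supremum over all `x ≠ y` of
`v(x) ‖Δ_{yx}‖_α / (φ(x,y)^{η-γ} v^*(x-y) ‖y-x‖_𝔰^{γ-α})`. -/
def incrementNorm (v vs : (Fin d → ℝ) → ℝ) (γ η : ℝ)
    (Δ : OffPlane d → OffPlane d → S.Space) : ℝ≥0∞ :=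
  ⨆ (α : S.A) (_ : (α : ℝ) < γ) (x : OffPlane d) (y : OffPlane d) (_ : x ≠ y),
    ENNReal.ofReal (v x * ‖(Δ x y) α‖ /
      (min (temporalWeight s x) (temporalWeight s y) ^ (η - γ) * vs (x - y) *
        scaledNorm s (y - x) ^ (γ - α)))

/-- `‖f‖^#_{γ,η,v}`. -/
def sharpNorm (v vs : (Fin d → ℝ) → ℝ) (γ η : ℝ)
    (Γ : (Fin d → ℝ) → (Fin d → ℝ) → S.Space →ₗ[ℝ] S.Space)
    (f : OffPlane d → S.Space) : ℝ≥0∞ :=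
  incrementNorm S s v vs γ η (increment Γ f)

/-- `‖f; f'‖^#_{γ,η,v}`, for `f` and `f'` over `Γ` and `Γ'`. -/
def sharpDist (v vs : (Fin d → ℝ) → ℝ) (γ η : ℝ)
    (Γ Γ' : (Fin d → ℝ) → (Fin d → ℝ) → S.Space →ₗ[ℝ] S.Space)
    (f f' : OffPlane d → S.Space) : ℝ≥0∞ :=
  incrementNorm S s v vs γ η (increment Γ f - increment Γ' f')

/-- `|||f|||^#_{γ,η,v}`. -/
def tripleSharpNorm (v vs : (Fin d → ℝ) → ℝ) (γ η : ℝ)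
    (Γ : (Fin d → ℝ) → (Fin d → ℝ) → S.Space →ₗ[ℝ] S.Space)
    (f : OffPlane d → S.Space) : ℝ≥0∞ :=
  sizeNorm S s v γ η f + sharpNorm S s v vs γ η Γ f

/-- `|||f; f'|||^#_{γ,η,v}`. -/
def tripleSharpDist (v vs : (Fin d → ℝ) → ℝ) (γ η : ℝ)
    (Γ Γ' : (Fin d → ℝ) → (Fin d → ℝ) → S.Space →ₗ[ℝ] S.Space)
    (f f' : OffPlane d → S.Space) : ℝ≥0∞ :=
  sizeNorm S s v γ η (f - f') + sharpDist S s v vs γ η Γ Γ' f f'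

/-- The class `𝒟_v^{γ,η}(Γ)^#`: functions with values in `T_{<γ}` and `|||f|||^# < ∞`. -/
def DSharp (v vs : (Fin d → ℝ) → ℝ) (γ η : ℝ)
    (Γ : (Fin d → ℝ) → (Fin d → ℝ) → S.Space →ₗ[ℝ] S.Space) :
    Set (OffPlane d → S.Space) :=
  {f | (∀ x (α : S.A), γ ≤ α → (f x) α = 0) ∧ tripleSharpNorm S s v vs γ η Γ f < ⊤}

end ModelledDistributions

/-! ### Reconstructions -/

section Reconstruction

variable {d : ℕ} [NeZero d] {S : RegularityStructure.{u}} {s : Fin d → ℝ} {ℓ : ℝ}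
  {Q : ℝ → (Fin d → ℝ) → (Fin d → ℝ) → ℝ} {w ws w₁ : (Fin d → ℝ) → ℝ}

/-- `(t, x) ↦ Q_t(x, Λ_x)` with `Λ_x = Λ - Π_x f(x)`. -/
def localError (M : Model S s ℓ Q w ws w₁) (f : OffPlane d → S.Space) (Λ : QFamily d)
    (t : Ioc (0 : ℝ) 1) (x : OffPlane d) : ℝ :=
  Λ t x - M.Pi x (f x) t x

/-- `sup_{0<t≤1} sup_x t^{-γ/ℓ} φ(x)^{γ-η} W(x) |E(t,x)|`. -/
def localNorm (s : Fin d → ℝ) (ℓ γ η : ℝ) (W : (Fin d → ℝ) → ℝ)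
    (E : Ioc (0 : ℝ) 1 → OffPlane d → ℝ) : ℝ≥0∞ :=
  ⨆ (t : Ioc (0 : ℝ) 1) (x : OffPlane d), ENNReal.ofReal
    ((t : ℝ) ^ (-γ / ℓ) * temporalWeight s x ^ (γ - η) * W x * |E t x|)

/-- `Λ` is a reconstruction of `f` for `M` in the Besov space of order `ζ` with weight `w v`. -/
def IsReconstruction (v : (Fin d → ℝ) → ℝ) (γ η ζ : ℝ) (M : Model S s ℓ Q w ws w₁)
    (f : OffPlane d → S.Space) (Λ : QFamily d) : Prop :=
  Λ ∈ BesovSpace ℓ Q ζ (w * v) ∧ localNorm s ℓ γ η (w * v) (localError M f Λ) < ⊤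

end Reconstruction

end

/-! ### Elementary facts on the scaled size and the temporal weight -/

section ScaledSize

variable {d : ℕ} {s : Fin d → ℝ}

/-! Testing each local distribution at its own base point gives the germ F_t(x) = Q_t(x, Π_x f(x))
(`diagonalGerm`), and the proof measures how far it is from satisfying F_t = Q_{t-r} F_r. Since Π_y
f(y) obeys the semigroup identity, the defect at y is the integral of Q_{t-r}(y,z) against Q_r(z,
Π_y f(y) - Π_z f(z)), and Π_z Γ_{zy} = Π_y turns the last argument into -Π_z Δ_{zy} f. Its component
of degree α contributes r^{α/ℓ} ‖z-y‖^{γ-α}, and the kernel converts a distance into t^{1/ℓ}. For r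
between t/4 and t/2 the defect is therefore of order t^{γ/ℓ} φ(y)^{η-γ}
(`IsLocalFamily.exists_isGerm`).

The factor (φ(y) ∧ φ(z))^{η-γ} is integrable in z because γ - η < 𝔰₁. To see this quantitatively,
the kernel, together with weights and powers of the distance, is dominated by a product of Cauchy
densities (`GControlled.scaledKernel_le`). The integral then factorises, and only its temporal
factor is singular (`cauchyKernel_mul_temporalWeight`). Two bounds result
(`WeightedSemigroup.kernelMoment_le`): the singularity costs either t^{-(γ-η)/ℓ} uniformly in the
base point, which serves the Besov norm, or φ(x)^{-(γ-η)}, which serves the local norm.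

Since γ > 0, the functions Q_{t-2^{-n}} F_{2^{-n}} form a Cauchy sequence with ratio 2^{-γ/ℓ}. Their
limits Λ_t satisfy Q_{t-r} Λ_r = Λ_t and stay within order t^{γ/ℓ} φ^{η-γ} of F_t
(`IsGerm.exists_reconstruction`). A family with this semigroup property and finite norm of order ζ ≤
0 is approximated by its own members in all lower orders (`IsSemigroupFamily.mem_besovSpace`).
Uniqueness holds because the difference of two reconstructions is of order r^{γ/ℓ} φ^{η-γ} at time
r, and Λ_t = Q_{t-r} Λ_r lets r tend to zero (`IsSemigroupFamily.eq_zero`).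

The sewing is done for arbitrary families H_x with size and increment bounds (`IsLocalFamily`), not
just for those coming from a model. This gives the comparison of two models for free: Π_x f(x) -
Π'_x f'(x) is again such a family, with bounds bilinear in the data (`Model.isLocalFamily_sub`), and
by uniqueness its reconstruction is the difference of the two. The identities Π_z Γ_{zy} = Π_y and Γ
T_{<γ} ⊂ T_{<γ} hold for smooth models and are passed to the limit (`Model.pi_gam_apply`,
`Model.gam_apply_eq_zero`). -/

theorem scaledNorm_nonneg (s x : Fin d → ℝ) : 0 ≤ scaledNorm s x :=
  Finset.sum_nonneg fun _ _ => Real.rpow_nonneg (abs_nonneg _) _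

theorem abs_rpow_le_scaledNorm (s x : Fin d → ℝ) (i : Fin d) :
    |x i| ^ (1 / s i) ≤ scaledNorm s x :=
  Finset.single_le_sum (f := fun i => |x i| ^ (1 / s i))
    (fun _ _ => Real.rpow_nonneg (abs_nonneg _) _) (Finset.mem_univ i)

theorem scaledNorm_neg (s x : Fin d → ℝ) : scaledNorm s (-x) = scaledNorm s x := by
  simp [scaledNorm]

theorem scaledNorm_sub_comm (s x y : Fin d → ℝ) :
    scaledNorm s (x - y) = scaledNorm s (y - x) := by
  rw [← scaledNorm_neg, neg_sub]

theorem continuous_scaledNorm (hs : ∀ i, 1 ≤ s i) : Continuous (scaledNorm s) := by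
  unfold scaledNorm
  refine continuous_finsetSum _ fun i _ => ?_
  have h : 0 ≤ 1 / s i := by have := hs i; positivity
  exact ((continuous_apply i).abs).rpow_const fun _ => Or.inr h

theorem scaledNorm_zero (hs : ∀ i, 1 ≤ s i) : scaledNorm s 0 = 0 := by
  unfold scaledNorm
  refine Finset.sum_eq_zero fun i _ => ?_
  have h : 1 / s i ≠ 0 := by have := hs i; positivity
  simp only [Pi.zero_apply, abs_zero]
  exact Real.zero_rpow h

/-- Superadditivity of a ↦ a^{𝔰ᵢ} on [0,∞), valid as 𝔰ᵢ ≥ 1. This is how moments in the scaled size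
control the denominators of the Cauchy product. -/
theorem one_add_sq_le_one_add_scaledNorm (hs : ∀ i, 1 ≤ s i) (x : Fin d → ℝ) (i : Fin d) :
    1 + x i ^ 2 ≤ (1 + scaledNorm s x) ^ (2 * s i) := by
  have hsi := hs i
  have h0 : 0 ≤ |x i| ^ (1 / s i) := Real.rpow_nonneg (abs_nonneg _) _
  have h1 : |x i| = (|x i| ^ (1 / s i)) ^ s i := by
    rw [← Real.rpow_mul (abs_nonneg _), one_div_mul_cancel (by positivity), Real.rpow_one]
  have h2 : 1 + x i ^ 2 ≤ (1 + |x i|) ^ 2 := by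
    nlinarith [sq_abs (x i), abs_nonneg (x i)]
  have h3 : 1 + |x i| ≤ (1 + |x i| ^ (1 / s i)) ^ s i := by
    have := Real.add_rpow_le_rpow_add zero_le_one h0 hsi
    rwa [Real.one_rpow, ← h1] at this
  calc 1 + x i ^ 2 ≤ (1 + |x i|) ^ 2 := h2
    _ ≤ ((1 + |x i| ^ (1 / s i)) ^ s i) ^ 2 := by gcongr
    _ = (1 + |x i| ^ (1 / s i)) ^ (2 * s i) := by
        rw [← Real.rpow_natCast, ← Real.rpow_mul (by positivity)]; congr 1; push_cast; ring
    _ ≤ (1 + scaledNorm s x) ^ (2 * s i) := by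
        gcongr
        exact abs_rpow_le_scaledNorm s x i

theorem prod_one_add_sq_le (hs : ∀ i, 1 ≤ s i) (x : Fin d → ℝ) :
    ∏ i, (1 + x i ^ 2) ≤ (1 + scaledNorm s x) ^ (2 * ∑ i, s i) := by
  have h := scaledNorm_nonneg s x
  rw [Finset.mul_sum, Real.rpow_sum_of_pos (by positivity)]
  exact Finset.prod_le_prod (fun i _ => by positivity)
    fun i _ => one_add_sq_le_one_add_scaledNorm hs x i

theorem scaledNorm_scaledDil (hs : ∀ i, 1 ≤ s i) {ℓ t : ℝ} (ht : 0 < t) (x : Fin d → ℝ) :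
    scaledNorm s (scaledDil s ℓ t x) = t ^ (1 / ℓ) * scaledNorm s x := by
  unfold scaledNorm scaledDil
  rw [Finset.mul_sum]
  refine Finset.sum_congr rfl fun i _ => ?_
  have hsi : s i ≠ 0 := by have := hs i; positivity
  rw [abs_mul, abs_of_pos (Real.rpow_pos_of_pos ht _),
    Real.mul_rpow (Real.rpow_nonneg ht.le _) (abs_nonneg _), ← Real.rpow_mul ht.le]
  congr 2
  field_simp

variable [NeZero d]

theorem temporalWeight_nonneg (s x : Fin d → ℝ) : 0 ≤ temporalWeight s x :=
  le_min (Real.rpow_nonneg (abs_nonneg _) _) zero_le_one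

theorem temporalWeight_le_one (s x : Fin d → ℝ) : temporalWeight s x ≤ 1 := min_le_right _ _

theorem temporalWeight_pos (s : Fin d → ℝ) {x : Fin d → ℝ} (hx : x 0 ≠ 0) :
    0 < temporalWeight s x :=
  lt_min (Real.rpow_pos_of_pos (abs_pos.2 hx) _) one_pos

theorem continuous_temporalWeight (hs : ∀ i, 1 ≤ s i) : Continuous (temporalWeight s) := by
  unfold temporalWeight
  have h : 0 ≤ 1 / s 0 := by have := hs 0; positivity
  exact (((continuous_apply 0).abs).rpow_const fun _ => Or.inr h).min continuous_const

/-- The power 1/𝔰₁ ≤ 1 is subadditive, and truncation at 1 preserves the inequality. -/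
theorem temporalWeight_le_add (hs : ∀ i, 1 ≤ s i) (x y : Fin d → ℝ) :
    temporalWeight s x ≤ temporalWeight s y + scaledNorm s (x - y) := by
  have hs0 := hs 0
  have h1 : 1 / s 0 ≤ 1 := by rw [div_le_one (by positivity)]; exact hs0
  have h0 : 0 ≤ 1 / s 0 := by positivity
  have h2 : |x 0| ^ (1 / s 0) ≤ |y 0| ^ (1 / s 0) + |(x - y) 0| ^ (1 / s 0) := by
    have h3 : |x 0| ≤ |y 0| + |(x - y) 0| := by
      have := abs_add_le (y 0) ((x - y) 0)
      simpa using this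
    have h4 := NNReal.rpow_add_le_add_rpow ⟨|y 0|, abs_nonneg _⟩ ⟨|(x - y) 0|, abs_nonneg _⟩ h0 h1
    refine (Real.rpow_le_rpow (abs_nonneg _) h3 h0).trans ?_
    exact_mod_cast h4
  have h3 := abs_rpow_le_scaledNorm s (x - y) 0
  have h4 := scaledNorm_nonneg s (x - y)
  unfold temporalWeight
  rcases le_total (|y 0| ^ (1 / s 0)) 1 with h | h
  · rw [min_eq_left h]
    exact (min_le_left _ _).trans (by linarith)
  · rw [min_eq_right h]
    exact (min_le_right _ _).trans (by linarith)

theorem temporalWeight_rpow_neg_le (hs : ∀ i, 1 ≤ s i) {a : ℝ} (x : Fin d → ℝ) :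
    temporalWeight s x ^ (-a) ≤ 1 + |x 0| ^ (-(a / s 0)) := by
  have hs0 : 0 < s 0 := by have := hs 0; positivity
  have h0 : 0 ≤ |x 0| ^ (-(a / s 0)) := Real.rpow_nonneg (abs_nonneg _) _
  rcases eq_or_ne (x 0) 0 with hx | hx
  · have : temporalWeight s x = 0 := by
      have h : (1 / s 0) ≠ 0 := by positivity
      rw [temporalWeight, hx, abs_zero, Real.zero_rpow h]
      simp
    rw [this]
    -- On the plane a power of the zero weight is 0 or 1 by convention, so the bound holds there
    -- too.
    have := Real.zero_rpow_le_one (-a)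
    linarith
  · rcases le_total (|x 0| ^ (1 / s 0)) 1 with h | h
    · rw [temporalWeight, min_eq_left h, ← Real.rpow_mul (abs_nonneg _)]
      have : 1 / s 0 * -a = -(a / s 0) := by ring
      rw [this]; linarith
    · rw [temporalWeight, min_eq_right h, Real.one_rpow]; linarith

theorem rpow_add_le_two_rpow_mul {a b p : ℝ} (ha : 0 ≤ a) (hb : 0 ≤ b) (hp : 0 ≤ p) :
    (a + b) ^ p ≤ 2 ^ p * (a ^ p + b ^ p) := by
  have h1 : a + b ≤ 2 * max a b := by
    rcases le_total a b with h | h <;> simp [h] <;> linarith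
  have h2 : (max a b) ^ p ≤ a ^ p + b ^ p := by
    have := Real.rpow_nonneg ha p
    have := Real.rpow_nonneg hb p
    rcases le_total a b with h | h <;> simp only [max_eq_left h, max_eq_right h] <;> linarith
  calc (a + b) ^ p ≤ (2 * max a b) ^ p := by gcongr
    _ = 2 ^ p * (max a b) ^ p := Real.mul_rpow (by norm_num) (le_max_of_le_left ha)
    _ ≤ _ := by gcongr

/-- A point-dependent comparison of inverse powers of the temporal weight. -/
theorem temporalWeight_rpow_neg_le_mul (hs : ∀ i, 1 ≤ s i) {a : ℝ} (ha : 0 ≤ a)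
    {x y : Fin d → ℝ} (hx : x 0 ≠ 0) (hy : y 0 ≠ 0) :
    temporalWeight s y ^ (-a) ≤ 2 ^ a * temporalWeight s x ^ (-a) *
      (1 + scaledNorm s (x - y) ^ a * temporalWeight s y ^ (-a)) := by
  have hx' := temporalWeight_pos s hx
  have hy' := temporalWeight_pos s hy
  have hn := scaledNorm_nonneg s (x - y)
  have h1 : temporalWeight s x ^ a ≤
      2 ^ a * (temporalWeight s y ^ a + scaledNorm s (x - y) ^ a) :=
    (Real.rpow_le_rpow hx'.le (temporalWeight_le_add hs x y) ha).trans
      (rpow_add_le_two_rpow_mul hy'.le hn ha)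
  have h2 : temporalWeight s x ^ a * temporalWeight s x ^ (-a) = 1 := by
    rw [← Real.rpow_add hx']; simp
  have h3 : temporalWeight s y ^ a * temporalWeight s y ^ (-a) = 1 := by
    rw [← Real.rpow_add hy']; simp
  have h4 : 0 ≤ temporalWeight s x ^ (-a) := by positivity
  have h5 : 0 ≤ temporalWeight s y ^ (-a) := by positivity
  calc temporalWeight s y ^ (-a)
      = temporalWeight s x ^ a * (temporalWeight s x ^ (-a) * temporalWeight s y ^ (-a)) := by
        rw [← mul_assoc, h2, one_mul]
    _ ≤ 2 ^ a * (temporalWeight s y ^ a + scaledNorm s (x - y) ^ a) *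
        (temporalWeight s x ^ (-a) * temporalWeight s y ^ (-a)) := by gcongr
    _ = 2 ^ a * temporalWeight s x ^ (-a) *
        (temporalWeight s y ^ a * temporalWeight s y ^ (-a) +
          scaledNorm s (x - y) ^ a * temporalWeight s y ^ (-a)) := by ring
    _ = _ := by rw [h3]

/-- Germs are controlled only off the plane; its nullity makes this enough under an integral. -/
theorem ae_ne_zero : ∀ᵐ x : Fin d → ℝ, x 0 ≠ 0 :=
  Measure.ae_eval_ne (fun _ : Fin d => (volume : Measure ℝ)) 0 0

end ScaledSize

/-! ### A product kernel dominating the semigroup -/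

section CauchyKernel

variable {d : ℕ}

/-- The anisotropically rescaled product of Cauchy densities (up to normalization). -/
noncomputable def cauchyKernel (s : Fin d → ℝ) (ℓ t : ℝ) (x : Fin d → ℝ) : ℝ :=
  t ^ (-(∑ i, s i) / ℓ) * ∏ i, (1 + (t ^ (-(s i) / ℓ) * x i) ^ 2)⁻¹

variable {s : Fin d → ℝ} {ℓ : ℝ}

theorem cauchyKernel_pos {t : ℝ} (ht : 0 < t) (x : Fin d → ℝ) : 0 < cauchyKernel s ℓ t x :=
  mul_pos (Real.rpow_pos_of_pos ht _) (Finset.prod_pos fun i _ => by positivity)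

theorem continuous_cauchyKernel (t : ℝ) : Continuous (cauchyKernel s ℓ t) := by
  unfold cauchyKernel
  refine continuous_const.mul (continuous_finsetProd _ fun i _ => ?_)
  refine Continuous.inv₀ (by fun_prop) fun x => ?_
  positivity

theorem cauchyKernel_eq_prod {t : ℝ} (ht : 0 < t) (x : Fin d → ℝ) :
    cauchyKernel s ℓ t x =
      ∏ i, (t ^ (-(s i) / ℓ) * (1 + (t ^ (-(s i) / ℓ) * x i) ^ 2)⁻¹) := by
  rw [Finset.prod_mul_distrib, cauchyKernel, ← Real.rpow_sum_of_pos ht, ← Finset.sum_div,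
    Finset.sum_neg_distrib]

/-! ### One-dimensional Cauchy integrals with a singularity at the origin. -/

theorem integrable_cauchy_comp {c : ℝ} (hc : 0 < c) (x : ℝ) :
    Integrable fun u : ℝ => c * (1 + (c * (x - u)) ^ 2)⁻¹ :=
  (((integrable_inv_one_add_sq).comp_mul_left' hc.ne').comp_sub_left x).const_mul c

theorem integral_cauchy_comp {c : ℝ} (hc : 0 < c) (x : ℝ) :
    ∫ u : ℝ, c * (1 + (c * (x - u)) ^ 2)⁻¹ = Real.pi := by
  rw [integral_const_mul,
    integral_sub_left_eq_self (fun u : ℝ => (1 + (c * u) ^ 2)⁻¹) volume x,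
    Measure.integral_comp_mul_left (fun u : ℝ => (1 + u ^ 2)⁻¹) c, integral_univ_inv_one_add_sq,
    abs_of_pos (inv_pos.2 hc), smul_eq_mul, mul_inv_cancel_left₀ hc.ne']

theorem integrableOn_abs_rpow_neg {b : ℝ} (hb : b < 1) :
    IntegrableOn (fun u : ℝ => |u| ^ (-b)) (Icc (-1) 1) := by
  have h : LocallyIntegrable (fun u : ℝ => |u| ^ (-b)) volume := by
    refine locallyIntegrable_of_norm_le_rpow (C := 1) (α := b) (by simp) (by simpa using hb)
      (Eventually.of_forall fun x => ?_) ?_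
    · rw [Real.norm_of_nonneg (Real.rpow_nonneg (abs_nonneg _) _), one_mul, Real.norm_eq_abs]
    · exact (continuous_abs.measurable.pow_const _).aestronglyMeasurable
  exact h.integrableOn_isCompact isCompact_Icc

/-- Scaling reduces to c = 1 and produces the factor c^b. There one splits at |u| = 1: inside, the
Cauchy factor is at most 1 and |u|^{-b} is integrable; outside, |u|^{-b} ≤ 1 and the Cauchy factor
has mass π. -/
theorem integral_cauchy_mul_abs_rpow_neg {b : ℝ} (hb0 : 0 ≤ b) (hb : b < 1) :
    ∃ C : ℝ, 0 < C ∧ ∀ (c : ℝ), 0 < c → ∀ x : ℝ,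
      Integrable (fun u : ℝ => c * (1 + (c * (x - u)) ^ 2)⁻¹ * |u| ^ (-b)) ∧
      ∫ u : ℝ, c * (1 + (c * (x - u)) ^ 2)⁻¹ * |u| ^ (-b) ≤ C * c ^ b := by
  set I := ∫ u in Icc (-1 : ℝ) 1, |u| ^ (-b) with hI
  have hI0 : 0 ≤ I := setIntegral_nonneg measurableSet_Icc
    fun u _ => Real.rpow_nonneg (abs_nonneg _) _
  have hint := integrableOn_abs_rpow_neg hb
  have key : ∀ z : ℝ, Integrable (fun u : ℝ => (1 + (z - u) ^ 2)⁻¹ * |u| ^ (-b)) ∧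
      ∫ u : ℝ, (1 + (z - u) ^ 2)⁻¹ * |u| ^ (-b) ≤ I + Real.pi := by
    intro z
    have hz : Integrable fun u : ℝ => (1 + (z - u) ^ 2)⁻¹ := by
      simpa using integrable_cauchy_comp one_pos z
    have hz' : ∫ u : ℝ, (1 + (z - u) ^ 2)⁻¹ = Real.pi := by
      simpa using integral_cauchy_comp one_pos z
    have hdom : Integrable fun u : ℝ => (Icc (-1 : ℝ) 1).indicator (fun u => |u| ^ (-b)) u +
        (1 + (z - u) ^ 2)⁻¹ := (hint.integrable_indicator measurableSet_Icc).add hz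
    have hle : ∀ u : ℝ, (1 + (z - u) ^ 2)⁻¹ * |u| ^ (-b) ≤
        (Icc (-1 : ℝ) 1).indicator (fun u => |u| ^ (-b)) u + (1 + (z - u) ^ 2)⁻¹ := by
      intro u
      have h0 : 0 ≤ |u| ^ (-b) := Real.rpow_nonneg (abs_nonneg _) _
      have h1 : 0 ≤ (1 + (z - u) ^ 2)⁻¹ := by positivity
      by_cases hu : u ∈ Icc (-1 : ℝ) 1
      · rw [indicator_of_mem hu]
        have h2 : (1 + (z - u) ^ 2)⁻¹ ≤ 1 := inv_le_one_of_one_le₀ (by nlinarith [sq_nonneg (z - u)])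
        nlinarith
      · rw [indicator_of_notMem hu, zero_add]
        have hu' : 1 ≤ |u| := by
          by_contra h
          push Not at h
          exact hu ⟨(abs_lt.1 h).1.le, (abs_lt.1 h).2.le⟩
        have h2 : |u| ^ (-b) ≤ 1 := Real.rpow_le_one_of_one_le_of_nonpos hu' (by linarith)
        nlinarith
    have hInt : Integrable (fun u : ℝ => (1 + (z - u) ^ 2)⁻¹ * |u| ^ (-b)) := by
      refine hdom.mono' ?_ (Eventually.of_forall fun u => ?_)
      · refine hz.aestronglyMeasurable.mul ?_
        exact (continuous_abs.measurable.pow_const _).aestronglyMeasurable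
      · rw [Real.norm_of_nonneg (by positivity)]
        exact hle u
    refine ⟨hInt, (integral_mono hInt hdom hle).trans (le_of_eq ?_)⟩
    rw [integral_add (hint.integrable_indicator measurableSet_Icc) hz, hz',
      integral_indicator measurableSet_Icc]
  refine ⟨I + Real.pi, by positivity, fun c hc x => ?_⟩
  -- Of the factor c^{1+b}, one power of c cancels the Jacobian of u ↦ cu; what remains is c^b.
  have heq : (fun u : ℝ => c * (1 + (c * (x - u)) ^ 2)⁻¹ * |u| ^ (-b)) =
      fun u => c ^ (1 + b) * (fun u' : ℝ => (1 + (c * x - u') ^ 2)⁻¹ * |u'| ^ (-b)) (c * u) := by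
    funext u
    have : |c * u| ^ (-b) = c ^ (-b) * |u| ^ (-b) := by
      rw [abs_mul, abs_of_pos hc, Real.mul_rpow hc.le (abs_nonneg _)]
    simp only [this]
    rw [mul_sub, Real.rpow_add hc, Real.rpow_one, Real.rpow_neg hc.le]
    have : c ^ b ≠ 0 := (Real.rpow_pos_of_pos hc b).ne'
    field_simp
  rw [heq]
  obtain ⟨k1, k2⟩ := key (c * x)
  refine ⟨(k1.comp_mul_left' hc.ne').const_mul _, ?_⟩
  rw [integral_const_mul,
    Measure.integral_comp_mul_left (fun u' : ℝ => (1 + (c * x - u') ^ 2)⁻¹ * |u'| ^ (-(b))) c,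
    abs_of_pos (inv_pos.2 hc), smul_eq_mul]
  have : c ^ (1 + b) = c * c ^ b := by rw [Real.rpow_add hc, Real.rpow_one]
  rw [this]
  calc c * c ^ b * (c⁻¹ * ∫ y : ℝ, (1 + (c * x - y) ^ 2)⁻¹ * |y| ^ (-b))
      = c ^ b * ∫ y : ℝ, (1 + (c * x - y) ^ 2)⁻¹ * |y| ^ (-b) := by field_simp
    _ ≤ c ^ b * (I + Real.pi) := by gcongr
    _ = _ := mul_comm _ _

/-- Only the temporal coordinate sees the singularity, so the product kernel reduces the claim to
dimension one with b = a/𝔰₁. The condition a < 𝔰₁ is b < 1, and the temporal scale t^{-𝔰₁/ℓ} raised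
to the power b is t^{-a/ℓ}. -/
theorem cauchyKernel_mul_temporalWeight [NeZero d] (hs : ∀ i, 1 ≤ s i) (hℓ : 0 < ℓ) {a : ℝ}
    (ha0 : 0 ≤ a) (ha : a < s 0) :
    ∃ C : ℝ, 0 < C ∧ ∀ t ∈ Ioc (0 : ℝ) 1, ∀ x : Fin d → ℝ,
      Integrable (fun y => cauchyKernel s ℓ t (x - y) * temporalWeight s y ^ (-a)) ∧
      ∫ y, cauchyKernel s ℓ t (x - y) * temporalWeight s y ^ (-a) ≤ C * t ^ (-a / ℓ) := by
  have hs0 : 0 < s 0 := by have := hs 0; positivity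
  have hb : a / s 0 < 1 := (div_lt_one hs0).2 ha
  have hb0 : 0 ≤ a / s 0 := by positivity
  obtain ⟨C, hC, h1⟩ := integral_cauchy_mul_abs_rpow_neg hb0 hb
  refine ⟨(Real.pi + C) ^ d, by positivity, fun t ht x => ?_⟩
  obtain ⟨ht0, ht1⟩ := ht
  have hc : ∀ i, 0 < t ^ (-(s i) / ℓ) := fun i => Real.rpow_pos_of_pos ht0 _
  -- The factors of an integrable product majorant: the truncated weight is replaced by 1 +
  -- |u|^{-a/𝔰₁}, carried by the temporal factor alone.
  set k : Fin d → ℝ → ℝ := fun i u => t ^ (-(s i) / ℓ) * (1 + (t ^ (-(s i) / ℓ) * (x i - u)) ^ 2)⁻¹ *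
    (if i = 0 then 1 + |u| ^ (-(a / s 0)) else 1) with hk
  have hk0 : ∀ i u, 0 ≤ k i u := by
    intro i u
    have h0 : 0 ≤ |u| ^ (-(a / s 0)) := Real.rpow_nonneg (abs_nonneg _) _
    have := hc i
    simp only [hk]
    split_ifs <;> positivity
  -- Lets the nonsingular term π be absorbed into t^{-a/ℓ}.
  have hT : 1 ≤ t ^ (-a / ℓ) := by
    refine Real.one_le_rpow_of_pos_of_le_one_of_nonpos ht0 ht1 ?_
    rw [neg_div]; have : 0 ≤ a / ℓ := by positivity
    linarith
  have hki : ∀ i, Integrable (k i) ∧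
      ∫ u, k i u ≤ (Real.pi + C) * (if i = 0 then t ^ (-a / ℓ) else 1) := by
    intro i
    by_cases hi : i = 0
    · subst hi
      have h2 := h1 _ (hc 0) (x 0)
      have h3 := integrable_cauchy_comp (hc 0) (x 0)
      have heq : k 0 = fun u => t ^ (-(s 0) / ℓ) * (1 + (t ^ (-(s 0) / ℓ) * (x 0 - u)) ^ 2)⁻¹ +
          t ^ (-(s 0) / ℓ) * (1 + (t ^ (-(s 0) / ℓ) * (x 0 - u)) ^ 2)⁻¹ * |u| ^ (-(a / s 0)) := by
        funext u; simp only [hk, if_true]; ring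
      rw [heq]
      refine ⟨h3.add h2.1, ?_⟩
      rw [integral_add h3 h2.1, integral_cauchy_comp (hc 0), if_pos rfl]
      have h4 : (t ^ (-(s 0) / ℓ)) ^ (a / s 0) = t ^ (-a / ℓ) := by
        rw [← Real.rpow_mul ht0.le]; congr 1; field_simp
      have h5 := h2.2
      rw [h4] at h5
      nlinarith [Real.pi_pos]
    · have heq : k i = fun u => t ^ (-(s i) / ℓ) * (1 + (t ^ (-(s i) / ℓ) * (x i - u)) ^ 2)⁻¹ := by
        funext u; simp only [hk, if_neg hi]; ring
      rw [heq]
      refine ⟨integrable_cauchy_comp (hc i) (x i), ?_⟩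
      rw [integral_cauchy_comp (hc i), if_neg hi]
      linarith
  have hprod : Integrable fun y : Fin d → ℝ => ∏ i, k i (y i) :=
    Integrable.fintype_prod fun i => (hki i).1
  have hle : ∀ y : Fin d → ℝ, cauchyKernel s ℓ t (x - y) * temporalWeight s y ^ (-a) ≤
      ∏ i, k i (y i) := by
    intro y
    have h2 : ∏ i, k i (y i) = cauchyKernel s ℓ t (x - y) * (1 + |y 0| ^ (-(a / s 0))) := by
      simp only [hk]
      rw [Finset.prod_mul_distrib, cauchyKernel_eq_prod ht0]
      congr 1
      rw [Finset.prod_ite_eq' Finset.univ (0 : Fin d) fun i => 1 + |y i| ^ (-(a / s 0))]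
      simp
    rw [h2]
    exact mul_le_mul_of_nonneg_left (temporalWeight_rpow_neg_le hs y)
      (cauchyKernel_pos ht0 _).le
  have hInt : Integrable (fun y => cauchyKernel s ℓ t (x - y) * temporalWeight s y ^ (-a)) := by
    refine hprod.mono' ?_ (Eventually.of_forall fun y => ?_)
    · refine (((continuous_cauchyKernel t).comp
        (continuous_const.sub continuous_id)).measurable.mul ?_).aestronglyMeasurable
      exact (continuous_temporalWeight hs).measurable.pow_const _
    · rw [Real.norm_of_nonneg (mul_nonneg (cauchyKernel_pos ht0 _).le
        (Real.rpow_nonneg (temporalWeight_nonneg _ _) _))]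
      exact hle y
  refine ⟨hInt, (integral_mono hInt hprod hle).trans ?_⟩
  rw [integral_fintype_prod_volume_eq_prod]
  calc ∏ i, ∫ u, k i u ≤ ∏ i : Fin d, ((Real.pi + C) * (if i = 0 then t ^ (-a / ℓ) else 1)) :=
        Finset.prod_le_prod (fun i _ => integral_nonneg (hk0 i)) fun i _ => (hki i).2
    _ = _ := by
        rw [Finset.prod_mul_distrib, Finset.prod_const,
          Finset.prod_ite_eq' Finset.univ (0 : Fin d) fun _ => t ^ (-a / ℓ)]
        simp

/-- The kernel bound behind all estimates: weights and polynomial factors are absorbed into the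
product kernel. -/
theorem GControlled.scaledKernel_le {G W Ws : (Fin d → ℝ) → ℝ} (hs : ∀ i, 1 ≤ s i)
    (hW : GControlled s ℓ G W Ws) (hG0 : ∀ x, 0 ≤ G x) {p T : ℝ} (hp : 0 ≤ p) (hT : 0 < T) :
    ∃ C : ℝ, 0 < C ∧ ∀ t ∈ Ioc (0 : ℝ) T, ∀ z : Fin d → ℝ,
      Ws z * scaledNorm s z ^ p * scaledKernel s ℓ G t z ≤
        C * t ^ (p / ℓ) * cauchyKernel s ℓ t z := by
  -- The order of the moment needed: p for the power of the distance, 2|𝔰| for the denominators of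
  -- the Cauchy product.
  set m : ℕ := ⌈p + 2 * ∑ i, s i⌉₊ with hm
  obtain ⟨B0, hB0⟩ := hW.controlled 0 T hT
  obtain ⟨B1, hB1⟩ := hW.controlled m T hT
  refine ⟨2 ^ m * (|B0| + |B1|) + 1, by positivity, fun t ht z => ?_⟩
  have ht0 : 0 < t := ht.1
  -- The unscaled variable: z is the dilation of y, so the control of the weight applies at y and
  -- bounds it at z.
  set y : Fin d → ℝ := fun i => t ^ (-(s i) / ℓ) * z i with hy
  have hdil : scaledDil s ℓ t y = z := by
    funext i
    simp only [scaledDil, hy]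
    rw [← mul_assoc, ← Real.rpow_add ht0, neg_div, add_neg_cancel, Real.rpow_zero, one_mul]
  have hnorm : scaledNorm s z = t ^ (1 / ℓ) * scaledNorm s y := by
    rw [← scaledNorm_scaledDil hs ht0, hdil]
  have hn := scaledNorm_nonneg s y
  have e0 := hB0 t ht y
  have e1 := hB1 t ht y
  rw [hdil] at e0 e1
  rw [pow_zero, one_mul] at e0
  have hWs : 0 ≤ Ws z := zero_le_one.trans (hW.one_le_star z)
  have hWG : 0 ≤ Ws z * G y := mul_nonneg hWs (hG0 y)
  have hP : 0 < ∏ i, (1 + y i ^ 2) := Finset.prod_pos fun i _ => by positivity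
  have h1 : scaledNorm s y ^ p * ∏ i, (1 + y i ^ 2) ≤ (1 + scaledNorm s y) ^ m := by
    calc scaledNorm s y ^ p * ∏ i, (1 + y i ^ 2)
        ≤ (1 + scaledNorm s y) ^ p * (1 + scaledNorm s y) ^ (2 * ∑ i, s i) := by
          gcongr
          · linarith
          · exact prod_one_add_sq_le hs y
      _ = (1 + scaledNorm s y) ^ (p + 2 * ∑ i, s i) := by
          rw [← Real.rpow_add (by positivity)]
      _ ≤ (1 + scaledNorm s y) ^ (m : ℝ) :=
          Real.rpow_le_rpow_of_exponent_le (by linarith) (Nat.le_ceil _)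
      _ = _ := Real.rpow_natCast _ _
  -- Reduces to the moments of order 0 and m, bounded by `B0` and `B1`.
  have h2 : (1 + scaledNorm s y) ^ m ≤ 2 ^ m * (1 + scaledNorm s y ^ m) := by
    rcases le_total (scaledNorm s y) 1 with h | h
    · calc (1 + scaledNorm s y) ^ m ≤ 2 ^ m := by gcongr; linarith
        _ ≤ _ := by
          have : (0 : ℝ) < 2 ^ m := by positivity
          have := pow_nonneg hn m
          nlinarith
    · calc (1 + scaledNorm s y) ^ m ≤ (2 * scaledNorm s y) ^ m := by gcongr; linarith
        _ = 2 ^ m * scaledNorm s y ^ m := mul_pow _ _ _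
        _ ≤ _ := by gcongr; linarith
  have h3 : scaledNorm s y ^ p * (Ws z * G y) ≤
      (2 ^ m * (|B0| + |B1|) + 1) * (∏ i, (1 + y i ^ 2))⁻¹ := by
    rw [← div_eq_mul_inv, le_div_iff₀ hP]
    calc scaledNorm s y ^ p * (Ws z * G y) * ∏ i, (1 + y i ^ 2)
        = (scaledNorm s y ^ p * ∏ i, (1 + y i ^ 2)) * (Ws z * G y) := by ring
      _ ≤ 2 ^ m * (1 + scaledNorm s y ^ m) * (Ws z * G y) := by
          exact mul_le_mul_of_nonneg_right (h1.trans h2) hWG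
      _ = 2 ^ m * (Ws z * G y + scaledNorm s y ^ m * Ws z * G y) := by ring
      _ ≤ 2 ^ m * (|B0| + |B1|) := by
          gcongr
          · exact e0.trans (le_abs_self _)
          · exact e1.trans (le_abs_self _)
      _ ≤ _ := by linarith
  have h4 : scaledNorm s z ^ p = t ^ (p / ℓ) * scaledNorm s y ^ p := by
    rw [hnorm, Real.mul_rpow (Real.rpow_nonneg ht0.le _) hn, ← Real.rpow_mul ht0.le]
    congr 2; ring
  have h5 : cauchyKernel s ℓ t z = t ^ (-(∑ i, s i) / ℓ) * (∏ i, (1 + y i ^ 2))⁻¹ := by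
    rw [cauchyKernel, Finset.prod_inv_distrib]
  have h6 : scaledKernel s ℓ G t z = t ^ (-(∑ i, s i) / ℓ) * G y := rfl
  rw [h4, h5, h6]
  have h7 : 0 ≤ t ^ (p / ℓ) * t ^ (-(∑ i, s i) / ℓ) :=
    mul_nonneg (Real.rpow_nonneg ht0.le _) (Real.rpow_nonneg ht0.le _)
  calc Ws z * (t ^ (p / ℓ) * scaledNorm s y ^ p) * (t ^ (-(∑ i, s i) / ℓ) * G y)
      = (t ^ (p / ℓ) * t ^ (-(∑ i, s i) / ℓ)) * (scaledNorm s y ^ p * (Ws z * G y)) := by ring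
    _ ≤ (t ^ (p / ℓ) * t ^ (-(∑ i, s i) / ℓ)) *
        ((2 ^ m * (|B0| + |B1|) + 1) * (∏ i, (1 + y i ^ 2))⁻¹) := by gcongr
    _ = _ := by ring

end CauchyKernel

/-! ### Action of the semigroup on weighted functions -/

/-- The function `x ↦ ∫ Q_t(x,y) g(y) dy`. -/
noncomputable def kernelInt {d : ℕ} (Q : ℝ → (Fin d → ℝ) → (Fin d → ℝ) → ℝ) (t : ℝ) (g : (Fin d → ℝ) → ℝ)
    (x : Fin d → ℝ) : ℝ :=
  ∫ y, Q t x y * g y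

/-- The integral of the kernel against the weight, a power of the distance and an inverse power of
the temporal weight. -/
noncomputable def kernelMoment {d : ℕ} [NeZero d] (s : Fin d → ℝ) (Q : ℝ → (Fin d → ℝ) → (Fin d → ℝ) → ℝ)
    (Ws : (Fin d → ℝ) → ℝ) (p a t : ℝ) (x : Fin d → ℝ) : ℝ :=
  ∫ y, Ws (x - y) * scaledNorm s (x - y) ^ p * |Q t x y| * temporalWeight s y ^ (-a)

/-- A `G`-type semigroup together with a `G`-controlled weight. -/
structure WeightedSemigroup {d : ℕ} (s : Fin d → ℝ) (ℓ : ℝ) (G : (Fin d → ℝ) → ℝ)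
    (Q : ℝ → (Fin d → ℝ) → (Fin d → ℝ) → ℝ) (W Ws : (Fin d → ℝ) → ℝ) : Prop where
  one_le_scaling : ∀ i, 1 ≤ s i
  order_pos : 0 < ℓ
  nonneg : ∀ x, 0 ≤ G x
  semigroup : IsGTypeSemigroup s ℓ G Q
  weight : GControlled s ℓ G W Ws

/-- `g` is measurable and bounded by `N φ^{-a} / W` almost everywhere. -/
structure WeightedBound {d : ℕ} [NeZero d] (s : Fin d → ℝ) (W : (Fin d → ℝ) → ℝ) (a N : ℝ)
    (g : (Fin d → ℝ) → ℝ) : Prop where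
  aestronglyMeasurable : AEStronglyMeasurable g volume
  bound : ∀ᵐ y, |g y| * W y ≤ N * temporalWeight s y ^ (-a)

/-- The form in which moderateness is used: a bound weighted at the integration point becomes one
weighted at the base point, at a price depending on their difference only, which the kernel absorbs.
-/
theorem GControlled.le_star_mul {d : ℕ} {s : Fin d → ℝ} {ℓ : ℝ} {G W Ws : (Fin d → ℝ) → ℝ}
    (h : GControlled s ℓ G W Ws) (x y : Fin d → ℝ) : W x ≤ Ws (x - y) * W y := by
  simpa using h.moderate (x - y) y

namespace WeightedSemigroup

section Kernel

variable {d : ℕ} {s : Fin d → ℝ} {ℓ : ℝ} {G : (Fin d → ℝ) → ℝ}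
  {Q : ℝ → (Fin d → ℝ) → (Fin d → ℝ) → ℝ} {W Ws : (Fin d → ℝ) → ℝ}

theorem star_nonneg (h : WeightedSemigroup s ℓ G Q W Ws) (x : Fin d → ℝ) : 0 ≤ Ws x :=
  zero_le_one.trans (h.weight.one_le_star x)

theorem star_mul_abs_kernel_le (h : WeightedSemigroup s ℓ G Q W Ws) {p T : ℝ} (hp : 0 ≤ p)
    (hT : 0 < T) :
    ∃ C : ℝ, 0 < C ∧ ∀ t ∈ Ioc (0 : ℝ) T, ∀ x y : Fin d → ℝ,
      Ws (x - y) * scaledNorm s (x - y) ^ p * |Q t x y| ≤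
        C * t ^ (p / ℓ) * cauchyKernel s ℓ t (x - y) := by
  obtain ⟨C1, hC1, h1⟩ := h.weight.scaledKernel_le h.one_le_scaling h.nonneg hp hT
  obtain ⟨C2, hC2, h2⟩ := h.semigroup.upper_bound
  refine ⟨C2 * C1, by positivity, fun t ht x y => ?_⟩
  have h0 : 0 ≤ Ws (x - y) * scaledNorm s (x - y) ^ p :=
    mul_nonneg (h.star_nonneg _) (Real.rpow_nonneg (scaledNorm_nonneg _ _) _)
  calc _ ≤ Ws (x - y) * scaledNorm s (x - y) ^ p * (C2 * scaledKernel s ℓ G t (x - y)) := by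
        gcongr
        exact h2 t ht.1 x y
    _ = C2 * (Ws (x - y) * scaledNorm s (x - y) ^ p * scaledKernel s ℓ G t (x - y)) := by ring
    _ ≤ C2 * (C1 * t ^ (p / ℓ) * cauchyKernel s ℓ t (x - y)) :=
        mul_le_mul_of_nonneg_left (h1 t ht (x - y)) hC2.le
    _ = _ := by ring

theorem star_mul_abs_deriv_le (h : WeightedSemigroup s ℓ G Q W Ws) :
    ∃ C : ℝ, 0 < C ∧ ∀ t ∈ Ioc (0 : ℝ) 1, ∀ x y : Fin d → ℝ,
      Ws (x - y) * |deriv (fun r => Q r x y) t| ≤ C * t⁻¹ * cauchyKernel s ℓ t (x - y) := by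
  obtain ⟨C1, hC1, h1⟩ := h.weight.scaledKernel_le h.one_le_scaling h.nonneg le_rfl one_pos
  obtain ⟨C2, hC2, h2⟩ := h.semigroup.deriv_bound
  refine ⟨C2 * C1, by positivity, fun t ht x y => ?_⟩
  have h0 := h.star_nonneg (x - y)
  have ht0 : 0 < t := ht.1
  have h3 := h1 t ht (x - y)
  rw [Real.rpow_zero, zero_div, Real.rpow_zero, mul_one, mul_one] at h3
  calc _ ≤ Ws (x - y) * (C2 * t⁻¹ * scaledKernel s ℓ G t (x - y)) := by
        gcongr
        exact h2 t ht.1 x y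
    _ = C2 * t⁻¹ * (Ws (x - y) * scaledKernel s ℓ G t (x - y)) := by ring
    _ ≤ C2 * t⁻¹ * (C1 * cauchyKernel s ℓ t (x - y)) := by gcongr
    _ = _ := by ring

theorem continuous_kernel_right (h : WeightedSemigroup s ℓ G Q W Ws) {t : ℝ} (ht : 0 < t)
    (x : Fin d → ℝ) : Continuous fun y => Q t x y :=
  (h.semigroup.continuous_kernel t ht).comp (Continuous.prodMk_right x)

theorem continuous_kernel_left (h : WeightedSemigroup s ℓ G Q W Ws) {t : ℝ} (ht : 0 < t)
    (y : Fin d → ℝ) : Continuous fun x => Q t x y :=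
  (h.semigroup.continuous_kernel t ht).comp (Continuous.prodMk_left y)

/-- For times in a compact subset of `(0,1]`, the product kernels are comparable. -/
theorem cauchyKernel_le_one {δ : ℝ} (hs : ∀ i, 1 ≤ s i) (hℓ : 0 < ℓ) (hδ : 0 < δ) {t : ℝ}
    (ht : t ∈ Icc δ 1) (x : Fin d → ℝ) :
    cauchyKernel s ℓ t x ≤ δ ^ (-(∑ i, s i) / ℓ) * cauchyKernel s ℓ 1 x := by
  have ht0 : 0 < t := hδ.trans_le ht.1
  have hS : -(∑ i, s i) / ℓ ≤ 0 := by
    have : 0 ≤ ∑ i, s i := Finset.sum_nonneg fun i _ => zero_le_one.trans (hs i)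
    rw [neg_div]; have : 0 ≤ (∑ i, s i) / ℓ := by positivity
    linarith
  unfold cauchyKernel
  simp only [Real.one_rpow, one_mul]
  refine mul_le_mul (Real.rpow_le_rpow_of_nonpos hδ ht.1 hS) ?_
    (Finset.prod_nonneg fun i _ => by positivity) (by positivity)
  refine Finset.prod_le_prod (fun i _ => by positivity) fun i _ => ?_
  refine inv_anti₀ (by positivity) ?_
  have h1 : 1 ≤ t ^ (-(s i) / ℓ) := by
    refine Real.one_le_rpow_of_pos_of_le_one_of_nonpos ht0 ht.2 ?_
    rw [neg_div]; have := hs i; have : 0 ≤ s i / ℓ := by positivity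
    linarith
  rw [mul_pow]
  have h2 : 1 ≤ (t ^ (-(s i) / ℓ)) ^ 2 := one_le_pow₀ h1
  nlinarith [sq_nonneg (x i)]

/-- Translating the product kernel changes it by a factor depending on the translation only. -/
theorem cauchyKernel_add_le {t : ℝ} (ht : 0 < t) (x e : Fin d → ℝ) :
    cauchyKernel s ℓ t (x + e) ≤
      (∏ i, (2 * (1 + (t ^ (-(s i) / ℓ) * e i) ^ 2))) * cauchyKernel s ℓ t x := by
  unfold cauchyKernel
  rw [mul_left_comm, ← Finset.prod_mul_distrib]
  refine mul_le_mul_of_nonneg_left ?_ (Real.rpow_nonneg ht.le _)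
  refine Finset.prod_le_prod (fun i _ => by positivity) fun i _ => ?_
  rw [← div_eq_mul_inv, inv_le_comm₀ (by positivity) (by positivity), inv_div,
    div_le_iff₀ (by positivity)]
  simp only [Pi.add_apply]
  generalize t ^ (-(s i) / ℓ) = c
  rw [mul_add c]
  generalize c * x i = u
  generalize c * e i = v
  -- The claim is 1 + u² ≤ 2 (1 + v²)(1 + (u+v)²); it comes from u² ≤ 2(u+v)² + 2v².
  nlinarith [sq_nonneg (u + 2 * v), sq_nonneg (u + v), sq_nonneg v, sq_nonneg u,
    mul_nonneg (sq_nonneg (u + v)) (sq_nonneg v)]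

end Kernel

variable {d : ℕ} [NeZero d] {s : Fin d → ℝ} {ℓ : ℝ} {G : (Fin d → ℝ) → ℝ}
  {Q : ℝ → (Fin d → ℝ) → (Fin d → ℝ) → ℝ} {W Ws : (Fin d → ℝ) → ℝ}

/-! ### Moments of the kernel and the resulting bounds. -/

theorem measurable_moment (h : WeightedSemigroup s ℓ G Q W Ws) {p a t : ℝ} (ht : 0 < t)
    (x : Fin d → ℝ) : Measurable fun y => Ws (x - y) * scaledNorm s (x - y) ^ p * |Q t x y| *
      temporalWeight s y ^ (-a) := by
  have h1 : Continuous fun y : Fin d → ℝ => x - y := continuous_const.sub continuous_id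
  refine Measurable.mul (Measurable.mul (Measurable.mul ?_ ?_) ?_) ?_
  · exact (h.weight.continuous_star.comp h1).measurable
  · exact (((continuous_scaledNorm h.one_le_scaling).comp h1).measurable).pow_const _
  · exact (h.continuous_kernel_right ht x).abs.measurable
  · exact (continuous_temporalWeight h.one_le_scaling).measurable.pow_const _

theorem moment_nonneg (h : WeightedSemigroup s ℓ G Q W Ws) (p a t : ℝ) (x y : Fin d → ℝ) :
    0 ≤ Ws (x - y) * scaledNorm s (x - y) ^ p * |Q t x y| * temporalWeight s y ^ (-a) :=
  mul_nonneg (mul_nonneg (mul_nonneg (h.star_nonneg _)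
    (Real.rpow_nonneg (scaledNorm_nonneg _ _) _)) (abs_nonneg _))
    (Real.rpow_nonneg (temporalWeight_nonneg _ _) _)

theorem kernelMoment_nonneg (h : WeightedSemigroup s ℓ G Q W Ws) (p a t : ℝ) (x : Fin d → ℝ) :
    0 ≤ kernelMoment s Q Ws p a t x :=
  integral_nonneg fun y => h.moment_nonneg p a t x y

/-- Distance to the power p gains t^{p/ℓ}, and the inverse power of the temporal weight loses
t^{-a/ℓ}, both through the Cauchy majorant. -/
theorem kernelMoment_le_time (h : WeightedSemigroup s ℓ G Q W Ws) {p a : ℝ} (hp : 0 ≤ p)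
    (ha0 : 0 ≤ a) (ha : a < s 0) :
    ∃ C : ℝ, 0 < C ∧ ∀ t ∈ Ioc (0 : ℝ) 1, ∀ x : Fin d → ℝ,
      Integrable (fun y => Ws (x - y) * scaledNorm s (x - y) ^ p * |Q t x y| *
        temporalWeight s y ^ (-a)) ∧
      kernelMoment s Q Ws p a t x ≤ C * t ^ ((p - a) / ℓ) := by
  obtain ⟨C1, hC1, h1⟩ := h.star_mul_abs_kernel_le hp one_pos
  obtain ⟨C2, hC2, h2⟩ := cauchyKernel_mul_temporalWeight h.one_le_scaling h.order_pos ha0 ha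
  refine ⟨C1 * C2, by positivity, fun t ht x => ?_⟩
  have ht0 : 0 < t := ht.1
  obtain ⟨h3, h4⟩ := h2 t ht x
  have hle : ∀ y, Ws (x - y) * scaledNorm s (x - y) ^ p * |Q t x y| * temporalWeight s y ^ (-a) ≤
      C1 * t ^ (p / ℓ) * (cauchyKernel s ℓ t (x - y) * temporalWeight s y ^ (-a)) := by
    intro y
    rw [← mul_assoc]
    exact mul_le_mul_of_nonneg_right (h1 t ht x y) (Real.rpow_nonneg (temporalWeight_nonneg _ _) _)
  have hI : Integrable (fun y => Ws (x - y) * scaledNorm s (x - y) ^ p * |Q t x y| *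
      temporalWeight s y ^ (-a)) := by
    refine (h3.const_mul (C1 * t ^ (p / ℓ))).mono'
      (h.measurable_moment ht0 x).aestronglyMeasurable (Eventually.of_forall fun y => ?_)
    rw [Real.norm_of_nonneg (h.moment_nonneg p a t x y)]
    exact hle y
  refine ⟨hI, ?_⟩
  calc kernelMoment s Q Ws p a t x
      ≤ ∫ y, C1 * t ^ (p / ℓ) * (cauchyKernel s ℓ t (x - y) * temporalWeight s y ^ (-a)) :=
        integral_mono hI (h3.const_mul _) hle
    _ ≤ C1 * t ^ (p / ℓ) * (C2 * t ^ (-a / ℓ)) := by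
        rw [integral_const_mul]; gcongr
    _ = C1 * C2 * t ^ ((p - a) / ℓ) := by
        rw [sub_div, sub_eq_add_neg, ← neg_div, Real.rpow_add ht0]; ring

/-- Moments of the kernel against an inverse power of the temporal weight, estimated in terms of
time, and in terms of the temporal weight of the base point. -/
theorem kernelMoment_le (h : WeightedSemigroup s ℓ G Q W Ws) {p a : ℝ} (hp : 0 ≤ p)
    (ha0 : 0 ≤ a) (ha : a < s 0) :
    ∃ C : ℝ, 0 < C ∧ ∀ t ∈ Ioc (0 : ℝ) 1, ∀ x : Fin d → ℝ,
      Integrable (fun y => Ws (x - y) * scaledNorm s (x - y) ^ p * |Q t x y| *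
        temporalWeight s y ^ (-a)) ∧
      kernelMoment s Q Ws p a t x ≤ C * t ^ ((p - a) / ℓ) ∧
      (x 0 ≠ 0 → kernelMoment s Q Ws p a t x ≤ C * t ^ (p / ℓ) * temporalWeight s x ^ (-a)) := by
  have hs0 : 0 < s 0 := by have := h.one_le_scaling 0; positivity
  obtain ⟨C1, hC1, h1⟩ := h.kernelMoment_le_time hp ha0 ha
  -- Comparing φ(y)^{-a} with φ(x)^{-a} produces the moments of exponents (p, 0) and (p + a, a).
  -- Both are of order t^{p/ℓ}: in the second, the extra distance pays for the singularity.
  obtain ⟨C2, hC2, h2⟩ := h.kernelMoment_le_time hp le_rfl hs0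
  obtain ⟨C3, hC3, h3⟩ := h.kernelMoment_le_time (add_nonneg hp ha0) ha0 ha
  refine ⟨C1 + 2 ^ a * (C2 + C3), by positivity, fun t ht x => ?_⟩
  have ht0 : 0 < t := ht.1
  obtain ⟨k1, k1'⟩ := h1 t ht x
  obtain ⟨k2, k2'⟩ := h2 t ht x
  obtain ⟨k3, k3'⟩ := h3 t ht x
  refine ⟨k1, k1'.trans ?_, fun hx => ?_⟩
  · have : 0 ≤ t ^ ((p - a) / ℓ) := by positivity
    gcongr
    have : 0 ≤ 2 ^ a * (C2 + C3) := by positivity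
    linarith
  have hφ := temporalWeight_pos s hx
  have hle : ∀ᵐ y : Fin d → ℝ, Ws (x - y) * scaledNorm s (x - y) ^ p * |Q t x y| *
      temporalWeight s y ^ (-a) ≤ 2 ^ a * temporalWeight s x ^ (-a) *
      (Ws (x - y) * scaledNorm s (x - y) ^ p * |Q t x y| * temporalWeight s y ^ (-(0 : ℝ)) +
        Ws (x - y) * scaledNorm s (x - y) ^ (p + a) * |Q t x y| *
          temporalWeight s y ^ (-a)) := by
    filter_upwards [ae_ne_zero] with y hy
    have e1 := temporalWeight_rpow_neg_le_mul h.one_le_scaling ha0 hx hy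
    have e2 : 0 ≤ Ws (x - y) * scaledNorm s (x - y) ^ p * |Q t x y| :=
      mul_nonneg (mul_nonneg (h.star_nonneg _) (Real.rpow_nonneg (scaledNorm_nonneg _ _) _))
        (abs_nonneg _)
    refine (mul_le_mul_of_nonneg_left e1 e2).trans (le_of_eq ?_)
    rw [neg_zero, Real.rpow_zero, Real.rpow_add_of_nonneg (scaledNorm_nonneg _ _) hp ha0]
    ring
  have e4 := integral_mono_ae k1 ((k2.add k3).const_mul _) hle
  refine e4.trans ?_
  rw [integral_const_mul]
  have e5 := integral_add k2 k3
  simp only [Pi.add_apply]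
  rw [e5]
  change _ * (kernelMoment s Q Ws p 0 t x + kernelMoment s Q Ws (p + a) a t x) ≤ _
  rw [sub_zero] at k2'
  rw [add_sub_cancel_right] at k3'
  have e6 : 0 ≤ t ^ (p / ℓ) * temporalWeight s x ^ (-a) := by positivity
  calc 2 ^ a * temporalWeight s x ^ (-a) *
        (kernelMoment s Q Ws p 0 t x + kernelMoment s Q Ws (p + a) a t x)
      ≤ 2 ^ a * temporalWeight s x ^ (-a) * (C2 * t ^ (p / ℓ) + C3 * t ^ (p / ℓ)) := by gcongr
    _ = (2 ^ a * (C2 + C3)) * (t ^ (p / ℓ) * temporalWeight s x ^ (-a)) := by ring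
    _ ≤ (C1 + 2 ^ a * (C2 + C3)) * (t ^ (p / ℓ) * temporalWeight s x ^ (-a)) := by
        gcongr; linarith
    _ = _ := by ring

/-- The basic estimate of an integral against the kernel. -/
theorem abs_kernelInt_le_sum (h : WeightedSemigroup s ℓ G Q W Ws) {ι : Type*} (J : Finset ι)
    {N p a : ι → ℝ} (hp : ∀ j ∈ J, 0 ≤ p j) (ha0 : ∀ j ∈ J, 0 ≤ a j) (ha : ∀ j ∈ J, a j < s 0)
    {g : (Fin d → ℝ) → ℝ} (hg : AEStronglyMeasurable g volume) {t : ℝ} (ht : t ∈ Ioc (0 : ℝ) 1)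
    (x : Fin d → ℝ)
    (hle : ∀ᵐ y, |g y| * W x ≤ ∑ j ∈ J, N j *
      (Ws (x - y) * scaledNorm s (x - y) ^ p j * temporalWeight s y ^ (-(a j)))) :
    Integrable (fun y => Q t x y * g y) ∧
      |kernelInt Q t g x| * W x ≤ ∑ j ∈ J, N j * kernelMoment s Q Ws (p j) (a j) t x := by
  have hWx := h.weight.pos x
  have hI : ∀ j ∈ J, Integrable fun y => N j * (Ws (x - y) * scaledNorm s (x - y) ^ p j *
      |Q t x y| * temporalWeight s y ^ (-(a j))) := fun j hj => by
    obtain ⟨C, -, hC⟩ := h.kernelMoment_le_time (hp j hj) (ha0 j hj) (ha j hj)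
    exact (hC t ht x).1.const_mul _
  have hle' : ∀ᵐ y, ‖Q t x y * g y * W x‖ ≤ ∑ j ∈ J, N j * (Ws (x - y) *
      scaledNorm s (x - y) ^ p j * |Q t x y| * temporalWeight s y ^ (-(a j))) := by
    filter_upwards [hle] with y hy
    rw [norm_mul, norm_mul, Real.norm_eq_abs, Real.norm_eq_abs, Real.norm_of_nonneg hWx.le,
      mul_assoc]
    refine (mul_le_mul_of_nonneg_left hy (abs_nonneg _)).trans (le_of_eq ?_)
    rw [Finset.mul_sum]
    exact Finset.sum_congr rfl fun j _ => by ring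
  have hint : Integrable (fun y => Q t x y * g y * W x) := by
    refine (integrable_finsetSum J hI).mono' ?_ hle'
    exact (((h.continuous_kernel_right ht.1 x).aestronglyMeasurable).mul hg).mul_const _
  refine ⟨?_, ?_⟩
  · have := hint.mul_const (W x)⁻¹
    simpa [mul_assoc, hWx.ne'] using this
  · have e1 : |kernelInt Q t g x| * W x = ‖∫ y, Q t x y * g y * W x‖ := by
      rw [integral_mul_const, norm_mul, Real.norm_eq_abs, Real.norm_of_nonneg hWx.le, kernelInt]
    rw [e1]
    refine (norm_integral_le_of_norm_le (integrable_finsetSum J hI) hle').trans (le_of_eq ?_)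
    rw [integral_finsetSum J hI]
    exact Finset.sum_congr rfl fun j _ => integral_const_mul _ _

theorem abs_kernelInt_le_moment (h : WeightedSemigroup s ℓ G Q W Ws) {a N : ℝ} (ha0 : 0 ≤ a)
    (ha : a < s 0) {g : (Fin d → ℝ) → ℝ} (hg : WeightedBound s W a N g) {t : ℝ}
    (ht : t ∈ Ioc (0 : ℝ) 1) (x : Fin d → ℝ) :
    Integrable (fun y => Q t x y * g y) ∧
      |kernelInt Q t g x| * W x ≤ N * kernelMoment s Q Ws 0 a t x := by
  have := h.abs_kernelInt_le_sum (Finset.univ : Finset Unit) (N := fun _ => N) (p := fun _ => 0)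
    (a := fun _ => a) (fun _ _ => le_rfl) (fun _ _ => ha0) (fun _ _ => ha)
    hg.aestronglyMeasurable ht x ?_
  · simpa using this
  · filter_upwards [hg.bound] with y hy
    simp only [Finset.univ_unique, Finset.sum_singleton, Real.rpow_zero, mul_one]
    calc |g y| * W x ≤ |g y| * (Ws (x - y) * W y) :=
          mul_le_mul_of_nonneg_left (h.weight.le_star_mul x y) (abs_nonneg _)
      _ = Ws (x - y) * (|g y| * W y) := by ring
      _ ≤ Ws (x - y) * (N * temporalWeight s y ^ (-a)) :=
          mul_le_mul_of_nonneg_left hy (h.star_nonneg _)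
      _ = _ := by ring

theorem integrable_kernel_mul (h : WeightedSemigroup s ℓ G Q W Ws) {a N : ℝ} (ha0 : 0 ≤ a)
    (ha : a < s 0) {g : (Fin d → ℝ) → ℝ} (hg : WeightedBound s W a N g) {t : ℝ}
    (ht : t ∈ Ioc (0 : ℝ) 1) (x : Fin d → ℝ) : Integrable (fun y => Q t x y * g y) :=
  (h.abs_kernelInt_le_moment ha0 ha hg ht x).1

/-- The bound in time serves Besov norms, the bound in the temporal weight serves local norms; both
share one constant, uniform in g. -/
theorem abs_kernelInt_le (h : WeightedSemigroup s ℓ G Q W Ws) {a : ℝ} (ha0 : 0 ≤ a)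
    (ha : a < s 0) :
    ∃ C : ℝ, 0 < C ∧ ∀ (N : ℝ), 0 ≤ N → ∀ (g : (Fin d → ℝ) → ℝ), WeightedBound s W a N g →
      ∀ t ∈ Ioc (0 : ℝ) 1, ∀ x, |kernelInt Q t g x| * W x ≤ C * N * t ^ (-a / ℓ) ∧
        (x 0 ≠ 0 → |kernelInt Q t g x| * W x ≤ C * N * temporalWeight s x ^ (-a)) := by
  obtain ⟨C, hC, h1⟩ := h.kernelMoment_le le_rfl ha0 ha
  refine ⟨C, hC, fun N hN g hg t ht x => ?_⟩
  obtain ⟨-, h2, h3⟩ := h1 t ht x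
  have h4 := (h.abs_kernelInt_le_moment ha0 ha hg ht x).2
  rw [zero_sub] at h2
  refine ⟨h4.trans ?_, fun hx => h4.trans ?_⟩
  · calc _ ≤ N * (C * t ^ (-a / ℓ)) := mul_le_mul_of_nonneg_left h2 hN
      _ = _ := by ring
  · have h3' := h3 hx
    rw [zero_div, Real.rpow_zero, mul_one] at h3'
    calc _ ≤ N * (C * temporalWeight s x ^ (-a)) := mul_le_mul_of_nonneg_left h3' hN
      _ = _ := by ring

/-- Dominated convergence: translating the Cauchy majorant from x to x₀ costs a factor that does not
depend on the integration variable. -/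
theorem continuous_kernelInt (h : WeightedSemigroup s ℓ G Q W Ws) {a N : ℝ} (ha0 : 0 ≤ a)
    (ha : a < s 0) (hN : 0 ≤ N) {g : (Fin d → ℝ) → ℝ} (hg : WeightedBound s W a N g) {t : ℝ}
    (ht : t ∈ Ioc (0 : ℝ) 1) : Continuous (kernelInt Q t g) := by
  have ht0 : 0 < t := ht.1
  obtain ⟨C1, hC1, h1⟩ := h.star_mul_abs_kernel_le le_rfl one_pos
  obtain ⟨C2, hC2, h2⟩ := cauchyKernel_mul_temporalWeight h.one_le_scaling h.order_pos ha0 ha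
  rw [continuous_iff_continuousAt]
  intro x₀
  -- Gathers the x-dependent factors of the majorant; being continuous, it is below its value at x₀
  -- plus one near x₀.
  set E : (Fin d → ℝ) → ℝ := fun x =>
    (∏ i, (2 * (1 + (t ^ (-(s i) / ℓ) * (x - x₀) i) ^ 2))) * (W x)⁻¹ with hE
  have hEc : Continuous E := by
    refine Continuous.mul (by fun_prop) (h.weight.continuous_weight.inv₀ fun x =>
      (h.weight.pos x).ne')
  have hEb : ∀ᶠ x in 𝓝 x₀, E x < E x₀ + 1 :=
    hEc.continuousAt.eventually (gt_mem_nhds (lt_add_one _))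
  refine continuousAt_of_dominated
    (bound := fun y => C1 * (E x₀ + 1) * N *
      (cauchyKernel s ℓ t (x₀ - y) * temporalWeight s y ^ (-a))) ?_ ?_ ?_ ?_
  · exact Eventually.of_forall fun x =>
      (h.continuous_kernel_right ht0 x).aestronglyMeasurable.mul hg.aestronglyMeasurable
  · filter_upwards [hEb] with x hx
    filter_upwards [hg.bound] with y hy
    have hWx := h.weight.pos x
    have hk := (cauchyKernel_pos (s := s) (ℓ := ℓ) ht0 (x₀ - y)).le
    have hφ : 0 ≤ temporalWeight s y ^ (-a) := Real.rpow_nonneg (temporalWeight_nonneg _ _) _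
    have e1 : |g y| ≤ Ws (x - y) * (N * temporalWeight s y ^ (-a)) * (W x)⁻¹ := by
      rw [← div_eq_mul_inv, le_div_iff₀ hWx]
      calc |g y| * W x ≤ |g y| * (Ws (x - y) * W y) :=
            mul_le_mul_of_nonneg_left (h.weight.le_star_mul x y) (abs_nonneg _)
        _ = Ws (x - y) * (|g y| * W y) := by ring
        _ ≤ _ := mul_le_mul_of_nonneg_left hy (h.star_nonneg _)
    have e2 := h1 t ht x y
    rw [Real.rpow_zero, zero_div, Real.rpow_zero, mul_one, mul_one] at e2
    have e3 := cauchyKernel_add_le (s := s) (ℓ := ℓ) ht0 (x₀ - y) (x - x₀)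
    have e4 : x₀ - y + (x - x₀) = x - y := by abel
    rw [e4] at e3
    rw [norm_mul, Real.norm_eq_abs, Real.norm_eq_abs]
    calc |Q t x y| * |g y| ≤ |Q t x y| * (Ws (x - y) * (N * temporalWeight s y ^ (-a)) *
          (W x)⁻¹) := mul_le_mul_of_nonneg_left e1 (abs_nonneg _)
      _ = (Ws (x - y) * |Q t x y|) * (N * temporalWeight s y ^ (-a) * (W x)⁻¹) := by ring
      _ ≤ (C1 * ((∏ i, (2 * (1 + (t ^ (-(s i) / ℓ) * (x - x₀) i) ^ 2))) *
          cauchyKernel s ℓ t (x₀ - y))) * (N * temporalWeight s y ^ (-a) * (W x)⁻¹) := by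
          refine mul_le_mul_of_nonneg_right (e2.trans ?_) (by positivity)
          exact mul_le_mul_of_nonneg_left e3 hC1.le
      _ = C1 * E x * N * (cauchyKernel s ℓ t (x₀ - y) * temporalWeight s y ^ (-a)) := by
          simp only [hE]; ring
      _ ≤ _ := by gcongr
  · exact (h2 t ht x₀).1.const_mul _
  · exact Eventually.of_forall fun y =>
      ((h.continuous_kernel_left ht0 y).mul continuous_const).continuousAt

/-- Smoothing by a positive time removes the singularity at the plane: the exponent drops from a to
0. -/
theorem weightedBound_kernelInt (h : WeightedSemigroup s ℓ G Q W Ws) {a N : ℝ} (ha0 : 0 ≤ a)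
    (ha : a < s 0) (hN : 0 ≤ N) {g : (Fin d → ℝ) → ℝ} (hg : WeightedBound s W a N g) {t : ℝ}
    (ht : t ∈ Ioc (0 : ℝ) 1) : ∃ N' : ℝ, 0 ≤ N' ∧ (∀ x, |kernelInt Q t g x| * W x ≤ N') ∧
      WeightedBound s W 0 N' (kernelInt Q t g) := by
  obtain ⟨C, hC, h1⟩ := h.abs_kernelInt_le ha0 ha
  have ht0 : 0 < t := ht.1
  refine ⟨C * N * t ^ (-a / ℓ), by positivity, fun x => (h1 N hN g hg t ht x).1,
    (h.continuous_kernelInt ha0 ha hN hg ht).aestronglyMeasurable, Eventually.of_forall fun x => ?_⟩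
  rw [neg_zero, Real.rpow_zero, mul_one]
  exact (h1 N hN g hg t ht x).1

/-- Fubini and the Chapman–Kolmogorov identity. The time t + r may exceed 1, where the moment bounds
are not available, but the identity holds for all positive times. -/
theorem kernelInt_kernelInt (h : WeightedSemigroup s ℓ G Q W Ws) {a N : ℝ} (ha0 : 0 ≤ a)
    (ha : a < s 0) (hN : 0 ≤ N) {g : (Fin d → ℝ) → ℝ} (hg : WeightedBound s W a N g) {t r : ℝ}
    (ht : t ∈ Ioc (0 : ℝ) 1) (hr : r ∈ Ioc (0 : ℝ) 1) (x : Fin d → ℝ) :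
    kernelInt Q t (kernelInt Q r g) x = kernelInt Q (t + r) g x := by
  obtain ⟨C, hC, hmom⟩ := h.kernelMoment_le_time (p := 0) le_rfl ha0 ha
  have hr0 : 0 < r := hr.1
  have hs0 : 0 < s 0 := by have := h.one_le_scaling 0; positivity
  have habs : WeightedBound s W a N (fun y => |g y|) :=
    ⟨hg.aestronglyMeasurable.norm, by simpa using hg.bound⟩
  have hmeas : AEStronglyMeasurable
      (Function.uncurry fun y z => Q t x y * (Q r y z * g z)) (volume.prod volume) := by
    refine AEStronglyMeasurable.mul ?_ (AEStronglyMeasurable.mul ?_ ?_)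
    · exact ((h.continuous_kernel_right ht.1 x).comp continuous_fst).aestronglyMeasurable
    · exact (h.semigroup.continuous_kernel r hr0).aestronglyMeasurable
    · exact hg.aestronglyMeasurable.comp_snd
  -- The inner integral of absolute values is itself bounded with weight W, hence integrable against
  -- the outer kernel, as Tonelli requires.
  have hinner : ∀ y, (∫ z, |Q r y z * g z|) * W y ≤ N * (C * r ^ (-a / ℓ)) := by
    intro y
    have hWy := h.weight.pos y
    have e1 := (hmom r hr y).1
    have e2 := (hmom r hr y).2
    rw [zero_sub] at e2
    refine le_trans ?_ (mul_le_mul_of_nonneg_left e2 hN)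
    rw [← integral_mul_const, kernelMoment, ← integral_const_mul]
    refine integral_mono_ae ((h.integrable_kernel_mul ha0 ha hg hr y).abs.mul_const _)
      (e1.const_mul _) ?_
    filter_upwards [hg.bound] with z hz
    simp only [Real.rpow_zero, mul_one]
    rw [abs_mul]
    calc |Q r y z| * |g z| * W y ≤ |Q r y z| * |g z| * (Ws (y - z) * W z) :=
          mul_le_mul_of_nonneg_left (h.weight.le_star_mul y z) (by positivity)
      _ = |Q r y z| * Ws (y - z) * (|g z| * W z) := by ring
      _ ≤ |Q r y z| * Ws (y - z) * (N * temporalWeight s z ^ (-a)) :=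
          mul_le_mul_of_nonneg_left hz (mul_nonneg (abs_nonneg _) (h.star_nonneg _))
      _ = _ := by ring
  have hint : Integrable
      (Function.uncurry fun y z => Q t x y * (Q r y z * g z)) (volume.prod volume) := by
    rw [integrable_prod_iff hmeas]
    refine ⟨Eventually.of_forall fun y =>
      (h.integrable_kernel_mul ha0 ha hg hr y).const_mul (Q t x y), ?_⟩
    have e0 : WeightedBound s W 0 (N * (C * r ^ (-a / ℓ))) fun y => ∫ z, |Q r y z * g z| := by
      refine ⟨?_, Eventually.of_forall fun y => ?_⟩
      · have : AEStronglyMeasurable (Function.uncurry fun y z => |Q r y z * g z|)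
            ((volume : Measure (Fin d → ℝ)).prod (volume : Measure (Fin d → ℝ))) :=
          (AEStronglyMeasurable.mul
            (h.semigroup.continuous_kernel r hr0).aestronglyMeasurable
            hg.aestronglyMeasurable.comp_snd).norm
        exact this.integral_prod_right'
      · rw [neg_zero, Real.rpow_zero, mul_one, abs_of_nonneg (integral_nonneg fun z => abs_nonneg _)]
        exact hinner y
    have e1 := (h.integrable_kernel_mul le_rfl hs0 e0 ht x).norm
    refine e1.congr (Eventually.of_forall fun y => ?_)
    simp only [Function.uncurry, norm_mul, Real.norm_eq_abs]
    rw [integral_const_mul, abs_of_nonneg (integral_nonneg fun z => abs_nonneg _)]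
    simp only [abs_mul]
  have e1 : kernelInt Q t (kernelInt Q r g) x = ∫ y, ∫ z, Q t x y * (Q r y z * g z) := by
    unfold kernelInt
    exact integral_congr_ae (Eventually.of_forall fun y => (integral_const_mul _ _).symm)
  rw [e1, integral_integral_swap hint, kernelInt]
  refine integral_congr_ae (Eventually.of_forall fun z => ?_)
  simp only [← mul_assoc]
  rw [integral_mul_const]
  congr 1
  have := h.semigroup.semigroup r (t + r) hr0 (by linarith [ht.1]) x z
  rwa [add_sub_cancel_right] at this

/-- Lipschitz continuity in time, away from time zero. -/
theorem abs_kernelInt_sub_le (h : WeightedSemigroup s ℓ G Q W Ws) {δ : ℝ} (hδ : 0 < δ) :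
    ∃ C : ℝ, 0 < C ∧ ∀ (N : ℝ), 0 ≤ N → ∀ (g : (Fin d → ℝ) → ℝ), WeightedBound s W 0 N g →
      ∀ t ∈ Icc δ 1, ∀ t' ∈ Icc δ 1, ∀ x,
        |kernelInt Q t' g x - kernelInt Q t g x| * W x ≤ C * N * |t' - t| := by
  have hs0 : 0 < s 0 := by have := h.one_le_scaling 0; positivity
  obtain ⟨C1, hC1, h1⟩ := h.star_mul_abs_deriv_le
  obtain ⟨C2, hC2, h2⟩ := cauchyKernel_mul_temporalWeight h.one_le_scaling h.order_pos le_rfl hs0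
  set A := δ ^ (-(∑ i, s i) / ℓ) with hA
  have hA0 : 0 < A := by positivity
  refine ⟨C1 * δ⁻¹ * A * C2, by positivity, fun N hN g hg t ht t' ht' x => ?_⟩
  have hWx := h.weight.pos x
  have hI := h.integrable_kernel_mul le_rfl hs0 hg ⟨hδ.trans_le ht.1, ht.2⟩ x
  have hI' := h.integrable_kernel_mul le_rfl hs0 hg ⟨hδ.trans_le ht'.1, ht'.2⟩ x
  -- Mean value inequality in time on [δ, 1]; every majorant with time in this interval is compared
  -- with the one at time 1, so the bound can be integrated in y.
  have hker : ∀ y, Ws (x - y) * |Q t' x y - Q t x y| ≤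
      C1 * δ⁻¹ * A * |t' - t| * cauchyKernel s ℓ 1 (x - y) := by
    intro y
    have hWs : 0 < Ws (x - y) := zero_lt_one.trans_le (h.weight.one_le_star _)
    have hb : ∀ r ∈ Icc δ 1, ‖deriv (fun r => Q r x y) r‖ ≤
        C1 * δ⁻¹ * A * cauchyKernel s ℓ 1 (x - y) / Ws (x - y) := by
      intro r hr
      have hr0 : 0 < r := hδ.trans_le hr.1
      rw [le_div_iff₀ hWs, mul_comm, Real.norm_eq_abs]
      refine (h1 r ⟨hr0, hr.2⟩ x y).trans ?_
      have e1 := cauchyKernel_le_one h.one_le_scaling h.order_pos hδ hr (x - y)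
      have e2 : r⁻¹ ≤ δ⁻¹ := inv_anti₀ hδ hr.1
      have e3 := (cauchyKernel_pos (s := s) (ℓ := ℓ) hr0 (x - y)).le
      calc C1 * r⁻¹ * cauchyKernel s ℓ r (x - y)
          ≤ C1 * δ⁻¹ * (A * cauchyKernel s ℓ 1 (x - y)) := by gcongr
        _ = _ := by ring
    have e4 := Convex.norm_image_sub_le_of_norm_deriv_le (f := fun r => Q r x y)
      (fun r hr => h.semigroup.differentiable r (hδ.trans_le hr.1) x y) hb (convex_Icc δ 1) ht ht'
    rw [Real.norm_eq_abs, Real.norm_eq_abs] at e4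
    calc Ws (x - y) * |Q t' x y - Q t x y|
        ≤ Ws (x - y) * (C1 * δ⁻¹ * A * cauchyKernel s ℓ 1 (x - y) / Ws (x - y) * |t' - t|) := by
          gcongr
      _ = _ := by field_simp
  have e5 : (kernelInt Q t' g x - kernelInt Q t g x) * W x =
      ∫ y, (Q t' x y - Q t x y) * g y * W x := by
    rw [integral_mul_const]
    simp only [sub_mul _ _ (g _)]
    rw [integral_sub hI' hI, kernelInt, kernelInt]
  have e6 : |kernelInt Q t' g x - kernelInt Q t g x| * W x =
      ‖∫ y, (Q t' x y - Q t x y) * g y * W x‖ := by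
    rw [← e5, norm_mul, Real.norm_eq_abs, Real.norm_of_nonneg hWx.le]
  obtain ⟨k1, k2⟩ := h2 1 (right_mem_Ioc.2 one_pos) x
  rw [Real.one_rpow, mul_one] at k2
  rw [e6]
  refine (norm_integral_le_of_norm_le (k1.const_mul (C1 * δ⁻¹ * A * |t' - t| * N)) ?_).trans ?_
  · filter_upwards [hg.bound] with y hy
    rw [norm_mul, norm_mul, Real.norm_eq_abs, Real.norm_eq_abs, Real.norm_of_nonneg hWx.le]
    calc |Q t' x y - Q t x y| * |g y| * W x
        ≤ |Q t' x y - Q t x y| * |g y| * (Ws (x - y) * W y) :=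
          mul_le_mul_of_nonneg_left (h.weight.le_star_mul x y) (by positivity)
      _ = (Ws (x - y) * |Q t' x y - Q t x y|) * (|g y| * W y) := by ring
      _ ≤ (C1 * δ⁻¹ * A * |t' - t| * cauchyKernel s ℓ 1 (x - y)) *
          (N * temporalWeight s y ^ (-(0 : ℝ))) := by
          refine mul_le_mul (hker y) hy (mul_nonneg (abs_nonneg _) (h.weight.pos y).le) ?_
          have := (cauchyKernel_pos (s := s) (ℓ := ℓ) one_pos (x - y)).le
          positivity
      _ = _ := by ring
  · rw [integral_const_mul]
    calc _ ≤ C1 * δ⁻¹ * A * |t' - t| * N * C2 := by gcongr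
      _ = _ := by ring

/-- Weighted uniform convergence passes to the integrals against the kernel. -/
theorem tendsto_kernelInt (h : WeightedSemigroup s ℓ G Q W Ws) {g : ℕ → (Fin d → ℝ) → ℝ}
    {g₀ : (Fin d → ℝ) → ℝ} {a : ℝ} (ha0 : 0 ≤ a) (ha : a < s 0) {N ε : ℕ → ℝ}
    (hg : ∀ n, WeightedBound s W a (N n) (g n))
    (hε : Tendsto ε atTop (𝓝 0)) (hle : ∀ n x, |g n x - g₀ x| * W x ≤ ε n) {t : ℝ}
    (ht : t ∈ Ioc (0 : ℝ) 1) (x : Fin d → ℝ) :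
    Tendsto (fun n => kernelInt Q t (g n) x) atTop (𝓝 (kernelInt Q t g₀ x)) := by
  have hs0 : 0 < s 0 := by have := h.one_le_scaling 0; positivity
  obtain ⟨C, hC, h1⟩ := h.abs_kernelInt_le le_rfl hs0
  have hε0 : ∀ n, 0 ≤ ε n := fun n =>
    (mul_nonneg (abs_nonneg _) (h.weight.pos x).le).trans (hle n x)
  have hconv : ∀ y, Tendsto (fun n => g n y) atTop (𝓝 (g₀ y)) := fun y => by
    rw [tendsto_iff_dist_tendsto_zero]
    refine squeeze_zero (fun _ => dist_nonneg) (g := fun n => ε n * (W y)⁻¹) (fun n => ?_)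
      (by simpa using hε.mul_const (W y)⁻¹)
    rw [Real.dist_eq, ← div_eq_mul_inv, le_div_iff₀ (h.weight.pos y)]
    exact hle n y
  have hg₀ : AEStronglyMeasurable g₀ volume :=
    aestronglyMeasurable_of_tendsto_ae atTop (fun n => (hg n).aestronglyMeasurable)
      (Eventually.of_forall hconv)
  have hd : ∀ n, WeightedBound s W 0 (ε n) (fun y => g n y - g₀ y) := fun n =>
    ⟨(hg n).aestronglyMeasurable.sub hg₀, Eventually.of_forall fun y => by
      rw [neg_zero, Real.rpow_zero, mul_one]; exact hle n y⟩
  have hI := fun n => h.integrable_kernel_mul le_rfl hs0 (hd n) ht x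
  have hI' := fun n => h.integrable_kernel_mul ha0 ha (hg n) ht x
  have heq : ∀ n, kernelInt Q t (fun y => g n y - g₀ y) x =
      kernelInt Q t (g n) x - kernelInt Q t g₀ x := fun n => by
    -- No bound on the limit g₀ is assumed: integrability comes from writing it as g_n minus the
    -- small difference.
    have : Integrable fun y => Q t x y * g₀ y := by
      refine ((hI' n).sub (hI n)).congr (Eventually.of_forall fun y => ?_)
      simp only [Pi.sub_apply]; ring
    unfold kernelInt
    rw [← integral_sub (hI' n) this]
    simp only [mul_sub]
  rw [tendsto_iff_dist_tendsto_zero]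
  have ht0 : 0 < t := ht.1
  refine squeeze_zero (fun _ => dist_nonneg)
    (g := fun n => C * ε n * t ^ (-(0 : ℝ) / ℓ) * (W x)⁻¹) (fun n => ?_) ?_
  · rw [Real.dist_eq, ← heq, ← div_eq_mul_inv, le_div_iff₀ (h.weight.pos x)]
    exact (h1 (ε n) (hε0 n) _ (hd n) t ht x).1
  · simpa using ((hε.const_mul C).mul_const (t ^ (-(0 : ℝ) / ℓ))).mul_const (W x)⁻¹

end WeightedSemigroup

/-! ### Families of the Besov spaces -/

section BesovFamilies

variable {d : ℕ}

theorem rpow_neg_mul_le_iff {t q A B : ℝ} (ht : 0 < t) : t ^ (-q) * A ≤ B ↔ A ≤ B * t ^ q := by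
  rw [Real.rpow_neg ht.le, inv_mul_le_iff₀ (Real.rpow_pos_of_pos ht q), mul_comm]

theorem besovNorm_le_ofReal_iff {ℓ α : ℝ} {W : (Fin d → ℝ) → ℝ} {Λ : QFamily d} {B : ℝ}
    (hB : 0 ≤ B) :
    besovNorm ℓ α W Λ ≤ ENNReal.ofReal B ↔ ∀ t x, |Λ t x| * W x ≤ B * (t : ℝ) ^ (α / ℓ) := by
  unfold besovNorm
  simp only [iSup_le_iff, ENNReal.ofReal_le_ofReal_iff hB, neg_div]
  exact forall_congr' fun t => forall_congr' fun x => rpow_neg_mul_le_iff t.2.1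

/-- A family `(Λ_t)_{0<t≤1}` of continuous functions with finite weighted supremum norms and
`Q_{t-r} Λ_r = Λ_t`. -/
structure IsSemigroupFamily (Q : ℝ → (Fin d → ℝ) → (Fin d → ℝ) → ℝ) (W : (Fin d → ℝ) → ℝ)
    (Λ : QFamily d) : Prop where
  continuous : ∀ t, Continuous (Λ t)
  bounded : ∀ t, ∃ N : ℝ, 0 ≤ N ∧ ∀ x, |Λ t x| * W x ≤ N
  kernelInt_eq : ∀ r t : Ioc (0 : ℝ) 1, (r : ℝ) < t → ∀ x,
    kernelInt Q ((t : ℝ) - r) (Λ r) x = Λ t x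

/-- After multiplication by W the convergence is uniform, and W can be divided out because it is
continuous and positive. -/
theorem continuous_of_weighted_limit {W : (Fin d → ℝ) → ℝ} (hW : Continuous W)
    (hW0 : ∀ x, 0 < W x) {g : ℕ → (Fin d → ℝ) → ℝ} {g₀ : (Fin d → ℝ) → ℝ} {ε : ℕ → ℝ}
    (hg : ∀ n, Continuous (g n)) (hε : Tendsto ε atTop (𝓝 0))
    (hle : ∀ n x, |g n x - g₀ x| * W x ≤ ε n) : Continuous g₀ := by
  have h1 : TendstoUniformly (fun n x => g n x * W x) (fun x => g₀ x * W x) atTop := by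
    rw [Metric.tendstoUniformly_iff]
    intro e he
    filter_upwards [hε.eventually (gt_mem_nhds he)] with n hn x
    rw [dist_comm, Real.dist_eq, ← sub_mul, abs_mul, abs_of_pos (hW0 x)]
    exact (hle n x).trans_lt hn
  have h2 := h1.continuous (Frequently.of_forall fun n => (hg n).mul hW)
  have h3 : g₀ = fun x => g₀ x * W x * (W x)⁻¹ := by
    funext x; rw [mul_inv_cancel_right₀ (hW0 x).ne']
  rw [h3]
  exact h2.mul (hW.inv₀ fun x => (hW0 x).ne')

/-- The shift by n₀ discards the indices at which the norm may be infinite, so that the errors are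
real numbers. -/
theorem exists_weighted_approx {Q : ℝ → (Fin d → ℝ) → (Fin d → ℝ) → ℝ} {W : (Fin d → ℝ) → ℝ}
    {ℓ α : ℝ} {Λ : QFamily d} {f : ℕ → (Fin d → ℝ) → ℝ}
    (hlim : Tendsto (fun n => besovNorm ℓ α W (toQFamily Q (f n) - Λ)) atTop (𝓝 0)) :
    ∃ (n₀ : ℕ) (ε : ℕ → ℝ), Tendsto ε atTop (𝓝 0) ∧ ∀ n (t : Ioc (0 : ℝ) 1) x,
      |kernelInt Q t (f (n + n₀)) x - Λ t x| * W x ≤ ε n * (t : ℝ) ^ (α / ℓ) := by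
  obtain ⟨n₀, hn₀⟩ := eventually_atTop.1 (hlim.eventually (gt_mem_nhds ENNReal.zero_lt_top))
  refine ⟨n₀, fun n => (besovNorm ℓ α W (toQFamily Q (f (n + n₀)) - Λ)).toReal, ?_, ?_⟩
  · have := (ENNReal.tendsto_toReal ENNReal.zero_ne_top).comp
      (hlim.comp (tendsto_add_atTop_nat n₀))
    rwa [ENNReal.toReal_zero] at this
  · intro n
    exact (besovNorm_le_ofReal_iff ENNReal.toReal_nonneg).1
      (ENNReal.ofReal_toReal (hn₀ (n + n₀) (Nat.le_add_left _ _)).ne).ge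

variable [NeZero d] {s : Fin d → ℝ} {ℓ : ℝ} {G : (Fin d → ℝ) → ℝ}
  {Q : ℝ → (Fin d → ℝ) → (Fin d → ℝ) → ℝ} {W Ws : (Fin d → ℝ) → ℝ}

theorem WeightedBound.of_continuous {g : (Fin d → ℝ) → ℝ} (hg : Continuous g) {N : ℝ}
    (h : ∀ x, |g x| * W x ≤ N) : WeightedBound s W 0 N g :=
  ⟨hg.aestronglyMeasurable, Eventually.of_forall fun x => by
    rw [neg_zero, Real.rpow_zero, mul_one]; exact h x⟩

theorem MemCw.weightedBound (hW : ∀ x, 0 < W x) {f : (Fin d → ℝ) → ℝ} (hf : MemCw W f) :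
    ∃ N : ℝ, 0 ≤ N ∧ WeightedBound s W 0 N f := by
  obtain ⟨hc, B, hB⟩ := hf
  exact ⟨B, (mul_nonneg (abs_nonneg _) (hW 0).le).trans (hB 0), .of_continuous hc hB⟩

theorem WeightedSemigroup.scaling_pos (h : WeightedSemigroup s ℓ G Q W Ws) : 0 < s 0 :=
  zero_lt_one.trans_le (h.one_le_scaling 0)

namespace IsSemigroupFamily

theorem weightedBound {Λ : QFamily d} (hΛ : IsSemigroupFamily Q W Λ) (t : Ioc (0 : ℝ) 1) :
    ∃ N : ℝ, 0 ≤ N ∧ WeightedBound s W 0 N (Λ t) := by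
  obtain ⟨N, hN, hle⟩ := hΛ.bounded t
  exact ⟨N, hN, .of_continuous (hΛ.continuous t) hle⟩

theorem sub_time_mem {r t : Ioc (0 : ℝ) 1} (h : (r : ℝ) < t) : (t : ℝ) - r ∈ Ioc (0 : ℝ) 1 :=
  ⟨sub_pos.2 h, by linarith [t.2.2, r.2.1]⟩

theorem sub (h : WeightedSemigroup s ℓ G Q W Ws) {Λ Λ' : QFamily d}
    (hΛ : IsSemigroupFamily Q W Λ) (hΛ' : IsSemigroupFamily Q W Λ') :
    IsSemigroupFamily Q W (Λ - Λ') where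
  continuous t := (hΛ.continuous t).sub (hΛ'.continuous t)
  bounded t := by
    obtain ⟨N, hN, hle⟩ := hΛ.bounded t
    obtain ⟨N', hN', hle'⟩ := hΛ'.bounded t
    refine ⟨N + N', by positivity, fun x => ?_⟩
    have := mul_le_mul_of_nonneg_right (abs_sub (Λ t x) (Λ' t x)) (h.weight.pos x).le
    simp only [Pi.sub_apply]
    linarith [hle x, hle' x]
  kernelInt_eq r t hrt x := by
    obtain ⟨N, -, hN⟩ := hΛ.weightedBound (s := s) r
    obtain ⟨N', -, hN'⟩ := hΛ'.weightedBound (s := s) r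
    have e1 := h.integrable_kernel_mul le_rfl h.scaling_pos hN (sub_time_mem hrt) x
    have e2 := h.integrable_kernel_mul le_rfl h.scaling_pos hN' (sub_time_mem hrt) x
    simp only [Pi.sub_apply]
    rw [← hΛ.kernelInt_eq r t hrt x, ← hΛ'.kernelInt_eq r t hrt x]
    simp only [kernelInt]
    rw [← integral_sub e1 e2]
    simp only [Pi.sub_apply, mul_sub]

/-- A semigroup family which vanishes at a positive rate as time tends to zero is trivial. -/
theorem eq_zero (h : WeightedSemigroup s ℓ G Q W Ws) {Λ : QFamily d}
    (hΛ : IsSemigroupFamily Q W Λ) {γ a B : ℝ} (hγ : 0 < γ) (ha0 : 0 ≤ a) (ha : a < s 0)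
    (hB : 0 ≤ B)
    (hle : ∀ (t : Ioc (0 : ℝ) 1) (x : Fin d → ℝ), x 0 ≠ 0 →
      |Λ t x| * W x ≤ B * (t : ℝ) ^ (γ / ℓ) * temporalWeight s x ^ (-a)) : Λ = 0 := by
  obtain ⟨C, hC, h1⟩ := h.abs_kernelInt_le ha0 ha
  have hℓ := h.order_pos
  funext t x
  have ht0 : 0 < (t : ℝ) := t.2.1
  -- From Λ_t = Q_{t-r} Λ_r. The temporal singularity costs (t-r)^{-a/ℓ}, which stays bounded for r
  -- ≤ t/2, while the rate r^{γ/ℓ} remains.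
  have key : ∀ r : ℝ, r ∈ Ioc 0 ((t : ℝ) / 2) →
      |Λ t x| * W x ≤ C * (B * r ^ (γ / ℓ)) * ((t : ℝ) / 2) ^ (-a / ℓ) := by
    intro r hr
    have hr0 : 0 < r := hr.1
    have hr1 : r < t := by linarith [hr.2]
    set r' : Ioc (0 : ℝ) 1 := ⟨r, hr0, by linarith [t.2.2]⟩ with hr'
    rw [← hΛ.kernelInt_eq r' t hr1 x]
    refine (h1 (B * r ^ (γ / ℓ)) (by positivity) (Λ r')
      ⟨(hΛ.continuous r').aestronglyMeasurable, ?_⟩ _ (sub_time_mem hr1) x).1.trans ?_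
    · filter_upwards [ae_ne_zero] with y hy
      exact hle r' y hy
    · have e1 : ((t : ℝ) - r) ^ (-a / ℓ) ≤ ((t : ℝ) / 2) ^ (-a / ℓ) := by
        refine Real.rpow_le_rpow_of_nonpos (by positivity) (by linarith [hr.2]) ?_
        rw [neg_div]; have : 0 ≤ a / ℓ := by positivity
        linarith
      exact mul_le_mul_of_nonneg_left e1 (by positivity)
  have hlim : Tendsto (fun r : ℝ => C * (B * r ^ (γ / ℓ)) * ((t : ℝ) / 2) ^ (-a / ℓ))
      (𝓝[>] 0) (𝓝 0) := by
    have e1 : Tendsto (fun r : ℝ => r ^ (γ / ℓ)) (𝓝[>] 0) (𝓝 0) := by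
      have := (Real.continuousAt_rpow_const 0 (γ / ℓ) (Or.inr (by positivity))).tendsto
      rw [Real.zero_rpow (by positivity)] at this
      exact this.mono_left nhdsWithin_le_nhds
    simpa using ((e1.const_mul B).const_mul C).mul_const (((t : ℝ) / 2) ^ (-a / ℓ))
  have hfin : |Λ t x| * W x ≤ 0 := by
    refine ge_of_tendsto hlim ?_
    filter_upwards [Ioc_mem_nhdsGT (half_pos ht0)] with r hr
    exact key r hr
  have hWx := h.weight.pos x
  have : |Λ t x| ≤ 0 := by
    by_contra hcon
    push Not at hcon
    exact absurd hfin (not_le.2 (mul_pos hcon hWx))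
  simpa using this

/-- A semigroup family with finite Besov norm of order `ζ ≤ 0` is in the Besov space: it is
approximated by its own members in the norms of lower orders. -/
theorem mem_besovSpace (h : WeightedSemigroup s ℓ G Q W Ws) {Λ : QFamily d}
    (hΛ : IsSemigroupFamily Q W Λ) {ζ : ℝ} (hζ : ζ ≤ 0) (hfin : besovNorm ℓ ζ W Λ < ⊤) :
    Λ ∈ BesovSpace ℓ Q ζ W := by
  have hℓ := h.order_pos
  refine ⟨fun α hα => ?_, hfin⟩
  set B := (besovNorm ℓ ζ W Λ).toReal with hBdef
  have hB0 : 0 ≤ B := ENNReal.toReal_nonneg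
  have hB : ∀ t x, |Λ t x| * W x ≤ B * (t : ℝ) ^ (ζ / ℓ) :=
    (besovNorm_le_ofReal_iff hB0).1 (by rw [hBdef, ENNReal.ofReal_toReal hfin.ne])
  -- The approximants are the members at times 1/(n+2) ≤ 1/2, so that t + 1/(n+2) ≤ 1 for all t ≤ δ
  -- ≤ 1/2.
  have hmem : ∀ n : ℕ, 1 / ((n : ℝ) + 2) ∈ Ioc (0 : ℝ) 1 := fun n =>
    ⟨by positivity, by rw [div_le_one (by positivity)]; linarith [n.cast_nonneg (α := ℝ)]⟩
  have hhalf : ∀ n : ℕ, 1 / ((n : ℝ) + 2) ≤ 1 / 2 := fun n => by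
    refine one_div_le_one_div_of_le (by norm_num) ?_
    linarith [n.cast_nonneg (α := ℝ)]
  have hto : Tendsto (fun n : ℕ => 1 / ((n : ℝ) + 2)) atTop (𝓝 0) := by
    refine tendsto_const_nhds.div_atTop ?_
    exact tendsto_atTop_add_const_right _ _ tendsto_natCast_atTop_atTop
  refine ⟨fun n => Λ ⟨_, hmem n⟩, fun n => ⟨hΛ.continuous _, ?_⟩, ?_⟩
  · obtain ⟨N, -, hN⟩ := hΛ.bounded ⟨_, hmem n⟩
    exact ⟨N, hN⟩
  rw [ENNReal.tendsto_nhds_zero]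
  intro ε' hε'
  obtain ⟨ε, hε, hεε'⟩ : ∃ ε : ℝ, 0 < ε ∧ ENNReal.ofReal ε ≤ ε' := by
    rcases eq_or_ne ε' ⊤ with rfl | hne
    · exact ⟨1, one_pos, le_top⟩
    · exact ⟨ε'.toReal, ENNReal.toReal_pos hε'.ne' hne, ENNReal.ofReal_toReal_le⟩
  -- A time below which both families are small in the norm of lower order.
  have hκ : 0 < (ζ - α) / ℓ := div_pos (sub_pos.2 hα) hℓ
  obtain ⟨δ, hδ0, hδ1, hδ⟩ : ∃ δ : ℝ, 0 < δ ∧ δ ≤ 1 / 2 ∧ 2 * B * δ ^ ((ζ - α) / ℓ) ≤ ε := by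
    have e1 : Tendsto (fun r : ℝ => 2 * B * r ^ ((ζ - α) / ℓ)) (𝓝[>] 0) (𝓝 0) := by
      have := (Real.continuousAt_rpow_const 0 ((ζ - α) / ℓ) (Or.inr hκ.le)).tendsto
      rw [Real.zero_rpow hκ.ne'] at this
      simpa using (this.mono_left nhdsWithin_le_nhds).const_mul (2 * B)
    have e2 := e1.eventually (gt_mem_nhds hε)
    obtain ⟨δ, h1, h2⟩ := (e2.and (Ioc_mem_nhdsGT (show (0 : ℝ) < 1 / 2 by norm_num))).exists
    exact ⟨δ, h2.1, h2.2, h1.le⟩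
  obtain ⟨C, hC, hLip⟩ := h.abs_kernelInt_sub_le (half_pos hδ0)
  set u : Ioc (0 : ℝ) 1 := ⟨δ / 2, by positivity, by linarith⟩ with hu
  obtain ⟨N, hN0, hN⟩ := hΛ.weightedBound (s := s) u
  have ev1 : ∀ᶠ n : ℕ in atTop, 1 / ((n : ℝ) + 2) < δ / 2 :=
    hto.eventually (gt_mem_nhds (by positivity))
  have ev2 : ∀ᶠ n : ℕ in atTop, C * N * (1 / ((n : ℝ) + 2)) < ε := by
    have := hto.const_mul (C * N)
    rw [mul_zero] at this
    exact this.eventually (gt_mem_nhds hε)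
  filter_upwards [ev1, ev2] with n hn1 hn2
  refine le_trans ?_ hεε'
  rw [besovNorm_le_ofReal_iff hε.le]
  intro t x
  set r : Ioc (0 : ℝ) 1 := ⟨1 / ((n : ℝ) + 2), hmem n⟩ with hr
  have hr0 : 0 < (r : ℝ) := r.2.1
  have hrh : (r : ℝ) ≤ 1 / 2 := hhalf n
  have ht0 : 0 < (t : ℝ) := t.2.1
  change |kernelInt Q t (Λ r) x - Λ t x| * W x ≤ _
  have hWx := h.weight.pos x
  obtain ⟨Nr, hNr0, hNr⟩ := hΛ.weightedBound (s := s) r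
  -- Below δ both terms are of order t^{ζ/ℓ}, and the gap ζ - α gives smallness. Above δ smallness
  -- comes from Lipschitz continuity in time.
  rcases le_total (t : ℝ) δ with htδ | htδ
  · set t' : Ioc (0 : ℝ) 1 := ⟨t + r, by positivity, by linarith⟩ with ht'
    have e1 : kernelInt Q t (Λ r) x = Λ t' x := by
      rw [← hΛ.kernelInt_eq r t' (by simp only [ht']; linarith) x]
      simp [ht']
    have e2 : |Λ t' x| * W x ≤ B * (t : ℝ) ^ (ζ / ℓ) := by
      refine (hB t' x).trans (mul_le_mul_of_nonneg_left ?_ hB0)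
      refine Real.rpow_le_rpow_of_nonpos ht0 (by simp only [ht']; linarith) ?_
      exact div_nonpos_of_nonpos_of_nonneg hζ hℓ.le
    have e3 := hB t x
    have e4 : (t : ℝ) ^ (ζ / ℓ) = (t : ℝ) ^ ((ζ - α) / ℓ) * (t : ℝ) ^ (α / ℓ) := by
      rw [← Real.rpow_add ht0]; congr 1; ring
    have e5 : (t : ℝ) ^ ((ζ - α) / ℓ) ≤ δ ^ ((ζ - α) / ℓ) :=
      Real.rpow_le_rpow ht0.le htδ hκ.le
    rw [e1]
    calc |Λ t' x - Λ t x| * W x ≤ (|Λ t' x| + |Λ t x|) * W x :=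
          mul_le_mul_of_nonneg_right (abs_sub _ _) hWx.le
      _ = |Λ t' x| * W x + |Λ t x| * W x := add_mul _ _ _
      _ ≤ B * (t : ℝ) ^ (ζ / ℓ) + B * (t : ℝ) ^ (ζ / ℓ) := add_le_add e2 e3
      _ = 2 * B * (t : ℝ) ^ ((ζ - α) / ℓ) * (t : ℝ) ^ (α / ℓ) := by rw [e4]; ring
      _ ≤ 2 * B * δ ^ ((ζ - α) / ℓ) * (t : ℝ) ^ (α / ℓ) := by gcongr
      _ ≤ _ := by gcongr
  · have hur : (r : ℝ) < u := hn1
    have hut : (u : ℝ) < t := by simp only [hu]; linarith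
    have hu0 : 0 < (u : ℝ) := u.2.1
    have m1 : (t : ℝ) - u ∈ Ioc (0 : ℝ) 1 := sub_time_mem hut
    set q : Ioc (0 : ℝ) 1 := ⟨u + r, by positivity, by simp only [hu]; linarith⟩ with hq
    have e1 : kernelInt Q u (Λ r) = Λ q := by
      funext y
      rw [← hΛ.kernelInt_eq r q (by simp only [hq]; linarith) y]
      simp [hq]
    have e2 : kernelInt Q r (Λ u) = Λ q := by
      funext y
      rw [← hΛ.kernelInt_eq u q (by simp only [hq]; linarith) y]
      simp [hq]
    -- The time t + r may exceed 1, where Λ is not defined, so one passes through u = δ/2: Q_t Λ_r =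
    -- Q_{t-u} Λ_{u+r} = Q_{t-u+r} Λ_u. Since r < u ≤ t - u, both t - u and t - u + r lie in [δ/2,
    -- 1].
    have e3 : kernelInt Q t (Λ r) x = kernelInt Q ((t : ℝ) - u + r) (Λ u) x := by
      have k1 := h.kernelInt_kernelInt le_rfl h.scaling_pos hNr0 hNr m1 u.2 x
      have k2 := h.kernelInt_kernelInt le_rfl h.scaling_pos hN0 hN m1 r.2 x
      rw [sub_add_cancel, e1] at k1
      rw [e2] at k2
      rw [← k1, k2]
    rw [e3, ← hΛ.kernelInt_eq u t hut x]
    have huδ : (u : ℝ) = δ / 2 := rfl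
    have e4 := hLip N hN0 _ hN ((t : ℝ) - u) ⟨by linarith, m1.2⟩ ((t : ℝ) - u + r)
      ⟨by linarith, by linarith [t.2.2]⟩ x
    have e5 : (t : ℝ) - u + r - ((t : ℝ) - u) = r := by ring
    rw [e5, abs_of_pos hr0] at e4
    have e6 : 1 ≤ (t : ℝ) ^ (α / ℓ) :=
      Real.one_le_rpow_of_pos_of_le_one_of_nonpos ht0 t.2.2
        (div_nonpos_of_nonpos_of_nonneg (hα.le.trans hζ) hℓ.le)
    calc _ ≤ C * N * r := e4
      _ ≤ ε := hn2.le
      _ ≤ _ := le_mul_of_one_le_right hε.le e6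

end IsSemigroupFamily

/-- For fixed t the factor t^{α/ℓ} is a constant, so Λ_t is a weighted uniform limit of the Q_t f_n;
continuity, boundedness and the semigroup identity pass to the limit. -/
theorem isSemigroupFamily_of_mem_besovCompletion (h : WeightedSemigroup s ℓ G Q W Ws) {α : ℝ}
    {Λ : QFamily d} (hΛ : Λ ∈ BesovCompletion ℓ Q α W) : IsSemigroupFamily Q W Λ := by
  obtain ⟨f, hf, hlim⟩ := hΛ
  obtain ⟨n₀, ε, hε, hle⟩ := exists_weighted_approx hlim
  choose N hN0 hN using fun n => (hf (n + n₀)).weightedBound (s := s) h.weight.pos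
  have hε' : ∀ t : Ioc (0 : ℝ) 1, Tendsto (fun n => ε n * (t : ℝ) ^ (α / ℓ)) atTop (𝓝 0) :=
    fun t => by simpa using hε.mul_const ((t : ℝ) ^ (α / ℓ))
  have hconv : ∀ (t : Ioc (0 : ℝ) 1) x,
      Tendsto (fun n => kernelInt Q t (f (n + n₀)) x) atTop (𝓝 (Λ t x)) := fun t x => by
    rw [tendsto_iff_dist_tendsto_zero]
    refine squeeze_zero (fun _ => dist_nonneg)
      (g := fun n => ε n * (t : ℝ) ^ (α / ℓ) * (W x)⁻¹) (fun n => ?_)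
      (by simpa using (hε' t).mul_const (W x)⁻¹)
    rw [Real.dist_eq, ← div_eq_mul_inv, le_div_iff₀ (h.weight.pos x)]
    exact hle n t x
  refine ⟨fun t => ?_, fun t => ?_, fun r t hrt x => ?_⟩
  · exact continuous_of_weighted_limit h.weight.continuous_weight h.weight.pos
      (fun n => h.continuous_kernelInt le_rfl h.scaling_pos (hN0 n) (hN n) t.2) (hε' t)
      fun n x => hle n t x
  · obtain ⟨N', hN'0, hN', -⟩ :=
      h.weightedBound_kernelInt le_rfl h.scaling_pos (hN0 0) (hN 0) t.2
    have hb : ∀ x, |Λ t x| * W x ≤ N' + ε 0 * (t : ℝ) ^ (α / ℓ) := fun x => by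
      have e1 : |Λ t x| ≤ |kernelInt Q t (f (0 + n₀)) x| +
          |kernelInt Q t (f (0 + n₀)) x - Λ t x| := by
        have := abs_sub (kernelInt Q t (f (0 + n₀)) x) (kernelInt Q t (f (0 + n₀)) x - Λ t x)
        rwa [sub_sub_cancel] at this
      have e2 := mul_le_mul_of_nonneg_right e1 (h.weight.pos x).le
      rw [add_mul] at e2
      linarith [hN' x, hle 0 t x]
    exact ⟨_, (mul_nonneg (abs_nonneg _) (h.weight.pos 0).le).trans (hb 0), hb⟩
  · have hm := IsSemigroupFamily.sub_time_mem hrt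
    choose N' hN'0 _ hN' using fun n =>
      h.weightedBound_kernelInt le_rfl h.scaling_pos (hN0 n) (hN n) r.2
    have e1 := h.tendsto_kernelInt le_rfl h.scaling_pos hN' (hε' r) (fun n x => hle n r x) hm x
    have e2 : ∀ n, kernelInt Q ((t : ℝ) - r) (kernelInt Q r (f (n + n₀))) x =
        kernelInt Q t (f (n + n₀)) x := fun n => by
      rw [h.kernelInt_kernelInt le_rfl h.scaling_pos (hN0 n) (hN n) hm r.2 x, sub_add_cancel]
    simp only [e2] at e1
    exact tendsto_nhds_unique e1 (hconv t x)

theorem isSemigroupFamily_of_mem_besovSpace (h : WeightedSemigroup s ℓ G Q W Ws) {ζ : ℝ}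
    {Λ : QFamily d} (hΛ : Λ ∈ BesovSpace ℓ Q ζ W) : IsSemigroupFamily Q W Λ :=
  isSemigroupFamily_of_mem_besovCompletion h (hΛ.1 (ζ - 1) (sub_one_lt ζ))

end BesovFamilies

/-! ### Sewing of germs -/

section Sewing

variable {d : ℕ} [NeZero d] {s : Fin d → ℝ} {ℓ : ℝ} {G : (Fin d → ℝ) → ℝ}
  {Q : ℝ → (Fin d → ℝ) → (Fin d → ℝ) → ℝ} {W Ws : (Fin d → ℝ) → ℝ}

theorem localNorm_le_ofReal_iff {γ η B : ℝ} (hB : 0 ≤ B)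
    {E : Ioc (0 : ℝ) 1 → OffPlane d → ℝ} :
    localNorm s ℓ γ η W E ≤ ENNReal.ofReal B ↔ ∀ (t : Ioc (0 : ℝ) 1) (x : OffPlane d),
      |E t x| * W x ≤ B * (t : ℝ) ^ (γ / ℓ) * temporalWeight s x ^ (-(γ - η)) := by
  unfold localNorm
  simp only [iSup_le_iff, ENNReal.ofReal_le_ofReal_iff hB, neg_div]
  refine forall_congr' fun t => forall_congr' fun x => ?_
  have hφ := temporalWeight_pos s x.2
  have e : (t : ℝ) ^ (-(γ / ℓ)) * temporalWeight s x ^ (γ - η) * W x * |E t x| =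
      (t : ℝ) ^ (-(γ / ℓ)) * (temporalWeight s x ^ (-(-(γ - η))) * (|E t x| * W x)) := by
    rw [neg_neg]; ring
  rw [e, rpow_neg_mul_le_iff t.2.1, rpow_neg_mul_le_iff hφ]

/-- A germ `F_t(x)`, with a size bound and a coherence bound. -/
structure IsGerm {ι : Type*} (s : Fin d → ℝ) (ℓ : ℝ) (Q : ℝ → (Fin d → ℝ) → (Fin d → ℝ) → ℝ)
    (W : (Fin d → ℝ) → ℝ) (J : Finset ι) (α : ι → ℝ) (γ η N₁ N₂ : ℝ)
    (F : ℝ → (Fin d → ℝ) → ℝ) : Prop where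
  aestronglyMeasurable : ∀ t ∈ Ioc (0 : ℝ) 1, AEStronglyMeasurable (F t) volume
  size : ∀ t ∈ Ioc (0 : ℝ) 1, ∀ y : Fin d → ℝ, y 0 ≠ 0 →
    |F t y| * W y ≤ N₁ * ∑ j ∈ J, t ^ (α j / ℓ) * temporalWeight s y ^ (min (η - α j) 0)
  coherence : ∀ t ∈ Ioc (0 : ℝ) 1, ∀ r ∈ Icc (t / 4) (t / 2), ∀ y : Fin d → ℝ, y 0 ≠ 0 →
    |F t y - kernelInt Q (t - r) (F r) y| * W y ≤
      N₂ * t ^ (γ / ℓ) * temporalWeight s y ^ (-(γ - η))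

/-- The absolute value in the constant covers both signs of the exponent. It is used to replace a
dyadic r, and t - r, by t. -/
theorem rpow_le_four_rpow_mul {r t q : ℝ} (ht : 0 < t) (hr : r ∈ Icc (t / 4) t) :
    r ^ q ≤ 4 ^ |q| * t ^ q := by
  have hr0 : 0 < r := (by positivity : 0 < t / 4).trans_le hr.1
  have h4 : (1 : ℝ) ≤ 4 ^ |q| := Real.one_le_rpow (by norm_num) (abs_nonneg q)
  rcases le_total 0 q with hq | hq
  · calc r ^ q ≤ t ^ q := Real.rpow_le_rpow hr0.le hr.2 hq
      _ ≤ _ := le_mul_of_one_le_left (by positivity) h4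
  · calc r ^ q ≤ (t / 4) ^ q := Real.rpow_le_rpow_of_nonpos (by positivity) hr.1 hq
      _ = _ := by
        rw [Real.div_rpow ht.le (by norm_num), abs_of_nonpos hq, Real.rpow_neg (by norm_num)]
        field_simp

/-- Dyadic times cannot be matched to t exactly; the window in the coherence of a germ is wide
enough to contain one of them. -/
theorem exists_half_pow_mem {t : ℝ} (ht : t ∈ Ioc (0 : ℝ) 1) :
    ∃ n : ℕ, (1 / 2 : ℝ) ^ n ∈ Icc (t / 4) (t / 2) := by
  obtain ⟨n, h1, h2⟩ := exists_nat_pow_near_of_lt_one (x := t / 2) (y := (1 / 2 : ℝ))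
    (by linarith [ht.1]) (by linarith [ht.2]) (by norm_num) (by norm_num)
  exact ⟨n + 1, by rw [pow_succ]; linarith, h1.le⟩

namespace IsGerm

variable {ι : Type*} {J : Finset ι} {α : ι → ℝ} {γ η N₁ N₂ : ℝ} {F : ℝ → (Fin d → ℝ) → ℝ}

/-- Since α_j < γ and η ≤ γ, each exponent min(η - α_j, 0) is at least η - γ; as φ ≤ 1, a single
singularity dominates the sum. -/
theorem weightedBound (hα : ∀ j ∈ J, α j < γ) (hη : η ≤ γ)
    (hN₁ : 0 ≤ N₁) (hF : IsGerm s ℓ Q W J α γ η N₁ N₂ F) {t : ℝ} (ht : t ∈ Ioc (0 : ℝ) 1) :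
    ∃ N : ℝ, 0 ≤ N ∧ WeightedBound s W (γ - η) N (F t) := by
  have ht0 : 0 < t := ht.1
  refine ⟨N₁ * ∑ j ∈ J, t ^ (α j / ℓ),
    mul_nonneg hN₁ (Finset.sum_nonneg fun j _ => by positivity),
    hF.aestronglyMeasurable t ht, ?_⟩
  filter_upwards [ae_ne_zero] with y hy
  have hφ := temporalWeight_pos s hy
  refine (hF.size t ht y hy).trans ?_
  rw [mul_assoc, Finset.sum_mul]
  refine mul_le_mul_of_nonneg_left (Finset.sum_le_sum fun j hj => ?_) hN₁
  refine mul_le_mul_of_nonneg_left ?_ (by positivity)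
  refine Real.rpow_le_rpow_of_exponent_ge hφ (temporalWeight_le_one s y) ?_
  rcases le_total (η - α j) 0 with h | h
  · rw [min_eq_left h]; linarith [hα j hj]
  · rw [min_eq_right h]; linarith

/-- Consecutive dyadic approximations of the reconstruction. -/
theorem abs_approx_sub_le (h : WeightedSemigroup s ℓ G Q W Ws) (hα : ∀ j ∈ J, α j < γ)
    (hη : η ≤ γ) (hη' : γ - η < s 0) (hN₁ : 0 ≤ N₁) (hN₂ : 0 ≤ N₂)
    (hF : IsGerm s ℓ Q W J α γ η N₁ N₂ F) {C : ℝ}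
    (hC : ∀ (N : ℝ), 0 ≤ N → ∀ (g : (Fin d → ℝ) → ℝ), WeightedBound s W (γ - η) N g →
      ∀ t ∈ Ioc (0 : ℝ) 1, ∀ x, |kernelInt Q t g x| * W x ≤ C * N * t ^ (-(γ - η) / ℓ) ∧
        (x 0 ≠ 0 → |kernelInt Q t g x| * W x ≤ C * N * temporalWeight s x ^ (-(γ - η))))
    {t r : ℝ} (ht : t ∈ Ioc (0 : ℝ) 1) (hr0 : 0 < r) (hr : r ≤ t / 2) (x : Fin d → ℝ) :
    |kernelInt Q (t - r) (F r) x - kernelInt Q (t - r / 2) (F (r / 2)) x| * W x ≤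
      C * (N₂ * r ^ (γ / ℓ)) * (t - r) ^ (-(γ - η) / ℓ) ∧
    (x 0 ≠ 0 →
      |kernelInt Q (t - r) (F r) x - kernelInt Q (t - r / 2) (F (r / 2)) x| * W x ≤
        C * (N₂ * r ^ (γ / ℓ)) * temporalWeight s x ^ (-(γ - η))) := by
  have ha0 : 0 ≤ γ - η := sub_nonneg.2 hη
  have ht0 : 0 < t := ht.1
  have m1 : r ∈ Ioc (0 : ℝ) 1 := ⟨hr0, by linarith [ht.2]⟩
  have m2 : r / 2 ∈ Ioc (0 : ℝ) 1 := ⟨by positivity, by linarith [m1.2]⟩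
  have m3 : t - r ∈ Ioc (0 : ℝ) 1 := ⟨by linarith, by linarith [ht.2]⟩
  obtain ⟨N, -, hN⟩ := hF.weightedBound hα hη hN₁ m1
  obtain ⟨N', hN'0, hN'⟩ := hF.weightedBound hα hη hN₁ m2
  obtain ⟨N'', -, -, hN''⟩ := h.weightedBound_kernelInt ha0 hη' hN'0 hN' m2
  -- Writing Q_{t-r/2} = Q_{t-r} Q_{r/2} exhibits the difference as Q_{t-r} applied to the coherence
  -- defect between the times r and r/2.
  have e1 : kernelInt Q (t - r / 2) (F (r / 2)) x =
      kernelInt Q (t - r) (kernelInt Q (r / 2) (F (r / 2))) x := by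
    rw [h.kernelInt_kernelInt ha0 hη' hN'0 hN' m3 m2]
    congr 1; ring
  have e2 : kernelInt Q (t - r) (F r) x - kernelInt Q (t - r / 2) (F (r / 2)) x =
      kernelInt Q (t - r) (fun y => F r y - kernelInt Q (r / 2) (F (r / 2)) y) x := by
    rw [e1]
    have i1 := h.integrable_kernel_mul ha0 hη' hN m3 x
    have i2 := h.integrable_kernel_mul le_rfl h.scaling_pos hN'' m3 x
    simp only [kernelInt] at i2 ⊢
    rw [← integral_sub i1 i2]
    simp only [mul_sub]
  rw [e2]
  refine hC _ (by positivity) _ ⟨hN.aestronglyMeasurable.sub hN''.aestronglyMeasurable, ?_⟩ _ m3 x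
  filter_upwards [ae_ne_zero] with y hy
  have e3 := hF.coherence r m1 (r / 2) ⟨by linarith, le_rfl⟩ y hy
  rwa [sub_half] at e3

theorem abs_sub_limit_le {u : ℕ → ℝ} {L w K ρ : ℝ} (hw : 0 < w) (hρ : ρ < 1)
    {n₀ : ℕ} (hu : ∀ n, n₀ ≤ n → |u n - u (n + 1)| * w ≤ K * ρ ^ n)
    (hL : Tendsto u atTop (𝓝 L)) {n : ℕ} (hn : n₀ ≤ n) :
    |u n - L| * w ≤ K * ρ ^ n / (1 - ρ) := by
  have e1 := dist_le_of_le_geometric_of_tendsto₀ (f := fun k => u (n + k)) (a := L) ρ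
    (K * ρ ^ n / w) hρ (fun k => by
      rw [Real.dist_eq, div_mul_eq_mul_div, le_div_iff₀ hw, mul_assoc, ← pow_add]
      exact hu (n + k) (by omega))
    (by simpa only [add_comm] using (tendsto_add_atTop_iff_nat n).2 hL)
  rw [add_zero, Real.dist_eq] at e1
  calc |u n - L| * w ≤ K * ρ ^ n / w / (1 - ρ) * w := mul_le_mul_of_nonneg_right e1 hw.le
    _ = _ := by field_simp

/-- The sewing theorem: a coherent germ is approximated by a semigroup family, with bounds
that are linear in the germ. -/
theorem exists_reconstruction (h : WeightedSemigroup s ℓ G Q W Ws) {ζ : ℝ} (J : Finset ι)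
    (α : ι → ℝ) (hγ : 0 < γ) (hα : ∀ j ∈ J, α j < γ) (hη : η ≤ γ) (hη' : γ - η < s 0)
    (hζη : ζ ≤ η) (hζα : ∀ j ∈ J, ζ ≤ α j) :
    ∃ C : ℝ, 0 < C ∧ ∀ (N₁ N₂ : ℝ), 0 ≤ N₁ → 0 ≤ N₂ → ∀ F : ℝ → (Fin d → ℝ) → ℝ,
      IsGerm s ℓ Q W J α γ η N₁ N₂ F → ∃ Λ : QFamily d, IsSemigroupFamily Q W Λ ∧
        (∀ t x, |Λ t x| * W x ≤ C * (N₁ + N₂) * (t : ℝ) ^ (ζ / ℓ)) ∧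
        ∀ (t : Ioc (0 : ℝ) 1) (x : Fin d → ℝ), x 0 ≠ 0 → |Λ t x - F t x| * W x ≤
          C * N₂ * (t : ℝ) ^ (γ / ℓ) * temporalWeight s x ^ (-(γ - η)) := by
  have hℓ := h.order_pos
  have ha0 : 0 ≤ γ - η := sub_nonneg.2 hη
  obtain ⟨C₁, hC₁, hC⟩ := h.abs_kernelInt_le ha0 hη'
  -- Stated for every index, with constant 0 outside J, so that the constants can be chosen as a
  -- function on the whole index type.
  have hmom : ∀ j : ι, ∃ C : ℝ, 0 ≤ C ∧ (j ∈ J → ∀ t ∈ Ioc (0 : ℝ) 1, ∀ x,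
      kernelMoment s Q Ws 0 (-(min (η - α j) 0)) t x ≤ C * t ^ (min (η - α j) 0 / ℓ)) := by
    intro j
    by_cases hj : j ∈ J
    · obtain ⟨C, hC0, hC⟩ := h.kernelMoment_le_time (p := 0) (a := -(min (η - α j) 0)) le_rfl
        (neg_nonneg.2 (min_le_right _ _)) (by
          rcases le_total (η - α j) 0 with h' | h'
          · rw [min_eq_left h']; linarith [hα j hj]
          · rw [min_eq_right h', neg_zero]; exact h.scaling_pos)
      refine ⟨C, hC0.le, fun _ t ht x => ?_⟩
      have := (hC t ht x).2
      rwa [zero_sub, neg_neg] at this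
    · exact ⟨0, le_rfl, fun hj' => absurd hj' hj⟩
  choose M hM0 hM using hmom
  -- Ratio of the telescoping series; it is below 1 exactly because γ > 0.
  set ρ : ℝ := (1 / 2 : ℝ) ^ (γ / ℓ) with hρdef
  have hρ0 : 0 < ρ := by positivity
  have hρ1 : ρ < 1 := Real.rpow_lt_one (by norm_num) (by norm_num) (by positivity)
  have hρ1' : 0 < 1 - ρ := sub_pos.2 hρ1
  have hpow : ∀ n : ℕ, ((1 / 2 : ℝ) ^ n) ^ (γ / ℓ) = ρ ^ n := fun n => by
    rw [hρdef, ← Real.rpow_natCast, ← Real.rpow_natCast, ← Real.rpow_mul (by norm_num),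
      ← Real.rpow_mul (by norm_num), mul_comm]
  -- `A₁` bounds the first approximation, `A₂` the telescoping tail in the Besov norm, `A₃` the tail
  -- in the local norm plus one coherence defect.
  set A₁ : ℝ := ∑ j ∈ J, 4 ^ |α j / ℓ| * M j * 4 ^ |min (η - α j) 0 / ℓ| with hA₁
  have hA₁0 : 0 ≤ A₁ := Finset.sum_nonneg fun j _ => by have := hM0 j; positivity
  set A₂ : ℝ := C₁ * 4 ^ |-(γ - η) / ℓ| / (1 - ρ) * 4 ^ |γ / ℓ| with hA₂
  set A₃ : ℝ := C₁ / (1 - ρ) * 4 ^ |γ / ℓ| + 1 with hA₃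
  have hA₂0 : 0 ≤ A₂ := by positivity
  have hA₃0 : 0 < A₃ := by positivity
  refine ⟨A₁ + A₂ + A₃, by positivity, fun N₁ N₂ hN₁ hN₂ F hF => ?_⟩
  -- The approximations Q_{t-2^{-n}} F_{2^{-n}}, controlled only once 2^{-n} ≤ t/2, that is for n at
  -- least an index `n₀` depending on t.
  set A : ℕ → Ioc (0 : ℝ) 1 → (Fin d → ℝ) → ℝ :=
    fun n t x => kernelInt Q ((t : ℝ) - (1 / 2) ^ n) (F ((1 / 2) ^ n)) x with hA
  set K : Ioc (0 : ℝ) 1 → ℝ := fun t => C₁ * N₂ * (4 ^ |-(γ - η) / ℓ| * (t : ℝ) ^ (-(γ - η) / ℓ))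
    with hK
  have hK0 : ∀ t, 0 ≤ K t := fun t => by have := t.2.1; positivity
  have hhalf0 : ∀ n : ℕ, (0 : ℝ) < (1 / 2) ^ n := fun n => by positivity
  have hanti : ∀ {t : Ioc (0 : ℝ) 1} {n₀ n : ℕ}, (1 / 2 : ℝ) ^ n₀ ≤ t / 2 → n₀ ≤ n →
      (1 / 2 : ℝ) ^ n ≤ t / 2 := fun h1 h2 =>
    (pow_le_pow_of_le_one (by norm_num) (by norm_num) h2).trans h1
  have hstep : ∀ (t : Ioc (0 : ℝ) 1) (n : ℕ), (1 / 2 : ℝ) ^ n ≤ t / 2 → ∀ x,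
      |A n t x - A (n + 1) t x| * W x ≤ K t * ρ ^ n ∧ (x 0 ≠ 0 →
        |A n t x - A (n + 1) t x| * W x ≤
          C₁ * N₂ * temporalWeight s x ^ (-(γ - η)) * ρ ^ n) := by
    intro t n hn x
    have ht0 : 0 < (t : ℝ) := t.2.1
    obtain ⟨e1, e2⟩ := hF.abs_approx_sub_le h hα hη hη' hN₁ hN₂ hC t.2 (hhalf0 n) hn x
    have e3 : (1 / 2 : ℝ) ^ (n + 1) = (1 / 2) ^ n / 2 := by rw [pow_succ]; ring
    simp only [hA, e3]
    rw [hpow] at e1 e2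
    refine ⟨e1.trans ?_, fun hx => (e2 hx).trans (le_of_eq (by ring))⟩
    have e4 : ((t : ℝ) - (1 / 2) ^ n) ^ (-(γ - η) / ℓ) ≤
        4 ^ |-(γ - η) / ℓ| * (t : ℝ) ^ (-(γ - η) / ℓ) :=
      rpow_le_four_rpow_mul ht0 ⟨by linarith, by linarith [hhalf0 n]⟩
    calc C₁ * (N₂ * ρ ^ n) * ((t : ℝ) - (1 / 2) ^ n) ^ (-(γ - η) / ℓ)
        ≤ C₁ * (N₂ * ρ ^ n) * (4 ^ |-(γ - η) / ℓ| * (t : ℝ) ^ (-(γ - η) / ℓ)) := by gcongr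
      _ = _ := by simp only [hK]; ring
  choose n₀ hn₀ using fun t : Ioc (0 : ℝ) 1 => exists_half_pow_mem t.2
  have hlim : ∀ t x, ∃ L, Tendsto (fun n => A n t x) atTop (𝓝 L) := by
    intro t x
    have hWx := h.weight.pos x
    have hc : CauchySeq fun k => A (k + n₀ t) t x := by
      refine cauchySeq_of_le_geometric ρ (K t * ρ ^ n₀ t / W x) hρ1 fun k => ?_
      rw [Real.dist_eq, div_mul_eq_mul_div, le_div_iff₀ hWx, mul_assoc, ← pow_add, add_comm (n₀ t),
        add_right_comm]
      exact (hstep t _ (hanti (hn₀ t).2 (Nat.le_add_left _ _)) x).1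
    obtain ⟨L, hL⟩ := cauchySeq_tendsto_of_complete hc
    exact ⟨L, (tendsto_add_atTop_iff_nat (n₀ t)).1 hL⟩
  choose Λ hΛ using hlim
  have hbound : ∀ t n, n₀ t ≤ n → ∀ x, |A n t x - Λ t x| * W x ≤ K t * ρ ^ n / (1 - ρ) :=
    fun t n hn x => abs_sub_limit_le (h.weight.pos x) hρ1
      (fun k hk => (hstep t k (hanti (hn₀ t).2 hk) x).1) (hΛ t x) hn
  have hbound' : ∀ t n, n₀ t ≤ n → ∀ x : Fin d → ℝ, x 0 ≠ 0 → |A n t x - Λ t x| * W x ≤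
      C₁ * N₂ * temporalWeight s x ^ (-(γ - η)) * ρ ^ n / (1 - ρ) :=
    fun t n hn x hx => abs_sub_limit_le (h.weight.pos x) hρ1
      (fun k hk => (hstep t k (hanti (hn₀ t).2 hk) x).2 hx) (hΛ t x) hn
  have hmem : ∀ (t : Ioc (0 : ℝ) 1) n, n₀ t ≤ n → (t : ℝ) - (1 / 2) ^ n ∈ Ioc (0 : ℝ) 1 :=
    fun t n hn => ⟨by linarith [hanti (hn₀ t).2 hn, t.2.1], by linarith [t.2.2, hhalf0 n]⟩
  have hmem' : ∀ n : ℕ, (1 / 2 : ℝ) ^ n ∈ Ioc (0 : ℝ) 1 := fun n =>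
    ⟨hhalf0 n, pow_le_one₀ (by norm_num) (by norm_num)⟩
  choose NF hNF0 hNF using fun n => hF.weightedBound hα hη hN₁ (hmem' n)
  have hε : ∀ t, Tendsto (fun n => K t * ρ ^ (n + n₀ t) / (1 - ρ)) atTop (𝓝 0) := fun t => by
    have := ((tendsto_add_atTop_iff_nat (n₀ t)).2
      (tendsto_pow_atTop_nhds_zero_of_lt_one hρ0.le hρ1)).const_mul (K t)
    simpa using this.div_const (1 - ρ)
  -- The size of the first approximation.
  have hsize : ∀ t x, |A (n₀ t) t x| * W x ≤ N₁ * A₁ * (t : ℝ) ^ (ζ / ℓ) := by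
    intro t x
    have ht0 : 0 < (t : ℝ) := t.2.1
    have hr := hn₀ t
    have hr' : (1 / 2 : ℝ) ^ n₀ t ∈ Icc ((t : ℝ) / 4) t := ⟨hr.1, by linarith [hr.2]⟩
    have hm := hmem t _ le_rfl
    have hm' : (t : ℝ) - (1 / 2) ^ n₀ t ∈ Icc ((t : ℝ) / 4) t :=
      ⟨by linarith [hr.2], by linarith [hhalf0 (n₀ t)]⟩
    have e1 := (h.abs_kernelInt_le_sum J (N := fun j => N₁ * ((1 / 2 : ℝ) ^ n₀ t) ^ (α j / ℓ))
      (p := fun _ => 0) (a := fun j => -(min (η - α j) 0)) (fun _ _ => le_rfl)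
      (fun j _ => neg_nonneg.2 (min_le_right _ _)) (fun j hj => by
        rcases le_total (η - α j) 0 with h' | h'
        · rw [min_eq_left h']; linarith [hα j hj]
        · rw [min_eq_right h', neg_zero]; exact h.scaling_pos)
      (hNF (n₀ t)).aestronglyMeasurable hm x (by
        filter_upwards [ae_ne_zero] with y hy
        have k1 := hF.size _ (hmem' (n₀ t)) y hy
        calc |F ((1 / 2) ^ n₀ t) y| * W x
            ≤ |F ((1 / 2) ^ n₀ t) y| * (Ws (x - y) * W y) :=
              mul_le_mul_of_nonneg_left (h.weight.le_star_mul x y) (abs_nonneg _)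
          _ = Ws (x - y) * (|F ((1 / 2) ^ n₀ t) y| * W y) := by ring
          _ ≤ _ := mul_le_mul_of_nonneg_left k1 (h.star_nonneg _)
          _ = _ := by
              rw [Finset.mul_sum, Finset.mul_sum]
              refine Finset.sum_congr rfl fun j _ => ?_
              rw [Real.rpow_zero, neg_neg]; ring)).2
    refine e1.trans ?_
    rw [hA₁, Finset.mul_sum, Finset.sum_mul]
    refine Finset.sum_le_sum fun j hj => ?_
    have k1 := hM j hj _ hm x
    have k2 : ((1 / 2 : ℝ) ^ n₀ t) ^ (α j / ℓ) ≤ 4 ^ |α j / ℓ| * (t : ℝ) ^ (α j / ℓ) :=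
      rpow_le_four_rpow_mul ht0 hr'
    have k3 : ((t : ℝ) - (1 / 2) ^ n₀ t) ^ (min (η - α j) 0 / ℓ) ≤
        4 ^ |min (η - α j) 0 / ℓ| * (t : ℝ) ^ (min (η - α j) 0 / ℓ) :=
      rpow_le_four_rpow_mul ht0 hm'
    -- The exponents add up to min(η, α_j) ≥ ζ, and t ≤ 1.
    have k4 : (t : ℝ) ^ (α j / ℓ) * (t : ℝ) ^ (min (η - α j) 0 / ℓ) ≤ (t : ℝ) ^ (ζ / ℓ) := by
      rw [← Real.rpow_add ht0, ← add_div]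
      refine Real.rpow_le_rpow_of_exponent_ge ht0 t.2.2 (div_le_div_of_nonneg_right ?_ hℓ.le)
      rcases le_total (η - α j) 0 with h' | h'
      · rw [min_eq_left h']; linarith
      · rw [min_eq_right h']; linarith [hζα j hj]
    have hMj := hM0 j
    have hmom0 := h.kernelMoment_nonneg 0 (-(min (η - α j) 0)) ((t : ℝ) - (1 / 2) ^ n₀ t) x
    calc _ ≤ N₁ * (4 ^ |α j / ℓ| * (t : ℝ) ^ (α j / ℓ)) *
          (M j * (4 ^ |min (η - α j) 0 / ℓ| * (t : ℝ) ^ (min (η - α j) 0 / ℓ))) := by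
          refine mul_le_mul (mul_le_mul_of_nonneg_left k2 hN₁)
            (k1.trans (mul_le_mul_of_nonneg_left k3 hMj)) hmom0 (by positivity)
      _ = N₁ * (4 ^ |α j / ℓ| * M j * 4 ^ |min (η - α j) 0 / ℓ|) *
          ((t : ℝ) ^ (α j / ℓ) * (t : ℝ) ^ (min (η - α j) 0 / ℓ)) := by ring
      _ ≤ _ := mul_le_mul_of_nonneg_left k4 (by positivity)
  have htri : ∀ (a b : ℝ) (x : Fin d → ℝ), |b| * W x ≤ |a| * W x + |a - b| * W x := by
    intro a b x
    have := abs_sub a (a - b)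
    rw [sub_sub_cancel] at this
    rw [← add_mul]
    exact mul_le_mul_of_nonneg_right this (h.weight.pos x).le
  have hρt : ∀ t, ρ ^ n₀ t ≤ 4 ^ |γ / ℓ| * (t : ℝ) ^ (γ / ℓ) := fun t => by
    rw [← hpow]
    exact rpow_le_four_rpow_mul t.2.1 ⟨(hn₀ t).1, by linarith [(hn₀ t).2, t.2.1]⟩
  have hbesov : ∀ t x, |Λ t x| * W x ≤ (A₁ * N₁ + A₂ * N₂) * (t : ℝ) ^ (ζ / ℓ) := by
    intro t x
    have ht0 : 0 < (t : ℝ) := t.2.1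
    have e1 := htri (A (n₀ t) t x) (Λ t x) x
    have e2 := hbound t _ le_rfl x
    have e3 := hsize t x
    -- The loss -(γ - η) and the gain γ leave η ≥ ζ.
    have e4 : (t : ℝ) ^ (-(γ - η) / ℓ) * (t : ℝ) ^ (γ / ℓ) ≤ (t : ℝ) ^ (ζ / ℓ) := by
      rw [← Real.rpow_add ht0, ← add_div]
      refine Real.rpow_le_rpow_of_exponent_ge ht0 t.2.2 (div_le_div_of_nonneg_right ?_ hℓ.le)
      linarith
    have e5 : K t * ρ ^ n₀ t / (1 - ρ) ≤ A₂ * N₂ * (t : ℝ) ^ (ζ / ℓ) := by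
      calc K t * ρ ^ n₀ t / (1 - ρ)
          ≤ K t * (4 ^ |γ / ℓ| * (t : ℝ) ^ (γ / ℓ)) / (1 - ρ) := by
            have := hK0 t
            gcongr
            exact hρt t
        _ = A₂ * N₂ * ((t : ℝ) ^ (-(γ - η) / ℓ) * (t : ℝ) ^ (γ / ℓ)) := by
            simp only [hK, hA₂]; ring
        _ ≤ _ := by gcongr
    linarith
  refine ⟨Λ, ⟨fun t => ?_, fun t => ?_, fun r t hrt x => ?_⟩, fun t x => ?_, fun t x hx => ?_⟩
  · exact continuous_of_weighted_limit h.weight.continuous_weight h.weight.pos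
      (g := fun n => A (n + n₀ t) t)
      (fun n => h.continuous_kernelInt ha0 hη' (hNF0 _) (hNF _)
        (hmem t _ (Nat.le_add_left _ _))) (hε t)
      fun n x => hbound t _ (Nat.le_add_left _ _) x
  · have ht0 : 0 < (t : ℝ) := t.2.1
    exact ⟨(A₁ * N₁ + A₂ * N₂) * (t : ℝ) ^ (ζ / ℓ), by positivity, hbesov t⟩
  · have hm := IsSemigroupFamily.sub_time_mem hrt
    choose N' hN'0 _ hN' using fun n => h.weightedBound_kernelInt ha0 hη' (hNF0 _)
      (hNF (n + n₀ r)) (hmem r (n + n₀ r) (Nat.le_add_left _ _))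
    have e1 := h.tendsto_kernelInt le_rfl h.scaling_pos hN' (hε r)
      (fun n x => hbound r _ (Nat.le_add_left _ _) x) hm x
    -- Q_{t-r} maps the approximation at time r exactly to the one at time t with the same dyadic
    -- index, so the semigroup identity survives in the limit.
    have e2 : ∀ n, kernelInt Q ((t : ℝ) - r)
        (kernelInt Q ((r : ℝ) - (1 / 2) ^ (n + n₀ r)) (F ((1 / 2) ^ (n + n₀ r)))) x =
        A (n + n₀ r) t x := fun n => by
      rw [h.kernelInt_kernelInt ha0 hη' (hNF0 _) (hNF _) hm
        (hmem r (n + n₀ r) (Nat.le_add_left _ _)) x, sub_add_sub_cancel]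
    simp only [e2] at e1
    exact tendsto_nhds_unique e1 ((tendsto_add_atTop_iff_nat (n₀ r)).2 (hΛ t x))
  · have ht0 : 0 < (t : ℝ) := t.2.1
    refine (hbesov t x).trans (mul_le_mul_of_nonneg_right ?_ (by positivity))
    nlinarith [mul_nonneg hA₂0 hN₁, mul_nonneg hA₁0 hN₂, mul_nonneg hA₃0.le hN₁,
      mul_nonneg hA₃0.le hN₂]
  · have ht0 : 0 < (t : ℝ) := t.2.1
    have hφ := temporalWeight_pos s hx
    have e1 := hbound' t _ le_rfl x hx
    -- One more defect, from time t to the nondyadic gap: it compares F_t with the first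
    -- approximation.
    have e2 := hF.coherence t t.2 _ (hn₀ t) x hx
    have e3 : |Λ t x - F t x| * W x ≤ |A (n₀ t) t x - Λ t x| * W x +
        |F t x - A (n₀ t) t x| * W x := by
      rw [← add_mul]
      refine mul_le_mul_of_nonneg_right ?_ (h.weight.pos x).le
      rw [abs_sub_comm (A (n₀ t) t x), abs_sub_comm (F t x)]
      exact abs_sub_le _ _ _
    have e4 : C₁ * N₂ * temporalWeight s x ^ (-(γ - η)) * ρ ^ n₀ t / (1 - ρ) ≤
        C₁ / (1 - ρ) * 4 ^ |γ / ℓ| * N₂ * (t : ℝ) ^ (γ / ℓ) *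
          temporalWeight s x ^ (-(γ - η)) := by
      calc _ ≤ C₁ * N₂ * temporalWeight s x ^ (-(γ - η)) *
            (4 ^ |γ / ℓ| * (t : ℝ) ^ (γ / ℓ)) / (1 - ρ) := by
            gcongr
            exact hρt t
        _ = _ := by ring
    have e5 : |Λ t x - F t x| * W x ≤
        A₃ * N₂ * (t : ℝ) ^ (γ / ℓ) * temporalWeight s x ^ (-(γ - η)) := by
      refine e3.trans ((add_le_add (e1.trans e4) e2).trans (le_of_eq ?_))
      simp only [hA₃]; ring
    refine e5.trans ?_
    gcongr
    linarith

end IsGerm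

end Sewing

/-! ### Local families and their germs -/

section LocalFamilies

variable {d : ℕ} [NeZero d] {s : Fin d → ℝ} {ℓ : ℝ} {G : (Fin d → ℝ) → ℝ}
  {Q : ℝ → (Fin d → ℝ) → (Fin d → ℝ) → ℝ} {w ws v vs W₁ W₁s : (Fin d → ℝ) → ℝ}
  {ι : Type*} {J : Finset ι} {α : ι → ℝ} {γ η N₁ N₂ : ℝ}

/-- Distributions `H_x` indexed by the points off the plane, with bounds on `Q_t(x, H_x)` and on
`Q_t(z, H_z - H_y)`. -/
structure IsLocalFamily (s : Fin d → ℝ) (ℓ : ℝ) (Q : ℝ → (Fin d → ℝ) → (Fin d → ℝ) → ℝ)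
    (w v vs W₁ : (Fin d → ℝ) → ℝ) (J : Finset ι) (α : ι → ℝ) (γ η N₁ N₂ : ℝ)
    (H : OffPlane d → QFamily d) : Prop where
  family : ∀ y, IsSemigroupFamily Q W₁ (H y)
  size : ∀ (t : Ioc (0 : ℝ) 1) (y : OffPlane d), |H y t y| * (w y * v y) ≤
    N₁ * ∑ j ∈ J, (t : ℝ) ^ (α j / ℓ) * temporalWeight s y ^ (min (η - α j) 0)
  increment : ∀ (t : Ioc (0 : ℝ) 1) (y z : OffPlane d), y ≠ z →
    |H z t z - H y t z| * (w z * v y) ≤ N₂ * ∑ j ∈ J, (t : ℝ) ^ (α j / ℓ) *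
      (min (temporalWeight s y) (temporalWeight s z) ^ (η - γ) * vs (y.1 - z.1) *
        scaledNorm s (z.1 - y.1) ^ (γ - α j))

/-- The germ `(t, y) ↦ Q_t(y, H_y)`, extended by zero to the plane. -/
noncomputable def diagonalGerm (H : OffPlane d → QFamily d) (t : ℝ) (y : Fin d → ℝ) : ℝ :=
  if h : t ∈ Ioc (0 : ℝ) 1 ∧ y 0 ≠ 0 then H ⟨y, h.2⟩ ⟨t, h.1⟩ y else 0

theorem diagonalGerm_apply (H : OffPlane d → QFamily d) {t : ℝ} (ht : t ∈ Ioc (0 : ℝ) 1)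
    {y : Fin d → ℝ} (hy : y 0 ≠ 0) : diagonalGerm H t y = H ⟨y, hy⟩ ⟨t, ht⟩ y :=
  dif_pos ⟨ht, hy⟩

theorem min_temporalWeight_rpow_le {y z : Fin d → ℝ} (hy : y 0 ≠ 0) (hz : z 0 ≠ 0) (a : ℝ) :
    min (temporalWeight s y) (temporalWeight s z) ^ a ≤
      temporalWeight s y ^ a + temporalWeight s z ^ a := by
  have h1 := Real.rpow_pos_of_pos (temporalWeight_pos s hy) a
  have h2 := Real.rpow_pos_of_pos (temporalWeight_pos s hz) a
  rcases le_total (temporalWeight s y) (temporalWeight s z) with h | h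
  · rw [min_eq_left h]; linarith
  · rw [min_eq_right h]; linarith

theorem isOpen_offPlane : IsOpen {y : Fin d → ℝ | y 0 ≠ 0} :=
  isOpen_ne_fun (continuous_apply 0) continuous_const

namespace IsLocalFamily

variable {H : OffPlane d → QFamily d}

/-- Near y the germ differs from the continuous function z ↦ Q_t(z, H_y) by the increment bound,
which vanishes as z → y because every γ - α_j is positive. Its purpose is measurability of the germ.
-/
theorem continuousOn_diagonalGerm (hs : ∀ i, 1 ≤ s i) (hw : GControlled s ℓ G w ws)
    (hv : GControlled s ℓ G v vs) (hα : ∀ j ∈ J, α j < γ)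
    (hH : IsLocalFamily s ℓ Q w v vs W₁ J α γ η N₁ N₂ H) {t : ℝ} (ht : t ∈ Ioc (0 : ℝ) 1) :
    ContinuousOn (diagonalGerm H t) {y | y 0 ≠ 0} := by
  intro y hy
  rw [mem_ofPred_eq] at hy
  have hφ := temporalWeight_pos s hy
  refine ContinuousAt.continuousWithinAt ?_
  set t' : Ioc (0 : ℝ) 1 := ⟨t, ht⟩ with ht'
  set y' : OffPlane d := ⟨y, hy⟩ with hy'
  set B : (Fin d → ℝ) → ℝ := fun z => N₂ * (∑ j ∈ J, t ^ (α j / ℓ) *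
      (min (temporalWeight s y) (temporalWeight s z) ^ (η - γ) * vs (y - z) *
        scaledNorm s (z - y) ^ (γ - α j))) / (w z * v y) with hB
  have hBc : ContinuousAt B y := by
    refine ContinuousAt.div (continuousAt_const.mul ?_) ?_ (mul_pos (hw.pos y) (hv.pos y)).ne'
    · refine tendsto_finsetSum _ fun j hj => ?_
      refine ContinuousAt.mul continuousAt_const (ContinuousAt.mul (ContinuousAt.mul ?_ ?_) ?_)
      · refine ContinuousAt.rpow_const ?_ (Or.inl ?_)
        · exact (continuous_const.min (continuous_temporalWeight hs)).continuousAt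
        · rw [min_self]; exact hφ.ne'
      · exact (hv.continuous_star.comp (continuous_const.sub continuous_id)).continuousAt
      · refine Continuous.continuousAt (Continuous.rpow_const ?_ fun _ => Or.inr ?_)
        · exact (continuous_scaledNorm hs).comp (continuous_id.sub continuous_const)
        · linarith [hα j hj]
    · exact hw.continuous_weight.continuousAt.mul continuousAt_const
  have hBy : B y = 0 := by
    simp only [hB]
    rw [Finset.sum_eq_zero, mul_zero, zero_div]
    intro j hj
    rw [sub_self, scaledNorm_zero hs, Real.zero_rpow (by linarith [hα j hj]), mul_zero, mul_zero]
  have hle : ∀ᶠ z in 𝓝 y, |diagonalGerm H t z - H y' t' z| ≤ B z := by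
    filter_upwards [isOpen_offPlane.mem_nhds hy] with z hz
    rcases eq_or_ne y z with rfl | hne
    · rw [hBy, diagonalGerm_apply H ht hy, sub_self, abs_zero]
    · rw [diagonalGerm_apply H ht hz, hB, le_div_iff₀ (mul_pos (hw.pos z) (hv.pos y))]
      exact hH.increment t' y' ⟨z, hz⟩ (fun h => hne (congrArg Subtype.val h))
  have h0 : Tendsto (fun z => diagonalGerm H t z - H y' t' z) (𝓝 y) (𝓝 0) := by
    rw [ContinuousAt, hBy] at hBc
    exact squeeze_zero_norm' hle hBc
  have h1 := h0.add (((hH.family y').continuous t').tendsto y)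
  simp only [sub_add_cancel, zero_add] at h1
  rw [ContinuousAt, diagonalGerm_apply H ht hy]
  exact h1

theorem aestronglyMeasurable_diagonalGerm (hs : ∀ i, 1 ≤ s i) (hw : GControlled s ℓ G w ws)
    (hv : GControlled s ℓ G v vs) (hα : ∀ j ∈ J, α j < γ)
    (hH : IsLocalFamily s ℓ Q w v vs W₁ J α γ η N₁ N₂ H) {t : ℝ} (ht : t ∈ Ioc (0 : ℝ) 1) :
    AEStronglyMeasurable (diagonalGerm H t) volume := by
  have h1 := (hH.continuousOn_diagonalGerm hs hw hv hα ht).aestronglyMeasurable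
    (μ := volume) isOpen_offPlane.measurableSet
  have h2 : (volume : Measure (Fin d → ℝ)).restrict {y | y 0 ≠ 0} = volume :=
    Measure.restrict_eq_self_of_ae_mem (s := {y : Fin d → ℝ | y 0 ≠ 0}) ae_ne_zero
  rwa [h2] at h1

/-- The diagonal germ of a local family is coherent. -/
theorem exists_isGerm (h : WeightedSemigroup s ℓ G Q (w * v) (ws * vs))
    (hw : GControlled s ℓ G w ws) (hv : GControlled s ℓ G v vs)
    (h₁ : WeightedSemigroup s ℓ G Q W₁ W₁s) (J : Finset ι) (α : ι → ℝ)
    (hα : ∀ j ∈ J, α j < γ) (hη : η ≤ γ) (hη' : γ - η < s 0) :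
    ∃ C : ℝ, 0 < C ∧ ∀ (N₁ N₂ : ℝ), 0 ≤ N₁ → 0 ≤ N₂ → ∀ H : OffPlane d → QFamily d,
      IsLocalFamily s ℓ Q w v vs W₁ J α γ η N₁ N₂ H →
        IsGerm s ℓ Q (w * v) J α γ η N₁ (C * N₂) (diagonalGerm H) := by
  have ha0 : 0 ≤ γ - η := sub_nonneg.2 hη
  have hs := h.one_le_scaling
  -- The increment is singular at the base point or at the integration point: in the first case the
  -- singular factor comes out of the integral, in the second it belongs to the moment.
  have hmom : ∀ j : ι, ∃ C : ℝ, 0 ≤ C ∧ (j ∈ J → ∀ t ∈ Ioc (0 : ℝ) 1, ∀ x : Fin d → ℝ, x 0 ≠ 0 →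
      temporalWeight s x ^ (-(γ - η)) * kernelMoment s Q (ws * vs) (γ - α j) 0 t x +
        kernelMoment s Q (ws * vs) (γ - α j) (γ - η) t x ≤
      C * t ^ ((γ - α j) / ℓ) * temporalWeight s x ^ (-(γ - η))) := by
    intro j
    by_cases hj : j ∈ J
    · have hp : 0 ≤ γ - α j := by linarith [hα j hj]
      obtain ⟨C, hC0, hC⟩ := h.kernelMoment_le_time hp le_rfl h.scaling_pos
      obtain ⟨C', hC'0, hC'⟩ := h.kernelMoment_le hp ha0 hη'
      refine ⟨C + C', by positivity, fun _ t ht x hx => ?_⟩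
      have e1 := (hC t ht x).2
      have e2 := (hC' t ht x).2.2 hx
      rw [sub_zero] at e1
      have hφ := temporalWeight_pos s hx
      have e3 := mul_le_mul_of_nonneg_left e1 (Real.rpow_nonneg hφ.le (-(γ - η)))
      refine (add_le_add e3 e2).trans (le_of_eq (by ring))
    · exact ⟨0, le_rfl, fun hj' => absurd hj' hj⟩
  choose M hM0 hM using hmom
  refine ⟨∑ j ∈ J, 4 ^ |α j / ℓ| * (M j * 4 ^ |(γ - α j) / ℓ|) + 1, ?_,
    fun N₁ N₂ hN₁ hN₂ H hH => ?_⟩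
  · have : 0 ≤ ∑ j ∈ J, 4 ^ |α j / ℓ| * (M j * 4 ^ |(γ - α j) / ℓ|) :=
      Finset.sum_nonneg fun j _ => by have := hM0 j; positivity
    linarith
  have hmeas := fun t (ht : t ∈ Ioc (0 : ℝ) 1) =>
    hH.aestronglyMeasurable_diagonalGerm hs hw hv hα ht
  have hsize : ∀ t ∈ Ioc (0 : ℝ) 1, ∀ y : Fin d → ℝ, y 0 ≠ 0 →
      |diagonalGerm H t y| * (w * v) y ≤
        N₁ * ∑ j ∈ J, t ^ (α j / ℓ) * temporalWeight s y ^ (min (η - α j) 0) := by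
    intro t ht y hy
    rw [diagonalGerm_apply H ht hy]
    exact hH.size ⟨t, ht⟩ ⟨y, hy⟩
  -- Integrability of the germ only needs its size.
  have hbd : ∀ t ∈ Ioc (0 : ℝ) 1, ∃ N : ℝ, WeightedBound s (w * v) (γ - η) N
      (diagonalGerm H t) := by
    intro t ht
    have ht0 : 0 < t := ht.1
    refine ⟨N₁ * ∑ j ∈ J, t ^ (α j / ℓ), hmeas t ht, ?_⟩
    filter_upwards [ae_ne_zero] with y hy
    have hφ := temporalWeight_pos s hy
    refine (hsize t ht y hy).trans ?_
    rw [mul_assoc, Finset.sum_mul]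
    refine mul_le_mul_of_nonneg_left (Finset.sum_le_sum fun j hj => ?_) hN₁
    refine mul_le_mul_of_nonneg_left ?_ (by positivity)
    refine Real.rpow_le_rpow_of_exponent_ge hφ (temporalWeight_le_one s y) ?_
    rcases le_total (η - α j) 0 with h | h
    · rw [min_eq_left h]; linarith [hα j hj]
    · rw [min_eq_right h]; linarith
  refine ⟨hmeas, hsize, fun t ht r hr y hy => ?_⟩
  have ht0 : 0 < t := ht.1
  have hr0 : 0 < r := (by positivity : 0 < t / 4).trans_le hr.1
  have hr1 : r ∈ Ioc (0 : ℝ) 1 := ⟨hr0, by linarith [hr.2, ht.2]⟩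
  have hm : t - r ∈ Ioc (0 : ℝ) 1 := ⟨by linarith [hr.2], by linarith [ht.2]⟩
  have hφ := temporalWeight_pos s hy
  set y' : OffPlane d := ⟨y, hy⟩ with hy'
  set r' : Ioc (0 : ℝ) 1 := ⟨r, hr1⟩ with hr'
  set t' : Ioc (0 : ℝ) 1 := ⟨t, ht⟩ with ht'
  obtain ⟨N, hN⟩ := hbd r hr1
  obtain ⟨N', -, hN'⟩ := (hH.family y').weightedBound (s := s) r'
  have i1 := h.integrable_kernel_mul ha0 hη' hN hm y
  have i2 := h₁.integrable_kernel_mul le_rfl h.scaling_pos hN' hm y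
  have hrt : (r' : ℝ) < t' := by simp only [hr', ht']; linarith [hr.2]
  -- Since H_y alone obeys the semigroup identity, the defect is Q_{t-r} applied to z ↦ Q_r(z, H_y -
  -- H_z). The two parts are integrable for different weights: `W₁` for H_y, `w * v` for the germ.
  have e1 : diagonalGerm H t y - kernelInt Q (t - r) (diagonalGerm H r) y =
      kernelInt Q (t - r) (fun z => H y' r' z - diagonalGerm H r z) y := by
    rw [diagonalGerm_apply H ht hy, ← (hH.family y').kernelInt_eq r' t' hrt y]
    simp only [kernelInt]
    rw [← integral_sub i2 i1]
    simp only [mul_sub]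
  rw [e1]
  -- The Boolean records where the singular factor sits: `true` at the base point y, as a constant,
  -- and `false` at the integration variable.
  have e2 := (h.abs_kernelInt_le_sum (J ×ˢ (Finset.univ : Finset Bool))
    (N := fun q => N₂ * r ^ (α q.1 / ℓ) *
      (if q.2 then temporalWeight s y ^ (-(γ - η)) else 1))
    (p := fun q => γ - α q.1) (a := fun q => if q.2 then 0 else γ - η)
    (fun q hq => by linarith [hα q.1 (Finset.mem_product.1 hq).1])
    (fun q _ => by split_ifs <;> linarith)
    (fun q _ => by split_ifs <;> linarith [h.scaling_pos])
    (hN'.aestronglyMeasurable.sub hN.aestronglyMeasurable) hm y ?_).2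
  · refine e2.trans ?_
    rw [Finset.sum_product]
    simp only [Fintype.sum_bool, if_true, Bool.false_eq_true, if_false, mul_one]
    have e3 : ∀ j ∈ J, N₂ * r ^ (α j / ℓ) * temporalWeight s y ^ (-(γ - η)) *
          kernelMoment s Q (ws * vs) (γ - α j) 0 (t - r) y +
        N₂ * r ^ (α j / ℓ) * kernelMoment s Q (ws * vs) (γ - α j) (γ - η) (t - r) y ≤
        4 ^ |α j / ℓ| * (M j * 4 ^ |(γ - α j) / ℓ|) * N₂ * t ^ (γ / ℓ) *
          temporalWeight s y ^ (-(γ - η)) := by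
      intro j hj
      have k1 := hM j hj _ hm y hy
      have k2 : r ^ (α j / ℓ) ≤ 4 ^ |α j / ℓ| * t ^ (α j / ℓ) :=
        rpow_le_four_rpow_mul ht0 ⟨hr.1, by linarith [hr.2]⟩
      have k3 : (t - r) ^ ((γ - α j) / ℓ) ≤ 4 ^ |(γ - α j) / ℓ| * t ^ ((γ - α j) / ℓ) :=
        rpow_le_four_rpow_mul ht0 ⟨by linarith [hr.2], by linarith⟩
      have k4 : t ^ (α j / ℓ) * t ^ ((γ - α j) / ℓ) = t ^ (γ / ℓ) := by
        rw [← Real.rpow_add ht0]; congr 1; ring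
      have hMj := hM0 j
      have hm0 := h.kernelMoment_nonneg (γ - α j) 0 (t - r) y
      have hm1 := h.kernelMoment_nonneg (γ - α j) (γ - η) (t - r) y
      calc _ = N₂ * r ^ (α j / ℓ) * (temporalWeight s y ^ (-(γ - η)) *
            kernelMoment s Q (ws * vs) (γ - α j) 0 (t - r) y +
              kernelMoment s Q (ws * vs) (γ - α j) (γ - η) (t - r) y) := by ring
        _ ≤ N₂ * (4 ^ |α j / ℓ| * t ^ (α j / ℓ)) * (M j *
            (4 ^ |(γ - α j) / ℓ| * t ^ ((γ - α j) / ℓ)) * temporalWeight s y ^ (-(γ - η))) := by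
            refine mul_le_mul (mul_le_mul_of_nonneg_left k2 hN₂) (k1.trans ?_) ?_ (by positivity)
            · gcongr
            · exact add_nonneg (mul_nonneg (Real.rpow_nonneg hφ.le _) hm0) hm1
        _ = _ := by rw [← k4]; ring
    refine (Finset.sum_le_sum e3).trans ?_
    rw [← Finset.sum_mul, ← Finset.sum_mul, ← Finset.sum_mul]
    gcongr
    linarith
  · filter_upwards [ae_ne_zero] with z hz
    rw [Finset.sum_product]
    simp only [Fintype.sum_bool, if_true, Bool.false_eq_true, if_false, mul_one, neg_zero,
      Real.rpow_zero]
    have hWs : 0 ≤ ws (y - z) * vs (y - z) := h.star_nonneg (y - z)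
    have hφz := temporalWeight_pos s hz
    rw [Pi.sub_apply]
    rcases eq_or_ne y z with rfl | hne
    · rw [diagonalGerm_apply H hr1 hy, sub_self, abs_zero, zero_mul]
      refine Finset.sum_nonneg fun j _ => ?_
      have k1 := h.star_nonneg (y - y)
      have k2 := Real.rpow_nonneg (scaledNorm_nonneg s (y - y)) (γ - α j)
      positivity
    · have k1 := hH.increment r' y' ⟨z, hz⟩ (fun h => hne (congrArg Subtype.val h))
      rw [diagonalGerm_apply H hr1 hz, abs_sub_comm]
      have hws : 0 ≤ ws (y - z) := zero_le_one.trans (hw.one_le_star _)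
      have hvs : 0 ≤ vs (y - z) := zero_le_one.trans (hv.one_le_star _)
      -- Only w has to be moved from z to y; v is already taken at y, its price vs(y - z) being part
      -- of the increment bound. Together they give the associated function of w v.
      calc |H ⟨z, hz⟩ r' z - H y' r' z| * (w * v) y
          ≤ |H ⟨z, hz⟩ r' z - H y' r' z| * (ws (y - z) * w z * v y) := by
            refine mul_le_mul_of_nonneg_left ?_ (abs_nonneg _)
            exact mul_le_mul_of_nonneg_right (hw.le_star_mul y z) (hv.pos y).le
        _ = ws (y - z) * (|H ⟨z, hz⟩ r' z - H y' r' z| * (w z * v y)) := by ring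
        _ ≤ _ := mul_le_mul_of_nonneg_left k1 hws
        _ ≤ _ := by
          rw [Finset.mul_sum, Finset.mul_sum]
          refine Finset.sum_le_sum fun j _ => ?_
          have k2 := min_temporalWeight_rpow_le (s := s) hy hz (η - γ)
          have k3 := Real.rpow_nonneg (scaledNorm_nonneg s (y - z)) (γ - α j)
          have k4 : -(γ - η) = η - γ := by ring
          have k5 : scaledNorm s (z - y) = scaledNorm s (y - z) := scaledNorm_sub_comm s z y
          simp only [k4, Pi.mul_apply, hy', hr', k5]
          calc ws (y - z) * (N₂ * (r ^ (α j / ℓ) *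
                (min (temporalWeight s y) (temporalWeight s z) ^ (η - γ) * vs (y - z) *
                  scaledNorm s (y - z) ^ (γ - α j))))
              ≤ ws (y - z) * (N₂ * (r ^ (α j / ℓ) *
                ((temporalWeight s y ^ (η - γ) + temporalWeight s z ^ (η - γ)) * vs (y - z) *
                  scaledNorm s (y - z) ^ (γ - α j)))) := by gcongr
            _ = _ := by ring

/-- Reconstruction of a local family. -/
theorem exists_reconstruction (h : WeightedSemigroup s ℓ G Q (w * v) (ws * vs))
    (hw : GControlled s ℓ G w ws) (hv : GControlled s ℓ G v vs)
    (h₁ : WeightedSemigroup s ℓ G Q W₁ W₁s) (J : Finset ι) (α : ι → ℝ) {ζ : ℝ} (hγ : 0 < γ)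
    (hα : ∀ j ∈ J, α j < γ) (hη : η ≤ γ) (hη' : γ - η < s 0)
    (hζη : ζ ≤ η) (hζα : ∀ j ∈ J, ζ ≤ α j) :
    ∃ C : ℝ, 0 < C ∧ ∀ (N₁ N₂ : ℝ), 0 ≤ N₁ → 0 ≤ N₂ → ∀ H : OffPlane d → QFamily d,
      IsLocalFamily s ℓ Q w v vs W₁ J α γ η N₁ N₂ H →
        ∃ Λ : QFamily d, IsSemigroupFamily Q (w * v) Λ ∧
          besovNorm ℓ ζ (w * v) Λ ≤ ENNReal.ofReal (C * (N₁ + N₂)) ∧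
          localNorm s ℓ γ η (w * v) (fun t x => Λ t x - H x t x) ≤ ENNReal.ofReal (C * N₂) := by
  obtain ⟨C₁, hC₁, hgerm⟩ := exists_isGerm h hw hv h₁ J α hα hη hη'
  obtain ⟨C₂, hC₂, hrec⟩ := IsGerm.exists_reconstruction h J α hγ hα hη hη' hζη hζα
  refine ⟨C₂ * (1 + C₁), by positivity, fun N₁ N₂ hN₁ hN₂ H hH => ?_⟩
  obtain ⟨Λ, hΛ, hb, hl⟩ := hrec N₁ (C₁ * N₂) hN₁ (by positivity) _ (hgerm N₁ N₂ hN₁ hN₂ H hH)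
  refine ⟨Λ, hΛ, ?_, ?_⟩
  · rw [besovNorm_le_ofReal_iff (by positivity)]
    intro t x
    have ht0 : 0 < (t : ℝ) := t.2.1
    refine (hb t x).trans (mul_le_mul_of_nonneg_right ?_ (by positivity))
    rw [mul_assoc]
    refine mul_le_mul_of_nonneg_left ?_ hC₂.le
    nlinarith [mul_nonneg hC₁.le hN₁]
  · rw [localNorm_le_ofReal_iff (by positivity)]
    intro t x
    have ht0 : 0 < (t : ℝ) := t.2.1
    have hφ := temporalWeight_pos s x.2
    have e1 := hl t x x.2
    rw [diagonalGerm_apply H t.2 x.2] at e1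
    refine e1.trans ?_
    gcongr ?_ * _ * _
    rw [mul_assoc]
    refine mul_le_mul_of_nonneg_left ?_ hC₂.le
    linarith

end IsLocalFamily

/-- Two semigroup families which are close to the same local family coincide. -/
theorem IsSemigroupFamily.eq_of_localNorm_lt_top
    {W Ws : (Fin d → ℝ) → ℝ} (h : WeightedSemigroup s ℓ G Q W Ws) (hγ : 0 < γ) (hη : η ≤ γ)
    (hη' : γ - η < s 0) {Λ Λ' : QFamily d} (hΛ : IsSemigroupFamily Q W Λ)
    (hΛ' : IsSemigroupFamily Q W Λ') {E : Ioc (0 : ℝ) 1 → OffPlane d → ℝ}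
    (hl : localNorm s ℓ γ η W (fun t x => Λ t x - E t x) < ⊤)
    (hl' : localNorm s ℓ γ η W (fun t x => Λ' t x - E t x) < ⊤) : Λ = Λ' := by
  have e1 := (localNorm_le_ofReal_iff ENNReal.toReal_nonneg).1 (ENNReal.ofReal_toReal hl.ne).ge
  have e2 := (localNorm_le_ofReal_iff ENNReal.toReal_nonneg).1 (ENNReal.ofReal_toReal hl'.ne).ge
  rw [← sub_eq_zero]
  refine (hΛ.sub h hΛ').eq_zero h hγ (sub_nonneg.2 hη) hη'
    (add_nonneg (ENNReal.toReal_nonneg (a := localNorm s ℓ γ η W fun t x => Λ t x - E t x))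
      (ENNReal.toReal_nonneg (a := localNorm s ℓ γ η W fun t x => Λ' t x - E t x)))
    fun t x hx => ?_
  have k1 := e1 t ⟨x, hx⟩
  have k2 := e2 t ⟨x, hx⟩
  have k3 : |(Λ - Λ') t x| * W x ≤
      (|Λ t x - E t ⟨x, hx⟩| + |Λ' t x - E t ⟨x, hx⟩|) * W x := by
    refine mul_le_mul_of_nonneg_right ?_ (h.weight.pos x).le
    have := abs_sub (Λ t x - E t ⟨x, hx⟩) (Λ' t x - E t ⟨x, hx⟩)
    rwa [sub_sub_sub_cancel_right] at this
  rw [add_mul] at k3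
  rw [add_mul, add_mul]
  exact k3.trans (add_le_add k1 k2)

end LocalFamilies

/-! ### Bounds for models and modelled distributions -/

namespace RegularityStructure

variable (S : RegularityStructure.{u})

theorem finite_lt (γ : ℝ) : {α : S.A | (α : ℝ) < γ}.Finite := by
  obtain ⟨b, hb⟩ := S.bddBelow_A
  refine ((S.locallyFinite_A b γ).preimage Subtype.val_injective.injOn).subset fun α hα => ?_
  exact ⟨α.2, hb α.2, le_of_lt hα⟩

/-- The finite set of homogeneities below `γ`. -/
noncomputable def below (γ : ℝ) : Finset S.A := (S.finite_lt γ).toFinset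

variable {S}

theorem mem_below {γ : ℝ} {α : S.A} : α ∈ S.below γ ↔ (α : ℝ) < γ := by
  simp [below]

theorem regularity_le (α : S.A) : S.regularity ≤ α := csInf_le S.bddBelow_A α.2

theorem incl_apply_self (α : S.A) (τ : S.T α) : (S.incl α τ) α = τ :=
  DirectSum.lof_apply ℝ α τ

theorem incl_apply_of_ne {α β : S.A} (h : β ≠ α) (τ : S.T α) : (S.incl α τ) β = 0 := by
  rw [incl, DirectSum.lof_eq_of]
  exact DirectSum.of_eq_of_ne α β τ h

theorem sum_incl {γ : ℝ} {σ : S.Space} (hσ : ∀ α : S.A, γ ≤ α → σ α = 0) :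
    ∑ α ∈ S.below γ, S.incl α (σ α) = σ := by
  refine DirectSum.ext fun β => ?_
  rw [DirectSum.sum_apply]
  by_cases hβ : (β : ℝ) < γ
  · rw [Finset.sum_eq_single β, incl_apply_self]
    · exact fun α _ hne => incl_apply_of_ne hne.symm _
    · exact fun h => absurd (mem_below.2 hβ) h
  · rw [hσ β (not_lt.1 hβ)]
    refine Finset.sum_eq_zero fun α hα => incl_apply_of_ne ?_ _
    rintro rfl
    exact hβ (mem_below.1 hα)

/-- Triangularity: g modifies an element of degree α only in lower degrees, so T_{<γ} is preserved.
-/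
theorem apply_eq_zero_of_mem_G {g : S.Space ≃ₗ[ℝ] S.Space} (hg : g ∈ S.G) {γ : ℝ} {σ : S.Space}
    (hσ : ∀ α : S.A, γ ≤ α → σ α = 0) {β : S.A} (hβ : γ ≤ β) : (g σ) β = 0 := by
  rw [← sum_incl hσ, map_sum, DirectSum.sum_apply]
  refine Finset.sum_eq_zero fun α hα => ?_
  have hlt : α < β := Subtype.coe_lt_coe.1 (lt_of_lt_of_le (mem_below.1 hα) hβ)
  have h1 := S.triangular_G g hg α (σ α) β hlt.le
  rw [DirectSum.sub_apply] at h1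
  rw [sub_eq_zero] at h1
  rw [h1]
  exact incl_apply_of_ne hlt.ne' _

end RegularityStructure

/-! ### Pointwise forms of the norms of models and modelled distributions. -/

section ModelBounds

open RegularityStructure

variable {d : ℕ} {S : RegularityStructure.{u}} {s : Fin d → ℝ} {ℓ : ℝ}
  {w ws v vs : (Fin d → ℝ) → ℝ} {γ η : ℝ}

theorem piNorm_le_ofReal_iff {N : ℝ} (hN : 0 ≤ N) {P : (Fin d → ℝ) → S.Space →ₗ[ℝ] QFamily d} :
    piNorm S ℓ w γ (fun x τ => P x τ) ≤ ENNReal.ofReal N ↔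
      ∀ (α : S.A), (α : ℝ) < γ → ∀ (t : Ioc (0 : ℝ) 1) x (τ : S.T α),
        |P x (S.incl α τ) t x| * w x ≤ N * (t : ℝ) ^ ((α : ℝ) / ℓ) * ‖τ‖ := by
  unfold piNorm
  simp only [iSup_le_iff, ENNReal.ofReal_le_ofReal_iff hN]
  refine forall_congr' fun α => forall_congr' fun hα => forall_congr' fun t =>
    forall_congr' fun x => forall_congr' fun τ => ?_
  by_cases hτ : τ = 0
  · subst hτ
    simp
  · have hτ' : 0 < ‖τ‖ := norm_pos_iff.2 hτ
    have e : (t : ℝ) ^ (-(α : ℝ) / ℓ) * w x * (|P x (S.incl α τ) t x| / ‖τ‖) =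
        (t : ℝ) ^ (-((α : ℝ) / ℓ)) * (|P x (S.incl α τ) t x| * w x) / ‖τ‖ := by
      rw [neg_div]; ring
    rw [e, div_le_iff₀ hτ', rpow_neg_mul_le_iff t.2.1]
    simp only [ne_eq, hτ, not_false_eq_true, true_imp_iff]
    rw [mul_right_comm]

/-- Extension of the bound on `Π` to elements of `T_{<γ}`. -/
theorem abs_apply_le_of_piNorm_le {N : ℝ} (hN : 0 ≤ N) (hw : ∀ x, 0 < w x)
    {P : (Fin d → ℝ) → S.Space →ₗ[ℝ] QFamily d}
    (hP : piNorm S ℓ w γ (fun x τ => P x τ) ≤ ENNReal.ofReal N) {σ : S.Space}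
    (hσ : ∀ α : S.A, γ ≤ α → σ α = 0) (t : Ioc (0 : ℝ) 1) (x : Fin d → ℝ) :
    |P x σ t x| * w x ≤ N * ∑ α ∈ S.below γ, (t : ℝ) ^ ((α : ℝ) / ℓ) * ‖σ α‖ := by
  rw [piNorm_le_ofReal_iff hN] at hP
  have e : P x σ t x = ∑ α ∈ S.below γ, P x (S.incl α (σ α)) t x := by
    conv_lhs => rw [← sum_incl hσ]
    rw [map_sum, Finset.sum_apply, Finset.sum_apply]
  rw [e, Finset.mul_sum]
  refine (mul_le_mul_of_nonneg_right (Finset.abs_sum_le_sum_abs _ _) (hw x).le).trans ?_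
  rw [Finset.sum_mul]
  refine Finset.sum_le_sum fun α hα => ?_
  rw [← mul_assoc]
  exact hP α (mem_below.1 hα) t x (σ α)

theorem scaledNorm_pos {x : Fin d → ℝ} (hx : x ≠ 0) : 0 < scaledNorm s x := by
  obtain ⟨i, hi⟩ := Function.ne_iff.1 hx
  exact (Real.rpow_pos_of_pos (abs_pos.2 hi) _).trans_le (abs_rpow_le_scaledNorm s x i)

variable [NeZero d]

theorem sizeNorm_le_ofReal_iff {N : ℝ} (hN : 0 ≤ N) {f : OffPlane d → S.Space} :
    sizeNorm S s v γ η f ≤ ENNReal.ofReal N ↔ ∀ (α : S.A), (α : ℝ) < γ → ∀ x : OffPlane d,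
      v x * ‖(f x) α‖ ≤ N * temporalWeight s x ^ (min (η - α) 0) := by
  unfold sizeNorm
  simp only [iSup_le_iff, ENNReal.ofReal_le_ofReal_iff hN]
  refine forall_congr' fun α => forall_congr' fun hα => forall_congr' fun x => ?_
  rw [div_le_iff₀ (Real.rpow_pos_of_pos (temporalWeight_pos s x.2) _)]

theorem incrementNorm_le_ofReal_iff {N : ℝ} (hN : 0 ≤ N) (hvs : ∀ x, 0 < vs x)
    {Δ : OffPlane d → OffPlane d → S.Space} :
    incrementNorm S s v vs γ η Δ ≤ ENNReal.ofReal N ↔ ∀ (α : S.A), (α : ℝ) < γ →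
      ∀ x y : OffPlane d, x ≠ y → v x * ‖(Δ x y) α‖ ≤
        N * (min (temporalWeight s x) (temporalWeight s y) ^ (η - γ) * vs (x.1 - y.1) *
          scaledNorm s (y.1 - x.1) ^ (γ - α)) := by
  unfold incrementNorm
  simp only [iSup_le_iff, ENNReal.ofReal_le_ofReal_iff hN]
  refine forall_congr' fun α => forall_congr' fun hα => forall_congr' fun x =>
    forall_congr' fun y => forall_congr' fun hxy => ?_
  rw [div_le_iff₀]
  refine mul_pos (mul_pos (Real.rpow_pos_of_pos (lt_min (temporalWeight_pos s x.2)
    (temporalWeight_pos s y.2)) _) (hvs _)) (Real.rpow_pos_of_pos (scaledNorm_pos ?_) _)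
  exact sub_ne_zero.2 fun h => hxy (Subtype.ext h.symm)

end ModelBounds

/-! ### Limits of smooth models -/

section Models

open RegularityStructure

variable {d : ℕ} [NeZero d] {S : RegularityStructure.{u}} {s : Fin d → ℝ} {ℓ : ℝ}
  {G : (Fin d → ℝ) → ℝ} {Q : ℝ → (Fin d → ℝ) → (Fin d → ℝ) → ℝ}
  {w ws w₁ u : (Fin d → ℝ) → ℝ} {γ : ℝ}

/-- The families `(Q_t Π_x τ)` of a smooth model. -/
noncomputable def SmoothModel.familyPi (h : WeightedSemigroup s ℓ G Q w ws) (M : SmoothModel S s ℓ Q w ws)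
    (x : Fin d → ℝ) : S.Space →ₗ[ℝ] QFamily d where
  toFun τ := toQFamily Q (M.Pi x τ)
  map_add' τ σ := by
    funext t y
    obtain ⟨N, -, hN⟩ := (M.memCw x τ).weightedBound (s := s) h.weight.pos
    obtain ⟨N', -, hN'⟩ := (M.memCw x σ).weightedBound (s := s) h.weight.pos
    have e1 := h.integrable_kernel_mul le_rfl h.scaling_pos hN t.2 y
    have e2 := h.integrable_kernel_mul le_rfl h.scaling_pos hN' t.2 y
    simp only [toQFamily, Pi.add_apply, map_add, mul_add]
    exact integral_add e1 e2
  map_smul' c τ := by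
    funext t y
    simp only [toQFamily, Pi.smul_apply, map_smul, smul_eq_mul, RingHom.id_apply]
    rw [← integral_const_mul]
    exact integral_congr_ae (Eventually.of_forall fun z => by simp only []; ring)

namespace Model

/-- The norm of Π sees Q_t(x, Π_x τ) only at the base point of Π_x. Convergence of Q_t(y, Π_x τ) at
other points y comes from the Besov convergence. -/
theorem exists_approx (h : WeightedSemigroup s ℓ G Q w ws) (M : Model S s ℓ Q w ws w₁)
    (hww₁ : ∀ x, 0 < (w * w₁) x) :
    ∃ m : ℕ → SmoothModel S s ℓ Q w ws,
      (∀ γ : ℝ, Tendsto (fun n => piNorm S ℓ w γ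
        (fun x τ => ((m n).familyPi h x - M.Pi x) τ)) atTop (𝓝 0)) ∧
      (∀ x τ t y, Tendsto (fun n => (m n).familyPi h x τ t y) atTop (𝓝 (M.Pi x τ t y))) ∧
      (∀ x y τ β, Tendsto (fun n => ((m n).Gam x y τ) β) atTop (𝓝 ((M.Gam x y τ) β))) := by
  obtain ⟨m, h1, h2, h3⟩ := M.isLimit
  refine ⟨m, fun γ => ?_, fun x τ t y => ?_, h3⟩
  · exact tendsto_of_tendsto_of_tendsto_of_le_of_le tendsto_const_nhds (h1 γ)
      (fun _ => bot_le) fun _ => le_self_add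
  · obtain ⟨n₀, ε, hε, hle⟩ := exists_weighted_approx (h2 x τ)
    rw [← tendsto_add_atTop_iff_nat n₀, tendsto_iff_dist_tendsto_zero]
    set K := (t : ℝ) ^ (min S.regularity 0 / ℓ) * ((w * w₁) y)⁻¹ with hK
    refine squeeze_zero (fun _ => dist_nonneg) (g := fun n => ε n * K) (fun n => ?_)
      (by simpa using hε.mul_const K)
    rw [Real.dist_eq, hK, ← mul_assoc, ← div_eq_mul_inv, le_div_iff₀ (hww₁ y)]
    exact hle n t y

theorem gam_apply_eq_zero (h : WeightedSemigroup s ℓ G Q w ws) (M : Model S s ℓ Q w ws w₁)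
    (hww₁ : ∀ x, 0 < (w * w₁) x) (x y : Fin d → ℝ) {τ : S.Space}
    (hτ : ∀ α : S.A, γ ≤ α → τ α = 0) (β : S.A) (hβ : γ ≤ β) : (M.Gam x y τ) β = 0 := by
  obtain ⟨m, -, -, h3⟩ := M.exists_approx h hww₁
  have e := h3 x y τ β
  have e' : ∀ n, ((m n).Gam x y τ) β = 0 := fun n =>
    apply_eq_zero_of_mem_G ((m n).gam_mem x y) hτ hβ
  simp only [e'] at e
  exact tendsto_nhds_unique e tendsto_const_nhds

/-- An approximating smooth model has finite norm and lies at finite distance. -/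
theorem normPi_lt_top (h : WeightedSemigroup s ℓ G Q w ws) (M : Model S s ℓ Q w ws w₁)
    (hww₁ : ∀ x, 0 < (w * w₁) x) (γ : ℝ) : M.normPi γ < ⊤ := by
  obtain ⟨m, h1, -, -⟩ := M.exists_approx h hww₁
  obtain ⟨n, hn⟩ := ((h1 γ).eventually (gt_mem_nhds ENNReal.zero_lt_top)).exists
  have hn' : piNorm S ℓ w γ (fun x τ => (m n).familyPi h x τ) < ⊤ := (m n).piNorm_lt_top γ
  have e1 := (piNorm_le_ofReal_iff ENNReal.toReal_nonneg).1 (ENNReal.ofReal_toReal hn.ne).ge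
  have e2 := (piNorm_le_ofReal_iff ENNReal.toReal_nonneg).1 (ENNReal.ofReal_toReal hn'.ne).ge
  refine lt_of_le_of_lt ((piNorm_le_ofReal_iff (add_nonneg
    (ENNReal.toReal_nonneg (a := piNorm S ℓ w γ (fun x τ => ((m n).familyPi h x - M.Pi x) τ)))
    (ENNReal.toReal_nonneg (a := piNorm S ℓ w γ (fun x τ => (m n).familyPi h x τ))))).2
      fun α hα t x τ => ?_) ENNReal.ofReal_lt_top
  have k1 := e1 α hα t x τ
  have k2 := e2 α hα t x τ
  have k3 := abs_sub ((m n).familyPi h x (S.incl α τ) t x)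
    ((m n).familyPi h x (S.incl α τ) t x - M.Pi x (S.incl α τ) t x)
  rw [sub_sub_cancel] at k3
  have k4 := mul_le_mul_of_nonneg_right k3 (h.weight.pos x).le
  rw [add_mul] at k4
  rw [add_mul, add_mul, add_comm]
  exact k4.trans (add_le_add k2 k1)

/-- Change of base point in the limit. -/
theorem pi_gam_apply (h : WeightedSemigroup s ℓ G Q w ws) (M : Model S s ℓ Q w ws w₁)
    (hww₁ : ∀ x, 0 < (w * w₁) x) (y z : Fin d → ℝ) {τ : S.Space}
    (hτ : ∀ α : S.A, γ ≤ α → τ α = 0) (t : Ioc (0 : ℝ) 1) :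
    M.Pi z (M.Gam z y τ) t z = M.Pi y τ t z := by
  obtain ⟨m, h1, h2, h3⟩ := M.exists_approx h hww₁
  have hlim := h2 y τ t z
  have hpg : ∀ n, (m n).familyPi h y τ t z = (m n).familyPi h z ((m n).Gam z y τ) t z := fun n => by
    change toQFamily Q ((m n).Pi y τ) t z = toQFamily Q ((m n).Pi z ((m n).Gam z y τ)) t z
    rw [(m n).pi_gam]
  refine tendsto_nhds_unique ?_ hlim
  rw [tendsto_iff_dist_tendsto_zero]
  set σ := M.Gam z y τ with hσdef
  have hσ : ∀ α : S.A, γ ≤ α → σ α = 0 := M.gam_apply_eq_zero h hww₁ z y hτ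
  have hσn : ∀ n (α : S.A), γ ≤ α → ((m n).Gam z y τ) α = 0 := fun n α hα =>
    apply_eq_zero_of_mem_G ((m n).gam_mem z y) hτ hα
  set ε : ℕ → ℝ≥0∞ := fun n => piNorm S ℓ w γ (fun x τ => ((m n).familyPi h x - M.Pi x) τ) with hε
  have hε0 : Tendsto (fun n => (ε n).toReal) atTop (𝓝 0) := by
    have := (ENNReal.tendsto_toReal ENNReal.zero_ne_top).comp (h1 γ)
    rwa [ENNReal.toReal_zero] at this
  have hN := (ENNReal.ofReal_toReal (M.normPi_lt_top h hww₁ γ).ne).ge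
  set N := (M.normPi γ).toReal with hNdef
  have hlimσ : ∀ α : S.A, Tendsto (fun n => ‖((m n).Gam z y τ) α‖) atTop (𝓝 ‖σ α‖) := fun α =>
    (h3 z y τ α).norm
  have hlimσ' : ∀ α : S.A, Tendsto (fun n => ‖((m n).Gam z y τ - σ) α‖) atTop (𝓝 0) := fun α => by
    have := ((h3 z y τ α).sub_const (σ α)).norm
    rw [sub_self, norm_zero] at this
    simpa only [DirectSum.sub_apply] using this
  have hb1 : Tendsto (fun n => (ε n).toReal *
      ∑ α ∈ S.below γ, (t : ℝ) ^ ((α : ℝ) / ℓ) * ‖((m n).Gam z y τ) α‖) atTop (𝓝 0) := by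
    have := hε0.mul (tendsto_finsetSum (S.below γ) fun α _ =>
      (hlimσ α).const_mul ((t : ℝ) ^ ((α : ℝ) / ℓ)))
    rwa [zero_mul] at this
  have hb2 : Tendsto (fun n => N *
      ∑ α ∈ S.below γ, (t : ℝ) ^ ((α : ℝ) / ℓ) * ‖((m n).Gam z y τ - σ) α‖) atTop (𝓝 0) := by
    have := (tendsto_finsetSum (S.below γ) fun α _ =>
      (hlimσ' α).const_mul ((t : ℝ) ^ ((α : ℝ) / ℓ))).const_mul N
    simpa using this
  have hb := (hb1.add hb2).mul_const (w z)⁻¹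
  rw [add_zero, zero_mul] at hb
  refine squeeze_zero' (Eventually.of_forall fun _ => dist_nonneg) ?_ hb
  filter_upwards [(h1 γ).eventually (gt_mem_nhds ENNReal.zero_lt_top)] with n hn
  rw [dist_comm, Real.dist_eq, hpg, ← div_eq_mul_inv, le_div_iff₀ (h.weight.pos z)]
  have k1 := abs_apply_le_of_piNorm_le ENNReal.toReal_nonneg h.weight.pos
    (ENNReal.ofReal_toReal hn.ne).ge (hσn n) t z
  have k2 := abs_apply_le_of_piNorm_le (P := M.Pi) ENNReal.toReal_nonneg h.weight.pos hN
    (σ := (m n).Gam z y τ - σ) (fun α hα => by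
      rw [DirectSum.sub_apply, hσn n α hα, hσ α hα, sub_zero]) t z
  -- The first term is small because Π^n → Π in norm and Γ^n τ stays bounded, the second because Γ^n
  -- τ → Γτ in each of finitely many components. Both are tested at z, the base point of Π_z, where
  -- the norm of Π applies.
  have k3 : M.Pi z σ t z - (m n).familyPi h z ((m n).Gam z y τ) t z =
      -(((m n).familyPi h z - M.Pi z) ((m n).Gam z y τ) t z) -
        M.Pi z ((m n).Gam z y τ - σ) t z := by
    simp only [LinearMap.sub_apply, Pi.sub_apply, map_sub]
    ring
  rw [k3]
  refine (mul_le_mul_of_nonneg_right (abs_sub _ _) (h.weight.pos z).le).trans ?_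
  rw [abs_neg, add_mul]
  exact add_le_add k1 k2

/-- As w₁ ≤ 1, smooth approximants in C(w) lie in C(w w₁), so Π_x τ belongs to a Besov completion
for the weight w w₁. -/
theorem isSemigroupFamily_pi (h₁ : WeightedSemigroup s ℓ G Q (w * w₁) u)
    (hw : ∀ x, 0 < w x) (hw₁ : ∀ x, w₁ x ≤ 1)
    (M : Model S s ℓ Q w ws w₁) (x : Fin d → ℝ) (τ : S.Space) :
    IsSemigroupFamily Q (w * w₁) (M.Pi x τ) := by
  obtain ⟨m, -, h2, -⟩ := M.isLimit
  refine isSemigroupFamily_of_mem_besovCompletion (α := min S.regularity 0) h₁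
    ⟨fun n => (m n).Pi x τ, fun n => ⟨((m n).memCw x τ).1, ?_⟩, h2 x τ⟩
  obtain ⟨B, hB⟩ := ((m n).memCw x τ).2
  refine ⟨B, fun y => le_trans ?_ (hB y)⟩
  refine mul_le_mul_of_nonneg_left ?_ (abs_nonneg _)
  exact mul_le_of_le_one_right (hw y).le (hw₁ y)

end Model

end Models

/-! ### The reconstruction theorem -/

section Reconstruction

open RegularityStructure

variable {d : ℕ} [NeZero d] {S : RegularityStructure.{u}} {s : Fin d → ℝ} {ℓ : ℝ}
  {G : (Fin d → ℝ) → ℝ} {Q : ℝ → (Fin d → ℝ) → (Fin d → ℝ) → ℝ}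
  {w ws v vs w₁ u : (Fin d → ℝ) → ℝ} {γ η : ℝ}

namespace Model

theorem increment_apply_eq_zero (h : WeightedSemigroup s ℓ G Q w ws) (M : Model S s ℓ Q w ws w₁)
    (hww₁ : ∀ x, 0 < (w * w₁) x) {f : OffPlane d → S.Space}
    (hf : ∀ x (α : S.A), γ ≤ α → (f x) α = 0) (x y : OffPlane d) (α : S.A) (hα : γ ≤ α) :
    (increment M.Gam f x y) α = 0 := by
  rw [increment, DirectSum.sub_apply, hf y α hα, M.gam_apply_eq_zero h hww₁ y x (hf x) α hα,
    sub_zero]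

theorem pi_increment (h : WeightedSemigroup s ℓ G Q w ws) (M : Model S s ℓ Q w ws w₁)
    (hww₁ : ∀ x, 0 < (w * w₁) x) {f : OffPlane d → S.Space}
    (hf : ∀ x (α : S.A), γ ≤ α → (f x) α = 0) (y z : OffPlane d) (t : Ioc (0 : ℝ) 1) :
    M.Pi z (f z) t z - M.Pi y (f y) t z = M.Pi z (increment M.Gam f y z) t z := by
  rw [increment, map_sub, Pi.sub_apply, Pi.sub_apply, M.pi_gam_apply h hww₁ y z (hf y)]

end Model

/-- Combination of the bounds on `Π` and on the size of the coefficients. -/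
theorem abs_apply_mul_le_size (h : WeightedSemigroup s ℓ G Q w ws) (hv : ∀ x, 0 < v x)
    {P : (Fin d → ℝ) → S.Space →ₗ[ℝ] QFamily d} {N A : ℝ} (hN : 0 ≤ N) (hA : 0 ≤ A)
    (hP : piNorm S ℓ w γ (fun x τ => P x τ) ≤ ENNReal.ofReal N) {f : OffPlane d → S.Space}
    (hf : ∀ x (α : S.A), γ ≤ α → (f x) α = 0)
    (hsize : sizeNorm S s v γ η f ≤ ENNReal.ofReal A) (t : Ioc (0 : ℝ) 1) (y : OffPlane d) :
    |P y (f y) t y| * (w y * v y) ≤ N * A * ∑ α ∈ S.below γ, (t : ℝ) ^ ((α : ℝ) / ℓ) *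
      temporalWeight s y ^ (min (η - α) 0) := by
  rw [sizeNorm_le_ofReal_iff hA] at hsize
  have ht0 : 0 < (t : ℝ) := t.2.1
  have k1 := abs_apply_le_of_piNorm_le hN h.weight.pos hP (hf y) t y
  rw [← mul_assoc]
  refine (mul_le_mul_of_nonneg_right k1 (hv y).le).trans ?_
  rw [mul_assoc, mul_assoc N A, Finset.sum_mul]
  refine mul_le_mul_of_nonneg_left ?_ hN
  rw [Finset.mul_sum]
  refine Finset.sum_le_sum fun α hα => ?_
  have k2 := hsize α (mem_below.1 hα) y
  calc (t : ℝ) ^ ((α : ℝ) / ℓ) * ‖(f y) α‖ * v y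
      = (t : ℝ) ^ ((α : ℝ) / ℓ) * (v y * ‖(f y) α‖) := by ring
    _ ≤ (t : ℝ) ^ ((α : ℝ) / ℓ) * (A * temporalWeight s y ^ (min (η - α) 0)) := by gcongr
    _ = _ := by ring

/-- Combination of the bounds on `Π` and on the increments of the coefficients. -/
theorem abs_apply_mul_le_increment (h : WeightedSemigroup s ℓ G Q w ws) (hv : ∀ x, 0 < v x)
    (hvs : ∀ x, 0 < vs x)
    {P : (Fin d → ℝ) → S.Space →ₗ[ℝ] QFamily d} {N B : ℝ} (hN : 0 ≤ N) (hB : 0 ≤ B)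
    (hP : piNorm S ℓ w γ (fun x τ => P x τ) ≤ ENNReal.ofReal N)
    {Δ : OffPlane d → OffPlane d → S.Space} (hΔ : ∀ x y (α : S.A), γ ≤ α → (Δ x y) α = 0)
    (hinc : incrementNorm S s v vs γ η Δ ≤ ENNReal.ofReal B) (t : Ioc (0 : ℝ) 1)
    (y z : OffPlane d) (hyz : y ≠ z) :
    |P z (Δ y z) t z| * (w z * v y) ≤ N * B * ∑ α ∈ S.below γ, (t : ℝ) ^ ((α : ℝ) / ℓ) *
      (min (temporalWeight s y) (temporalWeight s z) ^ (η - γ) * vs (y.1 - z.1) *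
        scaledNorm s (z.1 - y.1) ^ (γ - α)) := by
  rw [incrementNorm_le_ofReal_iff hB hvs] at hinc
  have ht0 : 0 < (t : ℝ) := t.2.1
  have k1 := abs_apply_le_of_piNorm_le hN h.weight.pos hP (hΔ y z) t z
  rw [← mul_assoc]
  refine (mul_le_mul_of_nonneg_right k1 (hv y).le).trans ?_
  rw [mul_assoc, mul_assoc N B, Finset.sum_mul]
  refine mul_le_mul_of_nonneg_left ?_ hN
  rw [Finset.mul_sum]
  refine Finset.sum_le_sum fun α hα => ?_
  have k2 := hinc α (mem_below.1 hα) y z hyz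
  calc (t : ℝ) ^ ((α : ℝ) / ℓ) * ‖(Δ y z) α‖ * v y
      = (t : ℝ) ^ ((α : ℝ) / ℓ) * (v y * ‖(Δ y z) α‖) := by ring
    _ ≤ (t : ℝ) ^ ((α : ℝ) / ℓ) * (B * (min (temporalWeight s y) (temporalWeight s z) ^ (η - γ) *
        vs (y.1 - z.1) * scaledNorm s (z.1 - y.1) ^ (γ - α))) := by gcongr
    _ = _ := by ring

namespace Model

/-- The local distributions `Π_x f(x)`. -/
noncomputable def localFamily (M : Model S s ℓ Q w ws w₁) (f : OffPlane d → S.Space) (x : OffPlane d) :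
    QFamily d :=
  M.Pi x (f x)

theorem isLocalFamily (h : WeightedSemigroup s ℓ G Q w ws)
    (h₁ : WeightedSemigroup s ℓ G Q (w * w₁) u) (hw₁ : ∀ x, w₁ x ≤ 1) (hv : ∀ x, 0 < v x)
    (hvs : ∀ x, 0 < vs x) (M : Model S s ℓ Q w ws w₁) {f : OffPlane d → S.Space}
    (hf : ∀ x (α : S.A), γ ≤ α → (f x) α = 0) {N A B : ℝ} (hN : 0 ≤ N) (hA : 0 ≤ A) (hB : 0 ≤ B)
    (hP : M.normPi γ ≤ ENNReal.ofReal N) (hsize : sizeNorm S s v γ η f ≤ ENNReal.ofReal A)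
    (hinc : sharpNorm S s v vs γ η M.Gam f ≤ ENNReal.ofReal B) :
    IsLocalFamily s ℓ Q w v vs (w * w₁) (S.below γ) (fun α => (α : ℝ)) γ η (N * A) (N * B)
      (M.localFamily f) where
  family y := M.isSemigroupFamily_pi h₁ h.weight.pos hw₁ y (f y)
  size t y := abs_apply_mul_le_size h hv hN hA hP hf hsize t y
  increment t y z hyz := by
    change |M.Pi z (f z) t z - M.Pi y (f y) t z| * _ ≤ _
    rw [M.pi_increment h h₁.weight.pos hf]
    exact abs_apply_mul_le_increment h hv hvs hN hB hP
      (M.increment_apply_eq_zero h h₁.weight.pos hf) hinc t y z hyz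

/-- The splitting Πf - Π'f' = (Π - Π')f + Π'(f - f'), and the same one with increments of f and f'.
The term `D * R` appears in both bounds; differences of Γ enter only through the increments. -/
theorem isLocalFamily_sub (h : WeightedSemigroup s ℓ G Q w ws)
    (h₁ : WeightedSemigroup s ℓ G Q (w * w₁) u) (hw₁ : ∀ x, w₁ x ≤ 1) (hv : ∀ x, 0 < v x)
    (hvs : ∀ x, 0 < vs x) (M M' : Model S s ℓ Q w ws w₁) {f f' : OffPlane d → S.Space}
    (hf : ∀ x (α : S.A), γ ≤ α → (f x) α = 0) (hf' : ∀ x (α : S.A), γ ≤ α → (f' x) α = 0)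
    {R D A B : ℝ} (hR : 0 ≤ R) (hD : 0 ≤ D) (hA : 0 ≤ A) (hB : 0 ≤ B)
    (hP' : M'.normPi γ ≤ ENNReal.ofReal R) (hPD : M.distPi M' γ ≤ ENNReal.ofReal D)
    (hsize : sizeNorm S s v γ η f ≤ ENNReal.ofReal R)
    (hsizeA : sizeNorm S s v γ η (f - f') ≤ ENNReal.ofReal A)
    (hinc : sharpNorm S s v vs γ η M.Gam f ≤ ENNReal.ofReal R)
    (hincB : sharpDist S s v vs γ η M.Gam M'.Gam f f' ≤ ENNReal.ofReal B) :
    IsLocalFamily s ℓ Q w v vs (w * w₁) (S.below γ) (fun α => (α : ℝ)) γ η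
      (D * R + R * A) (D * R + R * B) (M.localFamily f - M'.localFamily f') where
  family y := (M.isSemigroupFamily_pi h₁ h.weight.pos hw₁ y (f y)).sub h₁
    (M'.isSemigroupFamily_pi h₁ h.weight.pos hw₁ y (f' y))
  size t y := by
    have hPD' : piNorm S ℓ w γ (fun x τ => (M.Pi x - M'.Pi x) τ) ≤ ENNReal.ofReal D := hPD
    have k1 := abs_apply_mul_le_size h hv hD hR hPD' hf hsize t y
    have k2 := abs_apply_mul_le_size h hv hR hA hP' (f := f - f') (fun x α hα => by
      rw [Pi.sub_apply, DirectSum.sub_apply, hf x α hα, hf' x α hα, sub_zero]) hsizeA t y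
    have e : (M.localFamily f - M'.localFamily f') y t y =
        (M.Pi y - M'.Pi y) (f y) t y + M'.Pi y ((f - f') y) t y := by
      simp only [localFamily, Pi.sub_apply, LinearMap.sub_apply, map_sub]
      ring
    rw [e]
    refine (mul_le_mul_of_nonneg_right (abs_add_le _ _)
      (mul_pos (h.weight.pos y) (hv y)).le).trans ?_
    rw [add_mul, add_mul]
    exact add_le_add k1 k2
  increment t y z hyz := by
    have hPD' : piNorm S ℓ w γ (fun x τ => (M.Pi x - M'.Pi x) τ) ≤ ENNReal.ofReal D := hPD
    have hz := M.increment_apply_eq_zero h h₁.weight.pos hf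
    have hz' := M'.increment_apply_eq_zero h h₁.weight.pos hf'
    have k1 := abs_apply_mul_le_increment h hv hvs hD hR hPD' hz hinc t y z hyz
    have k2 := abs_apply_mul_le_increment h hv hvs hR hB hP'
      (Δ := increment M.Gam f - increment M'.Gam f') (fun x y α hα => by
        rw [Pi.sub_apply, Pi.sub_apply, DirectSum.sub_apply, hz x y α hα, hz' x y α hα,
          sub_zero]) hincB t y z hyz
    have e : (M.localFamily f - M'.localFamily f') z t z -
        (M.localFamily f - M'.localFamily f') y t z =
        (M.Pi z - M'.Pi z) (increment M.Gam f y z) t z +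
          M'.Pi z ((increment M.Gam f - increment M'.Gam f') y z) t z := by
      have e1 := M.pi_increment h h₁.weight.pos hf y z t
      have e2 := M'.pi_increment h h₁.weight.pos hf' y z t
      simp only [localFamily, Pi.sub_apply, LinearMap.sub_apply, map_sub]
      linarith
    rw [e]
    refine (mul_le_mul_of_nonneg_right (abs_add_le _ _)
      (mul_pos (h.weight.pos z) (hv y)).le).trans ?_
    rw [add_mul, add_mul]
    exact add_le_add k1 k2

theorem distPi_lt_top (h : WeightedSemigroup s ℓ G Q w ws) (M M' : Model S s ℓ Q w ws w₁)
    (hww₁ : ∀ x, 0 < (w * w₁) x) (γ : ℝ) : M.distPi M' γ < ⊤ := by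
  have e1 := (piNorm_le_ofReal_iff (P := M.Pi) ENNReal.toReal_nonneg).1
    (ENNReal.ofReal_toReal (M.normPi_lt_top h hww₁ γ).ne).ge
  have e2 := (piNorm_le_ofReal_iff (P := M'.Pi) ENNReal.toReal_nonneg).1
    (ENNReal.ofReal_toReal (M'.normPi_lt_top h hww₁ γ).ne).ge
  refine lt_of_le_of_lt ((piNorm_le_ofReal_iff (P := fun x => M.Pi x - M'.Pi x) (add_nonneg
    (ENNReal.toReal_nonneg (a := M.normPi γ)) (ENNReal.toReal_nonneg (a := M'.normPi γ)))).2
      fun α hα t x τ => ?_) ENNReal.ofReal_lt_top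
  refine (mul_le_mul_of_nonneg_right (abs_sub _ _) (h.weight.pos x).le).trans ?_
  rw [add_mul, add_mul, add_mul]
  exact add_le_add (e1 α hα t x τ) (e2 α hα t x τ)

end Model

/-! ### Finiteness of the distances between modelled distributions. -/

theorem sizeNorm_sub_lt_top (hv : ∀ x, 0 < v x) {f f' : OffPlane d → S.Space}
    (hf : sizeNorm S s v γ η f < ⊤) (hf' : sizeNorm S s v γ η f' < ⊤) :
    sizeNorm S s v γ η (f - f') < ⊤ := by
  have e1 := (sizeNorm_le_ofReal_iff ENNReal.toReal_nonneg).1 (ENNReal.ofReal_toReal hf.ne).ge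
  have e2 := (sizeNorm_le_ofReal_iff ENNReal.toReal_nonneg).1 (ENNReal.ofReal_toReal hf'.ne).ge
  refine lt_of_le_of_lt ((sizeNorm_le_ofReal_iff (add_nonneg
    (ENNReal.toReal_nonneg (a := sizeNorm S s v γ η f))
    (ENNReal.toReal_nonneg (a := sizeNorm S s v γ η f')))).2
      fun α hα x => ?_) ENNReal.ofReal_lt_top
  rw [Pi.sub_apply, DirectSum.sub_apply]
  refine (mul_le_mul_of_nonneg_left (norm_sub_le _ _) (hv x).le).trans ?_
  rw [mul_add, add_mul]
  exact add_le_add (e1 α hα x) (e2 α hα x)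

theorem incrementNorm_sub_lt_top (hv : ∀ x, 0 < v x) (hvs : ∀ x, 0 < vs x)
    {Δ Δ' : OffPlane d → OffPlane d → S.Space}
    (hΔ : incrementNorm S s v vs γ η Δ < ⊤) (hΔ' : incrementNorm S s v vs γ η Δ' < ⊤) :
    incrementNorm S s v vs γ η (Δ - Δ') < ⊤ := by
  have e1 := (incrementNorm_le_ofReal_iff ENNReal.toReal_nonneg hvs).1
    (ENNReal.ofReal_toReal hΔ.ne).ge
  have e2 := (incrementNorm_le_ofReal_iff ENNReal.toReal_nonneg hvs).1
    (ENNReal.ofReal_toReal hΔ'.ne).ge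
  refine lt_of_le_of_lt ((incrementNorm_le_ofReal_iff (add_nonneg
    (ENNReal.toReal_nonneg (a := incrementNorm S s v vs γ η Δ))
    (ENNReal.toReal_nonneg (a := incrementNorm S s v vs γ η Δ'))) hvs).2
      fun α hα x y hxy => ?_) ENNReal.ofReal_lt_top
  rw [Pi.sub_apply, Pi.sub_apply, DirectSum.sub_apply]
  refine (mul_le_mul_of_nonneg_left (norm_sub_le _ _) (hv x).le).trans ?_
  rw [mul_add, add_mul]
  exact add_le_add (e1 α hα x y hxy) (e2 α hα x y hxy)

end Reconstruction

theorem theorem3 {d : ℕ} [NeZero d] (s : Fin d → ℝ) (hs : ∀ i, 1 ≤ s i)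
    (ℓ : ℝ) (hℓ : 0 < ℓ)
    (G : (Fin d → ℝ) → ℝ) (hG : Measurable G) (hG0 : ∀ x, 0 ≤ G x)
    (Q : ℝ → (Fin d → ℝ) → (Fin d → ℝ) → ℝ) (hQ : IsGTypeSemigroup s ℓ G Q)
    (S : RegularityStructure.{u})
    (w ws v vs w₁ w₁s w₂ w₂s : (Fin d → ℝ) → ℝ)
    (hw : GControlled s ℓ G w ws) (hv : GControlled s ℓ G v vs)
    (hwv : GControlled s ℓ G (w * v) (ws * vs))
    (hw₁ : GControlled s ℓ G w₁ w₁s) (hw₂ : GControlled s ℓ G w₂ w₂s)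
    (hww₁ : ∃ u, GControlled s ℓ G (w * w₁) u) (hww₂ : ∃ u, GControlled s ℓ G (w * w₂) u)
    (hdec : ∀ n : ℕ, ∃ B : ℝ, ∀ x, scaledNorm s x ^ n * ws x * w₁ x ≤ B ∧
      scaledNorm s x ^ n * w₁s x * w₂ x ≤ B)
    (γ η : ℝ) (hγ : 0 < γ) (hη : η ∈ Ioc (γ - s 0) γ)
    (ζ : ℝ) (hζ : ζ = min (min η S.regularity) 0) :
    (∀ (M : Model S s ℓ Q w ws w₁), ∀ f ∈ DSharp S s v vs γ η M.Gam,
      ∃! Λ, IsReconstruction v γ η ζ M f Λ) ∧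
    (∃ C : ℝ≥0, ∀ (M : Model S s ℓ Q w ws w₁), ∀ f ∈ DSharp S s v vs γ η M.Gam,
      ∀ Λ, IsReconstruction v γ η ζ M f Λ →
        besovNorm ℓ ζ (w * v) Λ
          ≤ C * (M.normPi γ * tripleSharpNorm S s v vs γ η M.Gam f) ∧
        localNorm s ℓ γ η (w * v) (localError M f Λ)
          ≤ C * (M.normPi γ * sharpNorm S s v vs γ η M.Gam f)) ∧
    (∃ a b : ℝ, (∀ R : ℝ, 0 < R → 0 < a + b * R) ∧
      ∀ R : ℝ, 0 < R → ∀ (M M' : Model S s ℓ Q w ws w₁),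
        ∀ f ∈ DSharp S s v vs γ η M.Gam, ∀ f' ∈ DSharp S s v vs γ η M'.Gam,
        M.tripleNorm γ ≤ ENNReal.ofReal R → M'.tripleNorm γ ≤ ENNReal.ofReal R →
        tripleSharpNorm S s v vs γ η M.Gam f ≤ ENNReal.ofReal R →
        tripleSharpNorm S s v vs γ η M'.Gam f' ≤ ENNReal.ofReal R →
        ∀ Λ Λ', IsReconstruction v γ η ζ M f Λ → IsReconstruction v γ η ζ M' f' Λ' →
          besovNorm ℓ ζ (w * v) (Λ - Λ')
            ≤ ENNReal.ofReal (a + b * R) *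
              (M.distPi M' γ + tripleSharpDist S s v vs γ η M.Gam M'.Gam f f') ∧
          localNorm s ℓ γ η (w * v) (localError M f Λ - localError M' f' Λ')
            ≤ ENNReal.ofReal (a + b * R) *
              (M.distPi M' γ + sharpDist S s v vs γ η M.Gam M'.Gam f f')) := by
  have hℓs : WeightedSemigroup s ℓ G Q w ws := ⟨hs, hℓ, hG0, hQ, hw⟩
  have h : WeightedSemigroup s ℓ G Q (w * v) (ws * vs) := ⟨hs, hℓ, hG0, hQ, hwv⟩
  obtain ⟨u₁, hu₁⟩ := hww₁
  have h₁ : WeightedSemigroup s ℓ G Q (w * w₁) u₁ := ⟨hs, hℓ, hG0, hQ, hu₁⟩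
  have hvs : ∀ x, 0 < vs x := fun x => zero_lt_one.trans_le (hv.one_le_star x)
  have hη' : γ - η < s 0 := by linarith [hη.1]
  have hζ0 : ζ ≤ 0 := hζ.trans_le (min_le_right _ _)
  have hζη : ζ ≤ η := hζ.trans_le ((min_le_left _ _).trans (min_le_left _ _))
  have hζα : ∀ α ∈ S.below γ, ζ ≤ (α : ℝ) := fun α _ => hζ.trans_le
    (((min_le_left _ _).trans (min_le_right _ _)).trans (RegularityStructure.regularity_le α))
  obtain ⟨C, hC, hrec⟩ := IsLocalFamily.exists_reconstruction h hw hv h₁ (S.below γ)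
    (fun α => (α : ℝ)) hγ (fun α hα => RegularityStructure.mem_below.1 hα) hη.2 hη' hζη hζα
  -- Existence with bounds, for a single model and modelled distribution.
  have hex : ∀ (M : Model S s ℓ Q w ws w₁), ∀ f ∈ DSharp S s v vs γ η M.Gam,
      ∃ Λ, IsReconstruction v γ η ζ M f Λ ∧
        besovNorm ℓ ζ (w * v) Λ ≤
          ENNReal.ofReal C * (M.normPi γ * tripleSharpNorm S s v vs γ η M.Gam f) ∧
        localNorm s ℓ γ η (w * v) (localError M f Λ) ≤
          ENNReal.ofReal C * (M.normPi γ * sharpNorm S s v vs γ η M.Gam f) := by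
    intro M f hf
    have hP := M.normPi_lt_top hℓs hu₁.pos γ
    obtain ⟨hsize, hinc⟩ := ENNReal.add_lt_top.1 hf.2
    have eP := ENNReal.ofReal_toReal hP.ne
    have eA := ENNReal.ofReal_toReal hsize.ne
    have eB := ENNReal.ofReal_toReal hinc.ne
    set N := (M.normPi γ).toReal
    set A := (sizeNorm S s v γ η f).toReal
    set B := (sharpNorm S s v vs γ η M.Gam f).toReal
    have hN0 : 0 ≤ N := ENNReal.toReal_nonneg
    have hA0 : 0 ≤ A := ENNReal.toReal_nonneg
    have hB0 : 0 ≤ B := ENNReal.toReal_nonneg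
    obtain ⟨Λ, hΛ, hb, hl⟩ := hrec (N * A) (N * B) (by positivity) (by positivity) _
      (M.isLocalFamily hℓs h₁ hw₁.le_one hv.pos hvs hf.1 hN0 hA0 hB0 eP.ge eA.ge eB.ge)
    refine ⟨Λ, ⟨hΛ.mem_besovSpace h hζ0 (hb.trans_lt ENNReal.ofReal_lt_top),
      lt_of_le_of_lt hl ENNReal.ofReal_lt_top⟩, hb.trans (le_of_eq ?_), le_trans hl (le_of_eq ?_)⟩
    · rw [tripleSharpNorm, ← eP, ← eA, ← eB, ← ENNReal.ofReal_add hA0 hB0,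
        ← ENNReal.ofReal_mul hN0, ← ENNReal.ofReal_mul hC.le, mul_add N A B]
    · rw [← eP, ← eB, ← ENNReal.ofReal_mul hN0, ← ENNReal.ofReal_mul hC.le]
  -- Both families are close to the same germ. Uniqueness also transfers the bounds from the
  -- constructed reconstruction to an arbitrary one.
  have huniq : ∀ (M : Model S s ℓ Q w ws w₁) (f : OffPlane d → S.Space) (Λ Λ' : QFamily d),
      IsReconstruction v γ η ζ M f Λ → IsReconstruction v γ η ζ M f Λ' → Λ = Λ' :=
    fun M f Λ Λ' hΛ hΛ' => IsSemigroupFamily.eq_of_localNorm_lt_top h hγ hη.2 hη'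
      (isSemigroupFamily_of_mem_besovSpace h hΛ.1) (isSemigroupFamily_of_mem_besovSpace h hΛ'.1)
      (E := fun t x => M.Pi x (f x) t x) hΛ.2 hΛ'.2
  -- The affine function is R ↦ 2CR: the distance of the Π's enters both the size and the increment
  -- bound, whence the factor 2.
  refine ⟨fun M f hf => ?_, ⟨C.toNNReal, fun M f hf Λ hΛ => ?_⟩, 0, 2 * C, fun R hR => ?_,
    fun R hR M M' f hf f' hf' hM hM' hfR hfR' Λ Λ' hΛ hΛ' => ?_⟩
  · obtain ⟨Λ, hΛ, -⟩ := hex M f hf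
    exact ⟨Λ, hΛ, fun Λ' hΛ' => huniq M f Λ' Λ hΛ' hΛ⟩
  · obtain ⟨Λ', hΛ', hb, hl⟩ := hex M f hf
    rw [huniq M f Λ Λ' hΛ hΛ']
    exact ⟨hb, hl⟩
  · rw [zero_add]
    positivity
  · obtain ⟨hsize, hinc⟩ := ENNReal.add_lt_top.1 hf.2
    obtain ⟨hsize', hinc'⟩ := ENNReal.add_lt_top.1 hf'.2
    have eD := ENNReal.ofReal_toReal (M.distPi_lt_top hℓs M' hu₁.pos γ).ne
    have eA := ENNReal.ofReal_toReal (sizeNorm_sub_lt_top hv.pos hsize hsize').ne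
    have hincD : sharpDist S s v vs γ η M.Gam M'.Gam f f' < ⊤ :=
      incrementNorm_sub_lt_top hv.pos hvs hinc hinc'
    have eB := ENNReal.ofReal_toReal hincD.ne
    set D := (M.distPi M' γ).toReal
    set A := (sizeNorm S s v γ η (f - f')).toReal
    set B := (sharpDist S s v vs γ η M.Gam M'.Gam f f').toReal
    have hD0 : 0 ≤ D := ENNReal.toReal_nonneg
    have hA0 : 0 ≤ A := ENNReal.toReal_nonneg
    have hB0 : 0 ≤ B := ENNReal.toReal_nonneg
    -- The difference of the two local families is reconstructed directly; the result is then
    -- identified with Λ - Λ' by uniqueness.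
    obtain ⟨Λ₀, hΛ₀, hb, hl⟩ := hrec (D * R + R * A) (D * R + R * B) (by positivity)
      (by positivity) _ (M.isLocalFamily_sub hℓs h₁ hw₁.le_one hv.pos hvs M' hf.1 hf'.1 hR.le hD0
        hA0 hB0 (le_self_add.trans hM') eD.ge (le_self_add.trans hfR) eA.ge
        (le_add_self.trans hfR) eB.ge)
    have hsf := isSemigroupFamily_of_mem_besovSpace h hΛ.1
    have hsf' := isSemigroupFamily_of_mem_besovSpace h hΛ'.1
    have eloc : (fun (t : Ioc (0 : ℝ) 1) (x : OffPlane d) =>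
        (Λ - Λ') t x - (M.localFamily f - M'.localFamily f') x t x) =
        localError M f Λ - localError M' f' Λ' := by
      funext t x
      simp only [localError, Model.localFamily, Pi.sub_apply]
      ring
    -- Mere finiteness of this norm suffices for the identification; the quantitative bound comes
    -- from Λ₀.
    have hfin : localNorm s ℓ γ η (w * v) (localError M f Λ - localError M' f' Λ') < ⊤ := by
      have k1 := (localNorm_le_ofReal_iff ENNReal.toReal_nonneg).1
        (ENNReal.ofReal_toReal hΛ.2.ne).ge
      have k2 := (localNorm_le_ofReal_iff ENNReal.toReal_nonneg).1
        (ENNReal.ofReal_toReal hΛ'.2.ne).ge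
      refine lt_of_le_of_lt ((localNorm_le_ofReal_iff (add_nonneg
        (ENNReal.toReal_nonneg (a := localNorm s ℓ γ η (w * v) (localError M f Λ)))
        (ENNReal.toReal_nonneg (a := localNorm s ℓ γ η (w * v) (localError M' f' Λ'))))).2
          fun t x => ?_) ENNReal.ofReal_lt_top
      refine (mul_le_mul_of_nonneg_right (abs_sub _ _) (hwv.pos x).le).trans ?_
      rw [add_mul, add_mul, add_mul]
      exact add_le_add (k1 t x) (k2 t x)
    have heq : Λ - Λ' = Λ₀ := IsSemigroupFamily.eq_of_localNorm_lt_top h hγ hη.2 hη'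
      (hsf.sub h hsf') hΛ₀ (E := fun t x => (M.localFamily f - M'.localFamily f') x t x)
      (by rw [eloc]; exact hfin) (lt_of_le_of_lt hl ENNReal.ofReal_lt_top)
    have hCR : 0 ≤ C * R := by positivity
    have hCR2 : 0 ≤ 2 * C * R := by positivity
    rw [← heq, eloc] at hl
    rw [← heq] at hb
    rw [zero_add]
    constructor
    · refine hb.trans ?_
      rw [tripleSharpDist, ← eD, ← eA, ← eB, ← ENNReal.ofReal_add hA0 hB0,
        ← ENNReal.ofReal_add hD0 (by positivity), ← ENNReal.ofReal_mul hCR2]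
      refine ENNReal.ofReal_le_ofReal ?_
      nlinarith [mul_nonneg hCR hA0, mul_nonneg hCR hB0]
    · refine hl.trans ?_
      rw [← eD, ← eB, ← ENNReal.ofReal_add hD0 hB0, ← ENNReal.ofReal_mul hCR2]
      refine ENNReal.ofReal_le_ofReal ?_
      nlinarith [mul_nonneg hCR hD0, mul_nonneg hCR hB0]
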